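/- Let $\mathfrak g$ be a symmetrizable Kac–Moody algebra, with simple roots $\alpha_i$, simple coroots $\alpha_i^\vee$ ($i$ in a finite index set), simple reflections $s_i$ and Weyl group $W$, ordered by the (strong) Bruhat order $\le$. Let $\lambda,\mu$ be dominant integral weights, with stabilizers $W_\lambda,W_\mu$ in $W$. Let $P_\lambda$ be the set of Lakshmibai–Seshadri (LS) paths of shape $\lambda$: these are given by cosets $\tau_1>\dots>\tau_r$ in $W/W_\lambda$ and rationals $0=a_0<a_1<\dots<a_r=1$ such that for $1\le j<r$ there is an $a_j$-chain from $\tau_j$ to $\tau_{j+1}$, i.e. a sequence $\tau_j=\kappa_0>\kappa_1>\dots>\kappa_m=\tau_{j+1}$ in $W/W_\lambda$ with $\kappa_k=s_{\beta_k}\kappa_{k-1}$ for real roots $\beta_k$, $\ell(\kappa_k)=\ell(\kappa_{k-1})-1$ and $a_j\langle\kappa_{k-1}\lambda,\beta_k^\vee\rangle\in\mathbb Z$; the path starts at $0$ and has velocity $\tau_j\lambda$ on $[a_{j-1},a_j]$. Call $\tau_1$ its initial and $\tau_r$ its final direction. Define $P_\mu$ likewise, and let $P_\lambda * P_\mu$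 be the set of concatenations $\pi*\pi'$ with $\pi\in P_\lambda$, $\pi'\in P_\mu$. Let $e_\alpha,f_\alpha$ ($\alpha$ a simple root) be Littelmann's root operators on paths. For $\pi*\pi'\in P_\lambda*P_\mu$ put $$w(\pi*\pi')=\min\bigl(W_\lambda\,[e,\tau^{-1}]\,\varphi\,W_\mu\bigr),\qquad [e,\tau^{-1}]=\{\sigma\in W:\sigma\le\tau^{-1}\},$$ where $\tau,\varphi\in W$ are lifts of the final direction of $\pi$ and of the initial direction of $\pi'$, and $\min$ is the unique minimal element in the Bruhat order. Let $\sim$ be the reflexive and transitive closure of the relation on $P_\lambda*P_\mu$ in which $\theta$ is related to $\theta'$ if $\theta=e_\alpha\theta'$ or $\theta=f_\alpha\theta'$ for some simple root $\alpha$. For $w\in W$ the KK set of the double coset $W_\lambda wW_\mu$ is $\{\theta\in P_\lambda*P_\mu : w(\theta)\le w\}$. Then: 0. The unique minimal element above exists and does not depend on the lifts $\tau,\varphi$, so $w(\pi*\pi')$ is well defined. 1. For every $\pi*\pi'\in P_\lambda*P_\mu$ and every simple root $\alpha$, every local minimum value on $[0,1]$ (in the non-strict sense, end points included) of $t\mapsto\langle(\pi*\pi')(t),\alpha^\vee\rangle$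 is an integer. 2. If $e_\alpha(\pi*\pi')$ does not vanish, then it equals $e_\alpha\pi*\pi'$ with $e_\alpha\pi\in P_\lambda$, or $\pi*e_\alpha\pi'$ with $e_\alpha\pi'\in P_\mu$. 3. If $e_\alpha(\pi*\pi')$ does not vanish, then it lies in $P_\lambda*P_\mu$ and $w(e_\alpha(\pi*\pi'))=w(\pi*\pi')$; the same holds for $f_\alpha$. 4. The relation $\sim$ is an equivalence relation, and $\theta\mapsto w(\theta)$ is constant on its equivalence classes. 5. The KK set of a double coset does not depend on the choice of the representative $w$, and it is a union of equivalence classes of $\sim$. -/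

import Mathlib

noncomputable section

/-- A symmetrizable generalized Cartan matrix `cartan` together with a realization of it:
`E` is the real form of the dual `𝔥*` of the Cartan subalgebra of the corresponding symmetrizable
Kac-Moody algebra, `root i` are the simple roots, `coroot i` are the simple coroots, and the entry
`cartan i j` is the pairing of the `j`-th simple root with the `i`-th simple coroot. The space `E`
is not required to have the minimal possible dimension. -/
structure KacMoodyDatum (ι : Type*) (E : Type*) [AddCommGroup E] [Module ℝ E] where
  cartan : Matrix ι ι ℤ
  cartan_diag : ∀ i, cartan i i = 2
  cartan_offDiag : ∀ i j, i ≠ j → cartan i j ≤ 0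
  cartan_zero : ∀ i j, cartan i j = 0 → cartan j i = 0
  symmetrizable : ∃ d : ι → ℝ, (∀ i, 0 < d i) ∧
    ∀ i j, d i * (cartan i j : ℝ) = d j * (cartan j i : ℝ)
  root : ι → E
  coroot : ι → Module.Dual ℝ E
  root_linearIndependent : LinearIndependent ℝ root
  coroot_linearIndependent : LinearIndependent ℝ coroot
  coroot_root : ∀ i j, coroot i (root j) = (cartan i j : ℝ)

namespace KacMoodyDatum

section

variable {ι E : Type*} [AddCommGroup E] [Module ℝ E] (D : KacMoodyDatum ι E)

theorem coroot_root_self (i : ι) : D.coroot i (D.root i) = 2 := by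
  rw [D.coroot_root, D.cartan_diag]
  norm_num

/-- The simple reflection `s_i : x ↦ x - ⟨x, α_i^∨⟩ α_i`. -/
def simpleReflection (i : ι) : E ≃ₗ[ℝ] E :=
  Module.reflection (D.coroot_root_self i)

/-- The Weyl group: the group of automorphisms of `E` generated by the simple reflections. -/
def weylGroup : Subgroup (E ≃ₗ[ℝ] E) :=
  Subgroup.closure (Set.range D.simpleReflection)

/-- The simple reflections, as elements of the Weyl group. -/
def s (i : ι) : D.weylGroup :=
  ⟨D.simpleReflection i, Subgroup.subset_closure ⟨i, rfl⟩⟩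

/-- The length of `w`: the least length of a word in the simple reflections with product `w`. -/
def length (w : D.weylGroup) : ℕ :=
  sInf {n | ∃ l : List ι, l.length = n ∧ (l.map D.s).prod = w}

/-- The (strong) Bruhat order on the Weyl group: the reflexive and transitive closure of the
relation `x → t x` for `t` a reflection (a conjugate of a simple reflection) with
`ℓ(x) < ℓ(t x)`. -/
def bruhatLE : D.weylGroup → D.weylGroup → Prop :=
  Relation.ReflTransGen fun x y =>
    (∃ (w : D.weylGroup) (i : ι), y = (w * D.s i * w⁻¹) * x) ∧ D.length x < D.length y

/-- `w` is the unique minimal element of the set `K` in the Bruhat order. (Every element of `K`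
lies above some minimal one, so the unique minimal element is the least one.) -/
def IsBruhatMin (K : Set D.weylGroup) (w : D.weylGroup) : Prop :=
  w ∈ K ∧ ∀ x ∈ K, D.bruhatLE w x

/-- Dominant integral weights. -/
def IsDominantIntegral (lam : E) : Prop :=
  ∀ i, ∃ n : ℕ, D.coroot i lam = (n : ℝ)

/-- The stabilizer `W_λ` of `λ` in the Weyl group. -/
abbrev stab (lam : E) : Subgroup D.weylGroup :=
  MulAction.stabilizer D.weylGroup lam

/-- The coset space `W / W_λ`. -/
abbrev Cosets (lam : E) : Type _ :=
  D.weylGroup ⧸ D.stab lam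

variable {D}

/-- The weight `κ λ`, for a coset `κ` in `W / W_λ`. -/
def cosetWeight {lam : E} (κ : D.Cosets lam) : E :=
  MulAction.ofQuotientStabilizer D.weylGroup lam κ

/-- The set of lifts to `W` of a coset in `W / W_λ`. -/
def lifts {lam : E} (κ : D.Cosets lam) : Set D.weylGroup :=
  {w | (w : D.Cosets lam) = κ}

/-- The length of a coset: the minimal length of a representative. -/
def cosetLength {lam : E} (κ : D.Cosets lam) : ℕ :=
  sInf (D.length '' lifts κ)

/-- The Bruhat order on `W / W_λ`: the Bruhat order on minimal representatives. -/
def cosetLE {lam : E} (κ κ' : D.Cosets lam) : Prop :=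
  ∃ u v, D.IsBruhatMin (lifts κ) u ∧ D.IsBruhatMin (lifts κ') v ∧ D.bruhatLE u v

/-- One step `κ > κ' = s_β κ` of an `a`-chain, where `β = w α_i` is a real root,
`ℓ(κ') = ℓ(κ) - 1`, and `a ⟨κ λ, β^∨⟩` is an integer; here `⟨x, β^∨⟩ = ⟨w⁻¹ x, α_i^∨⟩`. -/
def ChainStep {lam : E} (a : ℚ) (κ κ' : D.Cosets lam) : Prop :=
  ∃ (w : D.weylGroup) (i : ι),
    κ' = (w * D.s i * w⁻¹) • κ ∧
    D.cosetLength κ = D.cosetLength κ' + 1 ∧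
    ∃ m : ℤ, (a : ℝ) * D.coroot i (w⁻¹ • cosetWeight κ) = (m : ℝ)

variable (D)

/-- Lakshmibai-Seshadri paths of shape `λ`: sequences `τ_0 > τ_1 > ... > τ_n` in `W / W_λ` and
rational numbers `0 = a_0 < a_1 < ... < a_{n+1} = 1` such that for each inner `a_j` there is an
`a_j`-chain for the pair `(τ_{j-1}, τ_j)`. -/
structure LSPath (lam : E) where
  n : ℕ
  τ : Fin (n + 1) → D.Cosets lam
  a : Fin (n + 2) → ℚ
  a_zero : a 0 = 0
  a_last : a (Fin.last (n + 1)) = 1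
  a_strictMono : StrictMono a
  decreasing : ∀ j : Fin n, cosetLE (τ j.succ) (τ j.castSucc) ∧ τ j.succ ≠ τ j.castSucc
  chain : ∀ j : Fin n,
    Relation.ReflTransGen (ChainStep (a j.succ.castSucc)) (τ j.castSucc) (τ j.succ)

variable {D}

/-- The initial direction of an LS path. -/
def LSPath.initialDirection {lam : E} (π : D.LSPath lam) : D.Cosets lam :=
  π.τ 0

/-- The final direction of an LS path. -/
def LSPath.finalDirection {lam : E} (π : D.LSPath lam) : D.Cosets lam :=
  π.τ (Fin.last π.n)

/-- The piecewise linear path `[0,1] → E` given by an LS path: it starts at `0` and has velocity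
`τ_j λ` on the interval `[a_j, a_{j+1}]`. -/
def LSPath.toPath {lam : E} (π : D.LSPath lam) : unitInterval → E := fun t =>
  ∑ j : Fin (π.n + 1),
    (min (t : ℝ) (π.a j.succ : ℝ) - min (t : ℝ) (π.a j.castSucc : ℝ)) • cosetWeight (π.τ j)

variable (D)

/-- The set `P_λ` of LS paths of shape `λ`, as paths in `E`. -/
def lsPaths (lam : E) : Set (unitInterval → E) :=
  Set.range fun π : D.LSPath lam => π.toPath

/-- The concatenation `π * π'` of two paths. -/
def concat (π π' : unitInterval → E) : unitInterval → E := fun t =>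
  if (t : ℝ) ≤ 1 / 2 then π (Set.projIcc 0 1 zero_le_one (2 * (t : ℝ)))
  else π 1 + π' (Set.projIcc 0 1 zero_le_one (2 * (t : ℝ) - 1))

/-- The set `P_λ * P_μ` of concatenations of LS paths. -/
def concatPaths (lam mu : E) : Set (unitInterval → E) :=
  Set.image2 concat (D.lsPaths lam) (D.lsPaths mu)

/-- The function `h_i(t) = ⟨θ(t), α_i^∨⟩`. -/
def height (i : ι) (θ : unitInterval → E) (t : unitInterval) : ℝ :=
  D.coroot i (θ t)

/-- The minimal integer `Q` attained by the function `h_i`. -/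
def minHeight (i : ι) (θ : unitInterval → E) : ℤ :=
  sInf {m : ℤ | ∃ t, D.height i θ t = (m : ℝ)}

open Classical in
/-- Littelmann's root operator `e_i`; the value `none` means that `e_i θ` vanishes.

Write `h = h_i`. If `Q = 0` then `e_i θ` vanishes. Otherwise let `q` be minimal with `h(q) = Q`, and
let `y < q` be maximal with `h ≥ Q + 1` on `[0, y]`. The path `e_i θ` is obtained from `θ` by
applying `s_i` to those pieces of `θ` over `[y, q]` on which `h` attains new strict minima (`h` is
strictly decreasing, and lies below all of its earlier values), and by translating all other pieces.
Now `s_i` changes an increment `v` of the path to `v - ⟨v, α_i^∨⟩ α_i`. So the shift of `e_i θ`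
relative to `θ` at time `t` is a multiple of `α_i`, namely `0` for `t ≤ y`, the amount
`Q + 1 - min_{s ≤ t} h(s)` by which the running minimum has dropped since `y` for `y ≤ t ≤ q`, and
`1` for `t ≥ q`. -/
def e (i : ι) (θ : unitInterval → E) : Option (unitInterval → E) :=
  if D.minHeight i θ = 0 then none
  else some fun t => θ t +
    max 0 (min 1 ((D.minHeight i θ : ℝ) + 1 - ⨅ u : Set.Iic t, D.height i θ u)) • D.root i

open Classical in
/-- Littelmann's root operator `f_i`; the value `none` means that `f_i θ` vanishes.

Write `h = h_i`. If `h(1) - Q < 1` then `f_i θ` vanishes. Otherwise let `p` be maximal with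
`h(p) = Q`, and let `x > p` be minimal with `h ≥ Q + 1` on `[x, 1]`. The path `f_i θ` is obtained
from `θ` by applying `s_i` to those pieces of `θ` over `[p, x]` on which `h` is strictly increasing
and lies below all of its later values, and by translating all other pieces. So the shift of `f_i θ`
relative to `θ` at time `t` is a multiple of `-α_i`, namely `0` for `t ≤ p`, then
`min_{s ≥ t} h(s) - Q` for `p ≤ t ≤ x`, and `1` for `t ≥ x`. -/
def f (i : ι) (θ : unitInterval → E) : Option (unitInterval → E) :=
  if D.height i θ 1 - (D.minHeight i θ : ℝ) < 1 then none
  else some fun t => θ t -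
    max 0 (min 1 ((⨅ u : Set.Ici t, D.height i θ u) - (D.minHeight i θ : ℝ))) • D.root i

/-- The set `W_λ [e, τ⁻¹] φ W_μ`. -/
def intervalSet (lam mu : E) (τ φ : D.weylGroup) : Set D.weylGroup :=
  {x | ∃ u ∈ D.stab lam, ∃ σ, D.bruhatLE σ τ⁻¹ ∧ ∃ v ∈ D.stab mu, x = u * σ * φ * v}

open Classical in
/-- The Weyl group element `w(π * π') = min (W_λ [e, τ⁻¹] φ W_μ)` of a path in `P_λ * P_μ`, where
`τ` and `φ` lift the final direction of `π` and the initial direction of `π'`. -/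
def weylElement (lam mu : E) (θ : unitInterval → E) : D.weylGroup :=
  Classical.epsilon fun w =>
    ∃ (π : D.LSPath lam) (π' : D.LSPath mu), θ = concat π.toPath π'.toPath ∧
      ∃ τ ∈ lifts π.finalDirection, ∃ φ ∈ lifts π'.initialDirection,
        D.IsBruhatMin (D.intervalSet lam mu τ φ) w

/-- `θ` is related to `θ'` if it equals `e_i θ'` or `f_i θ'` for some `i`. -/
def Related (lam mu : E) (θ θ' : D.concatPaths lam mu) : Prop :=
  ∃ i, D.e i θ'.1 = some θ.1 ∨ D.f i θ'.1 = some θ.1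

/-- The reflexive and transitive closure on `P_λ * P_μ` of the relation given by the root
operators. -/
def Sim (lam mu : E) : D.concatPaths lam mu → D.concatPaths lam mu → Prop :=
  Relation.ReflTransGen (D.Related lam mu)

/-- The KK set of the double coset `W_λ w W_μ`. -/
def kkSet (lam mu : E) (w : D.weylGroup) : Set (D.concatPaths lam mu) :=
  {θ | D.bruhatLE (D.weylElement lam mu θ.1) w}

end

end KacMoodyDatum

end

/-!
# Concatenations of LS paths, root operators and the Weyl group element

Three ingredients carry the theorem.

*Coxeter theory of the Weyl group.* The element `w ∈ W` acts on the coordinates of the root lattice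
with respect to the simple roots (`act`), and the symmetrizer transports this action to multiples of
coroots (`corootPt`). The key fact is that `w α_i` is positive or negative according to whether
`ℓ(w s_i)` is greater or smaller than `ℓ(w)` (`act_simple_nonneg`). It is reduced to rank two in the
usual way, and in rank two the invariant form excludes integral vectors of mixed sign that have the
length of a simple root (`rank_two_dichotomy`), so that no case distinction on the Cartan matrix is
needed. The strong exchange property (`length_mul_reflection_lt`) and the lifting property of the
Bruhat order (`bruhatLE.s_mul_le_of_lt`, `bruhatLE.le_s_mul_of_lt`) follow. The lifting property
yields the least element of `W_λ [e, τ⁻¹] φ W_μ` (`exists_isBruhatMin_intervalSet`), its independence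
of the lifts (`intervalSet_eq_of_lifts`), and two invariance statements: replacing `τ` by
`s_i τ < τ` does not change the least element if `⟨φ μ, α_i^∨⟩ ≥ 0`
(`isBruhatMin_intervalSet_of_s_mul`), and replacing `φ` by `s_i φ` does not change the set if
`⟨τ λ, α_i^∨⟩ ≤ 0` (`intervalSet_s_mul_right`).

*LS paths.* An `a`-chain along which the pairing with `α_i^∨` changes from negative to nonnegative
contains the step `κ → s_i κ` (`ChainStep.eq_s_smul_of_neg`). This makes `a` times the pairing
integral and allows one to move the reflection to the beginning of the chain
(`IsChain.s_smul_left`); the case of a change from nonpositive to positive is analogous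
(`IsChain.s_smul_right`). Consequently the local minima of `h_i` along an LS path are integers. An LS
path is described by its directions on the intervals of an equidistant subdivision of `[0, 1]`, so
fine that integral values of `h_i` are taken at points of the subdivision (`exists_adapted`).
Then `e_i` reflects the directions on an interval on which `h_i` decreases from `Q + 1` to its
minimum `Q`, and the chain lemmas show that the result is again an LS path (`IsLS.exists_e`,
`IsLS.exists_f`).

*Concatenation.* Let `Q` and `Q'` be the minima of `h_i` along `π` and `π'`. Then `e_i` acts on the
first factor of `π * π'` if `Q ≤ h_i(1) + Q'`, and `f_i` does if `Q < h_i(1) + Q'`; otherwise they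
act on the second factor. The final direction `τ` of `π` changes only if `h_i` takes its minimum
(for `f_i`: its minimum on the resulting path) at the end of `π`, and this forces `Q' = 0`, that is
`⟨φ μ, α_i^∨⟩ ≥ 0`. The initial direction `φ` of `π'` changes only if `h_i` takes its minimum along
`π` at the end, that is `⟨τ λ, α_i^∨⟩ ≤ 0`. So the two invariance statements apply
(`IsLS.e_concat`, `IsLS.f_concat`). The operators `e_i` and `f_i` undo each other, which makes `∼`
symmetric.
-/

noncomputable section

namespace KacMoodyDatum

/-! ### Coordinates of roots -/

section Coordinates

variable {ι E : Type*} [AddCommGroup E] [Module ℝ E] (D : KacMoodyDatum ι E)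

theorem smul_def (w : D.weylGroup) (x : E) : w • x = (w : E ≃ₗ[ℝ] E) x := rfl

theorem s_smul (i : ι) (x : E) : D.s i • x = x - D.coroot i x • D.root i := by
  rw [smul_def]
  simp [s, simpleReflection, Module.reflection_apply]

theorem smul_add' (w : D.weylGroup) (x y : E) : w • (x + y) = w • x + w • y := by
  simp [smul_def]

theorem smul_sub' (w : D.weylGroup) (x y : E) : w • (x - y) = w • x - w • y := by
  simp [smul_def]

theorem smul_smul' (w : D.weylGroup) (c : ℝ) (x : E) : w • (c • x) = c • (w • x) := by
  simp [smul_def]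

theorem weyl_ext {w w' : D.weylGroup} (h : ∀ x : E, w • x = w' • x) : w = w' :=
  Subtype.ext (LinearEquiv.ext h)

theorem s_mul_self (i : ι) : D.s i * D.s i = 1 := by
  refine D.weyl_ext fun x => ?_
  rw [mul_smul, one_smul, s_smul, s_smul]
  simp only [map_sub, map_smul, coroot_root_self, smul_eq_mul]
  module

@[simp]
theorem s_inv (i : ι) : (D.s i)⁻¹ = D.s i :=
  inv_eq_of_mul_eq_one_left (D.s_mul_self i)

@[simp]
theorem mul_s_mul_s (w : D.weylGroup) (i : ι) : w * D.s i * D.s i = w := by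
  rw [mul_assoc, s_mul_self, mul_one]

@[simp]
theorem s_mul_s_mul (w : D.weylGroup) (i : ι) : D.s i * (D.s i * w) = w := by
  rw [← mul_assoc, s_mul_self, one_mul]

/-- The product of a word in the simple reflections. -/
def wordProd (l : List ι) : D.weylGroup := (l.map D.s).prod

@[simp] theorem wordProd_nil : D.wordProd [] = 1 := rfl

@[simp] theorem wordProd_cons (i : ι) (l : List ι) :
    D.wordProd (i :: l) = D.s i * D.wordProd l := by simp [wordProd]

@[simp] theorem wordProd_append (l l' : List ι) :
    D.wordProd (l ++ l') = D.wordProd l * D.wordProd l' := by simp [wordProd]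

theorem wordProd_reverse (l : List ι) : D.wordProd l.reverse = (D.wordProd l)⁻¹ := by
  induction l with
  | nil => simp
  | cons i l ih => simp [ih]

theorem exists_word (w : D.weylGroup) : ∃ l : List ι, D.wordProd l = w := by
  obtain ⟨w, hw⟩ := w
  induction hw using Subgroup.closure_induction with
  | mem x hx =>
    obtain ⟨i, rfl⟩ := hx
    exact ⟨[i], by simp [s]⟩
  | one => exact ⟨[], rfl⟩
  | mul x y hx hy h1 h2 =>
    obtain ⟨l, hl⟩ := h1
    obtain ⟨l', hl'⟩ := h2
    exact ⟨l ++ l', by rw [wordProd_append, hl, hl']; rfl⟩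
  | inv x hx h =>
    obtain ⟨l, hl⟩ := h
    exact ⟨l.reverse, by rw [wordProd_reverse, hl]; rfl⟩

theorem weyl_induction {P : D.weylGroup → Prop} (one : P 1)
    (mul : ∀ i w, P w → P (D.s i * w)) (w : D.weylGroup) : P w := by
  obtain ⟨l, rfl⟩ := D.exists_word w
  induction l with
  | nil => exact one
  | cons i l ih => rw [wordProd_cons]; exact mul _ _ ih

/-- The positive weights `d_i` with `d_i ⟨α_j, α_i^∨⟩ = d_j ⟨α_i, α_j^∨⟩`. -/
def sym : ι → ℝ := D.symmetrizable.choose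

theorem sym_pos (i : ι) : 0 < D.sym i := D.symmetrizable.choose_spec.1 i

theorem sym_mul (i j : ι) : D.sym i * (D.cartan i j : ℝ) = D.sym j * (D.cartan j i : ℝ) :=
  D.symmetrizable.choose_spec.2 i j

/-- The element `∑ n_j α_j` of the root lattice with coordinates `n`. -/
def rootPt : (ι →₀ ℤ) →ₗ[ℤ] E := Finsupp.linearCombination ℤ D.root

/-- The functional `∑ n_j d_j α_j^∨`, where `d` is the symmetrizer. If `n` are the coordinates of a
real root `β`, it is a positive multiple of `β^∨`. -/
def corootPt : (ι →₀ ℤ) →ₗ[ℤ] Module.Dual ℝ E :=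
  Finsupp.linearCombination ℤ fun j => D.sym j • D.coroot j

@[simp] theorem rootPt_single (i : ι) (c : ℤ) : D.rootPt (Finsupp.single i c) = c • D.root i := by
  simp [rootPt]

@[simp] theorem corootPt_single (i : ι) (c : ℤ) (x : E) :
    D.corootPt (Finsupp.single i c) x = c * (D.sym i * D.coroot i x) := by
  simp [corootPt]

theorem rootPt_injective : Function.Injective D.rootPt := by
  have h : LinearIndependent ℤ D.root :=
    D.root_linearIndependent.restrict_scalars fun a b hab => by simpa using hab
  exact h

/-- The pairing `⟨∑ n_j α_j, α_i^∨⟩`, as an integer. -/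
def pair (i : ι) : (ι →₀ ℤ) →ₗ[ℤ] ℤ := Finsupp.linearCombination ℤ (D.cartan i)

theorem coroot_rootPt (i : ι) (n : ι →₀ ℤ) : D.coroot i (D.rootPt n) = (D.pair i n : ℝ) := by
  induction n using Finsupp.induction_linear with
  | zero => simp
  | add f g hf hg => simp [hf, hg]
  | single j c => simp [pair, D.coroot_root]

theorem corootPt_root (i : ι) (n : ι →₀ ℤ) :
    D.corootPt n (D.root i) = D.sym i * (D.pair i n : ℝ) := by
  induction n using Finsupp.induction_linear with
  | zero => simp
  | add f g hf hg => simp [hf, hg]; ring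
  | single j c => simp [pair, D.coroot_root, D.sym_mul j i]; ring

/-- The Weyl group preserves the root lattice, and the symmetrizer intertwines its actions on roots
and coroots. -/
theorem exists_act (w : D.weylGroup) : ∀ n : ι →₀ ℤ, ∃ n' : ι →₀ ℤ,
    D.rootPt n' = w • D.rootPt n ∧ ∀ x, D.corootPt n' x = D.corootPt n (w⁻¹ • x) := by
  induction w using D.weyl_induction with
  | one => exact fun n => ⟨n, by simp⟩
  | mul i w ih =>
    intro n
    obtain ⟨m, h1, h2⟩ := ih n
    refine ⟨m - Finsupp.single i (D.pair i m), ?_, fun x => ?_⟩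
    · rw [mul_smul, ← h1, s_smul, coroot_rootPt]
      simp [Int.cast_smul_eq_zsmul]
    · rw [mul_inv_rev, mul_smul, ← h2, s_inv, s_smul]
      simp only [map_sub, map_smul, LinearMap.sub_apply, corootPt_single, corootPt_root,
        smul_eq_mul]
      ring

/-- The action of the Weyl group on the coordinates of elements of the root lattice. -/
def act (w : D.weylGroup) (n : ι →₀ ℤ) : ι →₀ ℤ := (D.exists_act w n).choose

theorem rootPt_act (w : D.weylGroup) (n : ι →₀ ℤ) : D.rootPt (D.act w n) = w • D.rootPt n :=
  (D.exists_act w n).choose_spec.1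

theorem corootPt_act (w : D.weylGroup) (n : ι →₀ ℤ) (x : E) :
    D.corootPt (D.act w n) x = D.corootPt n (w⁻¹ • x) :=
  (D.exists_act w n).choose_spec.2 x

@[simp] theorem act_one (n : ι →₀ ℤ) : D.act 1 n = n :=
  D.rootPt_injective (by simp [rootPt_act])

theorem act_mul (w w' : D.weylGroup) (n : ι →₀ ℤ) : D.act (w * w') n = D.act w (D.act w' n) :=
  D.rootPt_injective (by simp only [rootPt_act, mul_smul])

theorem act_add (w : D.weylGroup) (n m : ι →₀ ℤ) : D.act w (n + m) = D.act w n + D.act w m :=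
  D.rootPt_injective (by simp only [rootPt_act, map_add, smul_add'])

theorem act_neg (w : D.weylGroup) (n : ι →₀ ℤ) : D.act w (-n) = -D.act w n :=
  D.rootPt_injective (by simp only [rootPt_act, map_neg, smul_def])

theorem act_zsmul (w : D.weylGroup) (c : ℤ) (n : ι →₀ ℤ) : D.act w (c • n) = c • D.act w n :=
  D.rootPt_injective (by simp only [rootPt_act, map_zsmul, smul_def])

theorem act_injective (w : D.weylGroup) : Function.Injective (D.act w) := fun n m h => by
  rw [← D.act_one n, ← D.act_one m, ← inv_mul_cancel w, act_mul, act_mul, h]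

theorem act_s (i : ι) (n : ι →₀ ℤ) :
    D.act (D.s i) n = n - Finsupp.single i (D.pair i n) :=
  D.rootPt_injective (by
    rw [rootPt_act, s_smul, coroot_rootPt]
    simp [Int.cast_smul_eq_zsmul])

/-- The coordinates of the simple root `α_i`. -/
def simple (i : ι) : ι →₀ ℤ := Finsupp.single i 1

@[simp] theorem pair_simple (i j : ι) : D.pair i (simple j) = D.cartan i j := by
  simp [pair, simple]

theorem act_s_self (i : ι) : D.act (D.s i) (simple i) = -simple i := by
  rw [act_s, pair_simple, D.cartan_diag, simple, ← Finsupp.single_sub, ← Finsupp.single_neg]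
  norm_num

theorem simple_pos (i : ι) : 0 ≤ (simple i : ι →₀ ℤ) := by
  simp [simple]

theorem simple_ne_zero (i : ι) : (simple i : ι →₀ ℤ) ≠ 0 := by
  simp [simple]

/-- The bilinear form `(n, m) ↦ corootPt n (rootPt m)` is invariant under the Weyl group. -/
theorem corootPt_rootPt_act (w : D.weylGroup) (n m : ι →₀ ℤ) :
    D.corootPt (D.act w n) (D.rootPt (D.act w m)) = D.corootPt n (D.rootPt m) := by
  rw [corootPt_act, rootPt_act, inv_smul_smul]

/-- A reflection is determined by the direction of its root: if `g α_i` is a multiple of `α_j`, then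
`g s_i g⁻¹ = s_j`. -/
theorem conj_s_eq {g : D.weylGroup} {i j : ι} {c : ℤ}
    (h : D.act g (simple i) = Finsupp.single j c) : g * D.s i * g⁻¹ = D.s j := by
  -- Comparing the lengths of `α_i` and `c α_j` relates `c` to the symmetrizer.
  have hB := D.corootPt_rootPt_act g (simple i) (simple i)
  have hr := D.rootPt_act g (simple i)
  have hc : D.sym i = c ^ 2 * D.sym j := by
    rw [h] at hB
    simp only [corootPt_single, rootPt_single, simple, map_zsmul, coroot_root_self] at hB
    simp only [zsmul_eq_mul] at hB
    push_cast at hB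
    linarith
  refine D.weyl_ext fun x => ?_
  have hx := D.corootPt_act g (simple i) x
  rw [h] at hx hr
  simp only [simple, corootPt_single, rootPt_single, Int.cast_one, one_mul, one_smul] at hx hr
  rw [mul_smul, mul_smul, s_smul, smul_sub', smul_inv_smul, smul_smul', ← hr, s_smul,
    ← Int.cast_smul_eq_zsmul ℝ, smul_smul]
  congr 2
  have hi := D.sym_pos i
  have hj := D.sym_pos j
  have hc0 : (c : ℝ) ≠ 0 := by
    rintro h0
    rw [h0] at hc
    simp at hc
    exact hi.ne' hc
  have : D.sym j * c * (D.coroot i (g⁻¹ • x) * c - D.coroot j x) = 0 := by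
    have : D.sym i * D.coroot i (g⁻¹ • x) = c * (D.sym j * D.coroot j x) := hx.symm
    rw [hc] at this
    have h2 : c * (D.sym j * c * D.coroot i (g⁻¹ • x) - D.sym j * D.coroot j x) = 0 := by
      linear_combination this
    rcases mul_eq_zero.1 h2 with h2 | h2
    · exact absurd h2 hc0
    · linear_combination (c : ℝ) * h2
  rcases mul_eq_zero.1 this with h2 | h2
  · rcases mul_eq_zero.1 h2 with h2 | h2
    · exact absurd h2 hj.ne'
    · exact absurd h2 hc0
  · linarith

end Coordinates

/-! ### The length function and the sign of roots -/

section Length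

variable {ι E : Type*} [AddCommGroup E] [Module ℝ E] (D : KacMoodyDatum ι E)

theorem length_wordProd_le (l : List ι) : D.length (D.wordProd l) ≤ l.length :=
  Nat.sInf_le ⟨l, rfl, rfl⟩

theorem exists_reduced_word (w : D.weylGroup) :
    ∃ l : List ι, D.wordProd l = w ∧ l.length = D.length w := by
  have hne : {n | ∃ l : List ι, l.length = n ∧ (l.map D.s).prod = w}.Nonempty := by
    obtain ⟨l, hl⟩ := D.exists_word w
    exact ⟨_, l, rfl, hl⟩
  obtain ⟨l, h1, h2⟩ := Nat.sInf_mem hne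
  exact ⟨l, h2, h1⟩

@[simp]
theorem length_one : D.length 1 = 0 :=
  Nat.le_zero.1 (D.length_wordProd_le [])

theorem eq_one_of_length_eq_zero {w : D.weylGroup} (h : D.length w = 0) : w = 1 := by
  obtain ⟨l, rfl, hl⟩ := D.exists_reduced_word w
  rw [h, List.length_eq_zero_iff] at hl
  simp [hl]

theorem length_inv_le (w : D.weylGroup) : D.length w⁻¹ ≤ D.length w := by
  obtain ⟨l, rfl, hl⟩ := D.exists_reduced_word w
  rw [← hl, ← wordProd_reverse, ← l.length_reverse]
  exact D.length_wordProd_le _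

@[simp]
theorem length_inv (w : D.weylGroup) : D.length w⁻¹ = D.length w :=
  (D.length_inv_le w).antisymm (by simpa using D.length_inv_le w⁻¹)

theorem length_s_mul_le (i : ι) (w : D.weylGroup) : D.length (D.s i * w) ≤ D.length w + 1 := by
  obtain ⟨l, rfl, hl⟩ := D.exists_reduced_word w
  rw [← wordProd_cons, ← hl, ← List.length_cons (a := i)]
  exact D.length_wordProd_le _

theorem length_mul_s_le (i : ι) (w : D.weylGroup) : D.length (w * D.s i) ≤ D.length w + 1 := by
  have := D.length_s_mul_le i w⁻¹
  rwa [← length_inv, mul_inv_rev, s_inv, ← length_inv D w]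

theorem length_le_mul_s (i : ι) (w : D.weylGroup) : D.length w ≤ D.length (w * D.s i) + 1 := by
  simpa using D.length_mul_s_le i (w * D.s i)

theorem length_mul_wordProd_le (w : D.weylGroup) (l : List ι) :
    D.length (w * D.wordProd l) ≤ D.length w + l.length := by
  obtain ⟨l', rfl, hl⟩ := D.exists_reduced_word w
  rw [← wordProd_append, ← hl, ← List.length_append]
  exact D.length_wordProd_le _

/-- If a simple reflection makes a positive root negative, that root is a multiple of the simple
root. -/
theorem eq_single_of_act_s_nonpos {r : ι} {m : ι →₀ ℤ} (h : 0 ≤ m) (h' : D.act (D.s r) m ≤ 0) :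
    m = Finsupp.single r (m r) := by
  classical
  ext k
  by_cases hk : k = r
  · subst hk; simp
  · have h1 := h k
    have h2 := h' k
    rw [act_s] at h2
    simp [Ne.symm hk] at h1 h2 ⊢
    omega

/-- The exchange property for a positive root `β = g α_i`: if a product of simple reflections makes
`β` negative, multiplying it by the reflection of `β` on the right deletes a letter. The roots that
occur on the way are required to be positive or negative, so that the lemma can be applied both to
prove that all roots are (in rank two) and when this is known. -/
theorem exchange_of_dichotomy {g : D.weylGroup} {i : ι} (l : List ι)
    (h0 : 0 ≤ D.act g (simple i))
    (dich : ∀ l', l' <:+ l → 0 ≤ D.act (D.wordProd l' * g) (simple i) ∨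
      D.act (D.wordProd l' * g) (simple i) ≤ 0)
    (hneg : ¬ 0 ≤ D.act (D.wordProd l * g) (simple i)) :
    ∃ l' : List ι, l'.Sublist l ∧ l'.length + 1 = l.length ∧
      D.wordProd l * (g * D.s i * g⁻¹) = D.wordProd l' := by
  induction l with
  | nil => simp [h0] at hneg
  | cons r l ih =>
    by_cases hl : 0 ≤ D.act (D.wordProd l * g) (simple i)
    · refine ⟨l, List.sublist_cons_self _ _, rfl, ?_⟩
      have h1 := (dich _ List.suffix_rfl).resolve_left hneg
      rw [wordProd_cons, mul_assoc, act_mul] at h1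
      have h2 := D.conj_s_eq (D.eq_single_of_act_s_nonpos hl h1)
      rw [wordProd_cons, mul_assoc]
      nth_rewrite 1 [← h2]
      have : D.s i * D.s i = 1 := D.s_mul_self i
      calc _ = D.wordProd l * g * (D.s i * D.s i) * g⁻¹ := by group
        _ = _ := by rw [this]; group
    · obtain ⟨l', h1, h2, h3⟩ := ih (fun l' h => dich l' (h.trans (List.suffix_cons _ _))) hl
      exact ⟨r :: l', h1.cons_cons r, by simp [h2], by simp [mul_assoc, ← h3]⟩

theorem exists_act_rank_two {i j : ι} (l : List ι) (hl : ∀ r ∈ l, r = i ∨ r = j) :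
    ∃ x y : ℤ, D.act (D.wordProd l) (simple i) = x • simple i + y • simple j := by
  induction l with
  | nil => exact ⟨1, 0, by simp⟩
  | cons r l ih =>
    obtain ⟨x, y, h⟩ := ih fun r hr => hl r (List.mem_cons_of_mem _ hr)
    rw [wordProd_cons, act_mul, h, act_s]
    set c := D.pair r (x • simple i + y • simple j)
    have hc : ∀ r : ι, Finsupp.single r c = c • simple r := by simp [simple]
    rcases hl r List.mem_cons_self with rfl | rfl
    · exact ⟨x - c, y, by rw [hc, sub_smul]; abel⟩
    · exact ⟨x, y - c, by rw [hc, sub_smul]; abel⟩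

/-- In rank two the invariant form shows that no root is of mixed sign: the form of a vector
`x α_i + y α_j` with `x y < 0` is greater than that of `α_i`. -/
theorem rank_two_dichotomy {i j : ι} (hij : i ≠ j) (l : List ι) (hl : ∀ r ∈ l, r = i ∨ r = j) :
    0 ≤ D.act (D.wordProd l) (simple i) ∨ D.act (D.wordProd l) (simple i) ≤ 0 := by
  classical
  obtain ⟨x, y, h⟩ := D.exists_act_rank_two l hl
  replace h : D.act (D.wordProd l) (simple i) = Finsupp.single i x + Finsupp.single j y := by
    simpa [simple] using h
  have hB := D.corootPt_rootPt_act (D.wordProd l) (simple i) (simple i)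
  have hi := D.sym_pos i
  have hj := D.sym_pos j
  have h1 : (D.cartan i j : ℝ) ≤ 0 := by exact_mod_cast D.cartan_offDiag i j hij
  have h2 : (D.cartan j i : ℝ) ≤ 0 := by exact_mod_cast D.cartan_offDiag j i hij.symm
  rw [h] at hB
  simp only [simple, map_add, LinearMap.add_apply, corootPt_single, rootPt_single,
    ← Int.cast_smul_eq_zsmul ℝ, map_smul, coroot_root, smul_eq_mul, D.cartan_diag] at hB
  push_cast at hB
  have hm : (x : ℝ) * y < 0 → False := by
    intro hxy
    have hxy' : x * y < 0 := by exact_mod_cast hxy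
    have hx : 1 ≤ x ^ 2 := by
      have : x ≠ 0 := by rintro rfl; simp at hxy'
      have := sq_pos_of_ne_zero this
      omega
    have hy : 1 ≤ y ^ 2 := by
      have : y ≠ 0 := by rintro rfl; simp at hxy'
      have := sq_pos_of_ne_zero this
      omega
    have hx' : (1 : ℝ) ≤ (x : ℝ) ^ 2 := by exact_mod_cast hx
    have hy' : (1 : ℝ) ≤ (y : ℝ) ^ 2 := by exact_mod_cast hy
    have e1 := mul_nonneg (mul_nonneg_of_nonpos_of_nonpos hxy.le h1) hi.le
    have e2 := mul_nonneg (mul_nonneg_of_nonpos_of_nonpos hxy.le h2) hj.le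
    have e3 := mul_le_mul_of_nonneg_left hx' hi.le
    have e4 := mul_le_mul_of_nonneg_left hy' hj.le
    nlinarith
  have hsign : (0 ≤ x ∧ 0 ≤ y) ∨ (x ≤ 0 ∧ y ≤ 0) := by
    by_contra hcon
    apply hm
    have : x * y < 0 := by
      push Not at hcon
      rcases lt_trichotomy x 0 with hx | hx | hx
      · exact mul_neg_of_neg_of_pos hx (hcon.2 hx.le)
      · subst hx
        have := hcon.1 le_rfl
        have := hcon.2 le_rfl
        omega
      · exact mul_neg_of_pos_of_neg hx (hcon.1 hx.le)
    exact_mod_cast this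
  rw [h]
  rcases hsign with ⟨hx, hy⟩ | ⟨hx, hy⟩
  · left
    exact add_nonneg (Finsupp.single_nonneg.2 hx) (Finsupp.single_nonneg.2 hy)
  · right
    exact add_nonpos (Finsupp.single_nonpos.2 hx) (Finsupp.single_nonpos.2 hy)

/-- The length function detects the sign of a root: `w α_i` is positive if
`ℓ(w) ≤ ℓ(w s_i)`. The proof writes `w = v g` with `g` in a rank two parabolic subgroup that contains
`s_i` and with `ℓ(v)` as small as possible. -/
theorem act_simple_nonneg (w : D.weylGroup) (i : ι) (h : D.length w ≤ D.length (w * D.s i)) :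
    0 ≤ D.act w (simple i) := by
  classical
  induction hn : D.length w using Nat.strong_induction_on generalizing w i with
  | _ n ih =>
  subst hn
  rcases Nat.eq_zero_or_pos (D.length w) with h0 | hpos
  · rw [D.eq_one_of_length_eq_zero h0, act_one]
    exact simple_pos i
  obtain ⟨j, hj⟩ : ∃ j, D.length (w * D.s j) + 1 = D.length w := by
    obtain ⟨l, hl, hl'⟩ := D.exists_reduced_word w
    rcases List.eq_nil_or_concat l with rfl | ⟨l, j, rfl⟩
    · simp at hl'; omega
    · refine ⟨j, ?_⟩
      have h1 := D.length_le_mul_s j w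
      have : w * D.s j = D.wordProd l := by rw [← hl]; simp
      have h2 := D.length_wordProd_le l
      rw [this] at h1 ⊢
      simp at hl'
      omega
  have hij : i ≠ j := by rintro rfl; omega
  -- The decomposition `w = v g` with `v` as short as possible.
  let P : ℕ → Prop := fun k => ∃ (v : D.weylGroup) (l : List ι), D.length v = k ∧
    (∀ r ∈ l, r = i ∨ r = j) ∧ w = v * D.wordProd l ∧ D.length v + l.length = D.length w
  have hP1 : P (D.length (w * D.s j)) := ⟨w * D.s j, [j], rfl, by simp, by simp, by simpa using hj⟩
  have hP : ∃ k, P k := ⟨_, hP1⟩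
  obtain ⟨v, l, hv, hl, hw, hlen⟩ := Nat.find_spec hP
  have hmin : ∀ k, P k → D.length v ≤ k := fun k hk => hv ▸ Nat.find_min' hP hk
  have hvw : D.length v < D.length w := by
    have := hmin _ hP1
    omega
  have hred : ∀ r, (r = i ∨ r = j) → D.length v ≤ D.length (v * D.s r) := by
    intro r hr
    by_contra hlt
    push Not at hlt
    have := hmin (D.length (v * D.s r)) ⟨v * D.s r, r :: l, rfl, by
      rintro r' (_ | ⟨_, h'⟩)
      · exact hr
      · exact hl r' h', by rw [hw]; simp [← mul_assoc], by
      have h1 := D.length_mul_wordProd_le (v * D.s r) (r :: l)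
      have h2 : v * D.s r * D.wordProd (r :: l) = w := by rw [hw]; simp [← mul_assoc]
      rw [h2] at h1
      simp only [List.length_cons] at h1 ⊢
      omega⟩
    omega
  have hvi := ih _ hvw v i (hred i (Or.inl rfl)) rfl
  have hvj := ih _ hvw v j (hred j (Or.inr rfl)) rfl
  -- If `g α_i` were not positive, a letter of `g s_i` could be deleted, so that `w s_i` would be
  -- shorter than `w`.
  have hg : 0 ≤ D.act (D.wordProd l) (simple i) := by
    by_contra hneg
    obtain ⟨l', -, h2, h3⟩ := D.exchange_of_dichotomy (g := 1) (i := i) l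
      (by simpa using simple_pos i)
      (fun l' h' => by
        simpa using D.rank_two_dichotomy hij l' fun r hr => hl r (h'.subset hr))
      (by simpa using hneg)
    have h4 : w * D.s i = v * D.wordProd l' := by rw [hw, ← h3]; group
    have := D.length_mul_wordProd_le v l'
    rw [← h4] at this
    omega
  obtain ⟨x, y, hxy⟩ := D.exists_act_rank_two l hl
  have hx : 0 ≤ x := by
    have := hg i
    rw [hxy] at this
    simpa [simple, Finsupp.single_apply, hij.symm] using this
  have hy : 0 ≤ y := by
    have := hg j
    rw [hxy] at this
    simpa [simple, Finsupp.single_apply, hij] using this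
  rw [hw, act_mul, hxy, act_add, act_zsmul, act_zsmul]
  exact add_nonneg (smul_nonneg hx hvi) (smul_nonneg hy hvj)

/-- Every real root is positive or negative. -/
theorem act_simple_dichotomy (w : D.weylGroup) (i : ι) :
    0 ≤ D.act w (simple i) ∨ D.act w (simple i) ≤ 0 := by
  rcases le_total (D.length w) (D.length (w * D.s i)) with h | h
  · exact Or.inl (D.act_simple_nonneg w i h)
  · right
    have := D.act_simple_nonneg (w * D.s i) i (by simpa using h)
    rw [act_mul, act_s_self, act_neg] at this
    simpa using this

theorem act_simple_ne_zero (w : D.weylGroup) (i : ι) : D.act w (simple i) ≠ 0 := by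
  intro h
  apply simple_ne_zero i
  apply D.act_injective w
  rw [h]
  simpa using (D.act_zsmul w 0 0).symm

theorem not_act_simple_nonneg {w : D.weylGroup} {i : ι} :
    ¬ 0 ≤ D.act w (simple i) ↔ D.act w (simple i) ≤ 0 :=
  ⟨(D.act_simple_dichotomy w i).resolve_left, fun h h' =>
    D.act_simple_ne_zero w i (le_antisymm h h')⟩

/-- The strong exchange property: for a positive root `β = g α_i`, multiplication by its reflection
on the right shortens `w` exactly if `w β` is negative. -/
theorem length_mul_reflection_lt (w g : D.weylGroup) (i : ι) (h0 : 0 ≤ D.act g (simple i))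
    (hneg : D.act (w * g) (simple i) ≤ 0) : D.length (w * (g * D.s i * g⁻¹)) < D.length w := by
  obtain ⟨l, rfl, hl⟩ := D.exists_reduced_word w
  obtain ⟨l', -, h2, h3⟩ := D.exchange_of_dichotomy l h0
    (fun l' _ => D.act_simple_dichotomy _ _) (D.not_act_simple_nonneg.2 hneg)
  rw [h3, ← hl, ← h2]
  exact Nat.lt_succ_of_le (D.length_wordProd_le _)

theorem length_lt_mul_reflection_iff (w g : D.weylGroup) (i : ι) (h0 : 0 ≤ D.act g (simple i)) :
    D.length w < D.length (w * (g * D.s i * g⁻¹)) ↔ 0 ≤ D.act (w * g) (simple i) := by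
  constructor
  · intro h
    by_contra hneg
    have := D.length_mul_reflection_lt w g i h0 (D.not_act_simple_nonneg.1 hneg)
    omega
  · intro h
    have := D.length_mul_reflection_lt (w * (g * D.s i * g⁻¹)) g i h0 (by
      have : w * (g * D.s i * g⁻¹) * g = w * g * D.s i := by group
      rw [this, act_mul, act_s_self, act_neg]
      simpa using h)
    have h2 : w * (g * D.s i * g⁻¹) * (g * D.s i * g⁻¹) = w := by
      calc _ = w * g * (D.s i * D.s i) * g⁻¹ := by group
        _ = w := by rw [s_mul_self]; group
    rwa [h2] at this

theorem length_lt_mul_s_iff (w : D.weylGroup) (i : ι) :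
    D.length w < D.length (w * D.s i) ↔ 0 ≤ D.act w (simple i) := by
  simpa using D.length_lt_mul_reflection_iff w 1 i (by simpa using simple_pos i)

theorem length_mul_s_lt_iff (w : D.weylGroup) (i : ι) :
    D.length (w * D.s i) < D.length w ↔ D.act w (simple i) ≤ 0 := by
  have := D.length_lt_mul_s_iff (w * D.s i) i
  rw [mul_s_mul_s, act_mul, act_s_self, act_neg] at this
  simpa using this

theorem length_lt_s_mul_iff (w : D.weylGroup) (i : ι) :
    D.length w < D.length (D.s i * w) ↔ 0 ≤ D.act w⁻¹ (simple i) := by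
  rw [← length_lt_mul_s_iff, ← D.length_inv (w⁻¹ * D.s i)]
  simp

theorem length_s_mul_lt_iff (w : D.weylGroup) (i : ι) :
    D.length (D.s i * w) < D.length w ↔ D.act w⁻¹ (simple i) ≤ 0 := by
  rw [← length_mul_s_lt_iff, ← D.length_inv (w⁻¹ * D.s i)]
  simp

theorem length_s_mul_lt_or_lt (i : ι) (w : D.weylGroup) :
    D.length (D.s i * w) < D.length w ∨ D.length w < D.length (D.s i * w) := by
  rw [length_s_mul_lt_iff, length_lt_s_mul_iff]
  exact (D.act_simple_dichotomy _ _).symm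

theorem length_mul_s_lt_or_lt (i : ι) (w : D.weylGroup) :
    D.length (w * D.s i) < D.length w ∨ D.length w < D.length (w * D.s i) := by
  rw [length_mul_s_lt_iff, length_lt_mul_s_iff]
  exact (D.act_simple_dichotomy _ _).symm

end Length

/-! ### The Bruhat order -/

section Bruhat

variable {ι E : Type*} [AddCommGroup E] [Module ℝ E] (D : KacMoodyDatum ι E)

/-- The relation `x → t x` for a reflection `t` with `ℓ(x) < ℓ(t x)`, which generates the Bruhat
order. -/
def BruhatStep (x y : D.weylGroup) : Prop :=
  (∃ (w : D.weylGroup) (i : ι), y = (w * D.s i * w⁻¹) * x) ∧ D.length x < D.length y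

variable {D}

theorem bruhatLE_refl (x : D.weylGroup) : D.bruhatLE x x := Relation.ReflTransGen.refl

theorem bruhatLE.trans {x y z : D.weylGroup} (h : D.bruhatLE x y) (h' : D.bruhatLE y z) :
    D.bruhatLE x z := Relation.ReflTransGen.trans h h'

theorem BruhatStep.le {x y : D.weylGroup} (h : D.BruhatStep x y) : D.bruhatLE x y :=
  Relation.ReflTransGen.single h

theorem bruhatLE.eq_or_length_lt {x y : D.weylGroup} (h : D.bruhatLE x y) :
    x = y ∨ D.length x < D.length y := by
  induction h with
  | refl => exact Or.inl rfl
  | tail _ h ih =>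
    right
    rcases ih with rfl | ih
    · exact h.2
    · exact ih.trans h.2

theorem bruhatLE.length_le {x y : D.weylGroup} (h : D.bruhatLE x y) :
    D.length x ≤ D.length y := by
  rcases h.eq_or_length_lt with rfl | h
  · rfl
  · exact h.le

theorem bruhatLE.eq_of_length_le {x y : D.weylGroup} (h : D.bruhatLE x y)
    (h' : D.length y ≤ D.length x) : x = y :=
  h.eq_or_length_lt.resolve_right (by omega)

theorem bruhatLE.antisymm {x y : D.weylGroup} (h : D.bruhatLE x y) (h' : D.bruhatLE y x) :
    x = y := h.eq_of_length_le h'.length_le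

theorem le_s_mul {i : ι} {x : D.weylGroup} (h : D.length x < D.length (D.s i * x)) :
    D.bruhatLE x (D.s i * x) :=
  BruhatStep.le ⟨⟨1, i, by simp⟩, h⟩

theorem s_mul_le {i : ι} {x : D.weylGroup} (h : D.length (D.s i * x) < D.length x) :
    D.bruhatLE (D.s i * x) x :=
  BruhatStep.le ⟨⟨1, i, by simp⟩, h⟩

theorem BruhatStep.inv {x y : D.weylGroup} (h : D.BruhatStep x y) : D.BruhatStep x⁻¹ y⁻¹ := by
  obtain ⟨⟨w, i, rfl⟩, h⟩ := h
  refine ⟨⟨x⁻¹ * w, i, ?_⟩, by simpa only [length_inv] using h⟩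
  simp [mul_assoc]

theorem bruhatLE.inv {x y : D.weylGroup} (h : D.bruhatLE x y) : D.bruhatLE x⁻¹ y⁻¹ := by
  induction h with
  | refl => exact bruhatLE_refl _
  | tail _ h ih => exact ih.trans (BruhatStep.inv h).le

/-- Left multiplication by a simple reflection preserves a step `x → t x`, unless `t` is this
reflection. -/
theorem BruhatStep.s_mul {x y : D.weylGroup} (j : ι) (h : D.BruhatStep x y) :
    y = D.s j * x ∨ D.BruhatStep (D.s j * x) (D.s j * y) := by
  obtain ⟨⟨w, i, hy⟩, h⟩ := h
  obtain ⟨w, hw, hy⟩ : ∃ w, 0 ≤ D.act w (simple i) ∧ y = (w * D.s i * w⁻¹) * x := by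
    rcases D.act_simple_dichotomy w i with h0 | h0
    · exact ⟨w, h0, hy⟩
    · refine ⟨w * D.s i, ?_, ?_⟩
      · rw [act_mul, act_s_self, act_neg]
        simpa using h0
      · rw [hy, mul_s_mul_s]
        simp [mul_assoc]
  have hyi : y⁻¹ = x⁻¹ * (w * D.s i * w⁻¹) := by
    rw [hy]; simp [mul_assoc]
  have hpos : 0 ≤ D.act (x⁻¹ * w) (simple i) := by
    rw [← D.length_lt_mul_reflection_iff _ w i hw, ← hyi]
    simpa using h
  rcases D.act_simple_dichotomy (D.s j * w) i with h0 | h0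
  · right
    refine ⟨⟨D.s j * w, i, by rw [hy]; simp [mul_assoc]⟩, ?_⟩
    have := (D.length_lt_mul_reflection_iff (D.s j * x)⁻¹ (D.s j * w) i h0).2
      (by simpa [mul_assoc] using hpos)
    have e : (D.s j * y)⁻¹ = (D.s j * x)⁻¹ * (D.s j * w * D.s i * (D.s j * w)⁻¹) := by
      rw [hy]
      simp [mul_assoc]
    rwa [← e, length_inv, length_inv] at this
  · left
    rw [act_mul] at h0
    rw [hy, D.conj_s_eq (D.eq_single_of_act_s_nonpos hw h0)]

/-- The lifting property of the Bruhat order, for the larger element. -/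
theorem bruhatLE.s_mul_le_of_lt {i : ι} {x y : D.weylGroup} (h : D.bruhatLE x y)
    (hy : D.length (D.s i * y) < D.length y) : D.bruhatLE (D.s i * x) y := by
  induction h using Relation.ReflTransGen.head_induction_on with
  | refl => exact s_mul_le hy
  | head h h' ih =>
    rcases BruhatStep.s_mul i h with rfl | h
    · exact h'
    · exact h.le.trans ih

/-- The lifting property of the Bruhat order, for the smaller element. -/
theorem bruhatLE.le_s_mul_of_lt {i : ι} {x y : D.weylGroup} (h : D.bruhatLE x y)
    (hx : D.length x < D.length (D.s i * x)) : D.bruhatLE x (D.s i * y) := by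
  induction h with
  | refl => exact le_s_mul hx
  | tail h' h ih =>
    rcases BruhatStep.s_mul i h with rfl | h
    · rw [s_mul_s_mul]
      exact h'
    · exact ih.trans h.le

theorem bruhatLE.mul_s_le_of_lt {i : ι} {x y : D.weylGroup} (h : D.bruhatLE x y)
    (hy : D.length (y * D.s i) < D.length y) : D.bruhatLE (x * D.s i) y := by
  have := h.inv.s_mul_le_of_lt (i := i) (by rw [← length_inv]; simpa using hy)
  simpa using this.inv

theorem bruhatLE.le_mul_s_of_lt {i : ι} {x y : D.weylGroup} (h : D.bruhatLE x y)
    (hx : D.length x < D.length (x * D.s i)) : D.bruhatLE x (y * D.s i) := by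
  have := h.inv.le_s_mul_of_lt (i := i) (by
    rw [← length_inv D (D.s i * x⁻¹)]
    simpa using hx)
  simpa using this.inv

theorem mul_s_le {i : ι} {x : D.weylGroup} (h : D.length (x * D.s i) < D.length x) :
    D.bruhatLE (x * D.s i) x := (bruhatLE_refl x).mul_s_le_of_lt h

/-- If `x s < x`, the interval below `x` is the product of the interval below `x s` and
`{e, s}`. -/
theorem bruhatLE_iff_of_mul_s_lt {i : ι} {x y : D.weylGroup}
    (hx : D.length (x * D.s i) < D.length x) :
    D.bruhatLE y x ↔ D.bruhatLE y (x * D.s i) ∨ D.bruhatLE (y * D.s i) (x * D.s i) := by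
  constructor
  · intro h
    rcases D.length_mul_s_lt_or_lt i y with hy | hy
    · right
      exact ((mul_s_le hy).trans h).le_mul_s_of_lt (by simpa using hy)
    · left
      exact h.le_mul_s_of_lt hy
  · rintro (h | h)
    · exact h.trans (mul_s_le hx)
    · simpa using (h.trans (mul_s_le hx)).mul_s_le_of_lt hx

/-- Left multiplication can be made monotone by passing to a smaller left factor. -/
theorem exists_le_mul_le_mul (σ : D.weylGroup) {x y : D.weylGroup} (h : D.bruhatLE x y) :
    ∃ σ', D.bruhatLE σ' σ ∧ D.bruhatLE (σ' * x) (σ * y) := by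
  induction hn : D.length σ using Nat.strong_induction_on generalizing σ x y with
  | _ n ih =>
  subst hn
  rcases Nat.eq_zero_or_pos (D.length σ) with h0 | hpos
  · rw [D.eq_one_of_length_eq_zero h0]
    exact ⟨1, bruhatLE_refl _, by simpa using h⟩
  obtain ⟨l, hl, hl'⟩ := D.exists_reduced_word σ
  rcases List.eq_nil_or_concat l with rfl | ⟨l, i, rfl⟩
  · simp at hl'; omega
  have hlt : D.length (σ * D.s i) < D.length σ := by
    have h1 : σ * D.s i = D.wordProd l := by rw [← hl]; simp
    have h2 := D.length_wordProd_le l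
    rw [h1]
    simp at hl'
    omega
  have hσ : ∀ z, σ * z = σ * D.s i * (D.s i * z) := fun z => by simp [mul_assoc]
  rcases D.length_s_mul_lt_or_lt i x with hx | hx
  · have hxy : D.bruhatLE (D.s i * x) (D.s i * y) :=
      ((s_mul_le hx).trans h).le_s_mul_of_lt (by simpa using hx)
    obtain ⟨σ', h1, h2⟩ := ih _ hlt (σ * D.s i) hxy rfl
    refine ⟨σ' * D.s i, (bruhatLE_iff_of_mul_s_lt hlt).2 (Or.inr (by simpa using h1)), ?_⟩
    rw [hσ, mul_assoc]
    exact h2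
  · obtain ⟨σ', h1, h2⟩ := ih _ hlt (σ * D.s i) (h.le_s_mul_of_lt hx) rfl
    exact ⟨σ', h1.trans (mul_s_le hlt), by rwa [hσ]⟩

/-- The set `[e, x] y` has a least element. -/
theorem exists_least_interval_mul (x y : D.weylGroup) :
    ∃ σ, D.bruhatLE σ x ∧ ∀ σ', D.bruhatLE σ' x → D.bruhatLE (σ * y) (σ' * y) := by
  induction hn : D.length x using Nat.strong_induction_on generalizing x y with
  | _ n ih =>
  subst hn
  rcases Nat.eq_zero_or_pos (D.length x) with h0 | hpos
  · rw [D.eq_one_of_length_eq_zero h0]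
    refine ⟨1, bruhatLE_refl _, fun σ' h => ?_⟩
    rw [h.eq_of_length_le (by simp)]
    exact bruhatLE_refl _
  obtain ⟨l, hl, hl'⟩ := D.exists_reduced_word x
  rcases List.eq_nil_or_concat l with rfl | ⟨l, i, rfl⟩
  · simp at hl'; omega
  have hlt : D.length (x * D.s i) < D.length x := by
    have h1 : x * D.s i = D.wordProd l := by rw [← hl]; simp
    have h2 := D.length_wordProd_le l
    rw [h1]
    simp at hl'
    omega
  -- The least element is found from the smaller of `y` and `s y`.
  have main : ∀ z, (z = y ∨ z = D.s i * y) → D.length z < D.length (D.s i * z) →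
      ∃ σ, D.bruhatLE σ x ∧ ∀ σ', D.bruhatLE σ' x → D.bruhatLE (σ * y) (σ' * y) := by
    intro z hz hlen
    obtain ⟨σ, h1, h2⟩ := ih _ hlt (x * D.s i) z rfl
    have h3 : ∀ σ', D.bruhatLE σ' (x * D.s i) →
        D.bruhatLE (σ * z) (σ' * z) ∧ D.bruhatLE (σ * z) (σ' * (D.s i * z)) := by
      intro σ' h
      refine ⟨h2 σ' h, ?_⟩
      obtain ⟨σ'', h4, h5⟩ := exists_le_mul_le_mul σ' (le_s_mul hlen)
      exact (h2 σ'' (h4.trans h)).trans h5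
    rcases hz with rfl | rfl
    · refine ⟨σ, h1.trans (mul_s_le hlt), fun σ' h => ?_⟩
      rcases (bruhatLE_iff_of_mul_s_lt hlt).1 h with h | h
      · exact (h3 _ h).1
      · simpa [mul_assoc] using (h3 _ h).2
    · refine ⟨σ * D.s i, (bruhatLE_iff_of_mul_s_lt hlt).2 (Or.inr (by simpa using h1)),
        fun σ' h => ?_⟩
      rw [mul_assoc]
      rcases (bruhatLE_iff_of_mul_s_lt hlt).1 h with h | h
      · simpa using (h3 _ h).2
      · simpa [mul_assoc] using (h3 _ h).1
  rcases D.length_s_mul_lt_or_lt i y with hy | hy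
  · exact main _ (Or.inr rfl) (by simpa using hy)
  · exact main _ (Or.inl rfl) hy

end Bruhat

/-! ### Stabilizers of dominant weights -/

section Stabilizers

variable {ι E : Type*} [AddCommGroup E] [Module ℝ E] {D : KacMoodyDatum ι E} {lam mu : E}

theorem corootPt_nonneg (hlam : D.IsDominantIntegral lam) {n : ι →₀ ℤ} (hn : 0 ≤ n) :
    0 ≤ D.corootPt n lam := by
  rw [corootPt, Finsupp.linearCombination_apply, Finsupp.sum, LinearMap.sum_apply]
  refine Finset.sum_nonneg fun j _ => ?_
  obtain ⟨k, hk⟩ := hlam j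
  have h1 : (0 : ℝ) ≤ n j := by exact_mod_cast hn j
  have h2 := (D.sym_pos j).le
  simp only [LinearMap.smul_apply, hk, zsmul_eq_mul, smul_eq_mul]
  positivity

theorem sym_mul_coroot_smul (w : D.weylGroup) (i : ι) (x : E) :
    D.sym i * D.coroot i (w • x) = D.corootPt (D.act w⁻¹ (simple i)) x := by
  simp [corootPt_act, simple]

theorem coroot_smul_nonneg (hlam : D.IsDominantIntegral lam) {w : D.weylGroup} {i : ι}
    (h : D.length w < D.length (D.s i * w)) : 0 ≤ D.coroot i (w • lam) := by
  have := corootPt_nonneg hlam ((D.length_lt_s_mul_iff w i).1 h)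
  rw [← sym_mul_coroot_smul] at this
  exact nonneg_of_mul_nonneg_right this (D.sym_pos i)

theorem coroot_smul_nonpos (hlam : D.IsDominantIntegral lam) {w : D.weylGroup} {i : ι}
    (h : D.length (D.s i * w) < D.length w) : D.coroot i (w • lam) ≤ 0 := by
  have := coroot_smul_nonneg hlam (w := D.s i * w) (i := i) (by simpa using h)
  rw [mul_smul, s_smul] at this
  simp only [map_sub, map_smul, coroot_root_self, smul_eq_mul] at this
  linarith

theorem length_lt_s_mul_of_pos (hlam : D.IsDominantIntegral lam) {w : D.weylGroup} {i : ι}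
    (h : 0 < D.coroot i (w • lam)) : D.length w < D.length (D.s i * w) :=
  (D.length_s_mul_lt_or_lt i w).resolve_left fun h' => (coroot_smul_nonpos hlam h').not_gt h

theorem length_s_mul_lt_of_neg (hlam : D.IsDominantIntegral lam) {w : D.weylGroup} {i : ι}
    (h : D.coroot i (w • lam) < 0) : D.length (D.s i * w) < D.length w :=
  (D.length_s_mul_lt_or_lt i w).resolve_right fun h' => (coroot_smul_nonneg hlam h').not_gt h

theorem s_smul_eq_self {i : ι} {x : E} (h : D.coroot i x = 0) : D.s i • x = x := by
  rw [s_smul, h, zero_smul, sub_zero]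

theorem s_mem_stab {i : ι} (h : D.coroot i lam = 0) : D.s i ∈ D.stab lam :=
  s_smul_eq_self h

/-- The stabilizer of a dominant weight is generated by the simple reflections that it contains. -/
theorem stab_induction (hlam : D.IsDominantIntegral lam) {P : D.weylGroup → Prop} (one : P 1)
    (mul : ∀ i w, D.coroot i lam = 0 → P w → P (w * D.s i)) {w : D.weylGroup}
    (hw : w ∈ D.stab lam) : P w := by
  induction hn : D.length w using Nat.strong_induction_on generalizing w with
  | _ n ih =>
  subst hn
  obtain ⟨l, hl, hl'⟩ := D.exists_reduced_word w
  rcases List.eq_nil_or_concat l with rfl | ⟨l, i, rfl⟩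
  · rw [← hl]; exact one
  have hlt : D.length (w * D.s i) < D.length w := by
    have h1 : w * D.s i = D.wordProd l := by rw [← hl]; simp
    have h2 := D.length_wordProd_le l
    rw [h1]
    simp at hl'
    omega
  have hw' : w⁻¹ • lam = lam := inv_smul_eq_iff.2 (MulAction.mem_stabilizer_iff.1 hw).symm
  -- A descent `s_i` of `w` makes the pairing of `w⁻¹ λ = λ` with `α_i^∨` nonpositive.
  have h0 : D.coroot i lam = 0 := by
    apply le_antisymm
    · rw [← hw']
      refine coroot_smul_nonpos hlam ?_
      rw [← length_inv, ← length_inv D w⁻¹]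
      simpa using hlt
    · obtain ⟨k, hk⟩ := hlam i
      rw [hk]
      positivity
  have := mul i _ h0 (ih _ hlt (Subgroup.mul_mem _ hw (s_mem_stab h0)) rfl)
  simpa using this

theorem bruhatLE.le_mul_of_mem_stab (hlam : D.IsDominantIntegral lam) {x y v : D.weylGroup}
    (h : D.bruhatLE x y) (hx : ∀ i, D.coroot i lam = 0 → D.length x < D.length (x * D.s i))
    (hv : v ∈ D.stab lam) : D.bruhatLE x (y * v) := by
  refine stab_induction hlam (P := fun v => D.bruhatLE x (y * v)) (by simpa using h) ?_ hv
  intro i w hi hw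
  rw [← mul_assoc]
  exact hw.le_mul_s_of_lt (hx i hi)

theorem bruhatLE.le_stab_mul (hlam : D.IsDominantIntegral lam) {x y v : D.weylGroup}
    (h : D.bruhatLE x y) (hx : ∀ i, D.coroot i lam = 0 → D.length x < D.length (D.s i * x))
    (hv : v ∈ D.stab lam) : D.bruhatLE x (v * y) := by
  have := h.inv.le_mul_of_mem_stab hlam (v := v⁻¹) (fun i hi => by
    have := hx i hi
    rw [← length_inv D (D.s i * x)] at this
    simpa using this) (inv_mem hv)
  simpa using this.inv

end Stabilizers

/-! ### Cosets of the stabilizer -/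

section Cosets

variable {ι E : Type*} [AddCommGroup E] [Module ℝ E] {D : KacMoodyDatum ι E} {lam mu : E}

@[simp]
theorem cosetWeight_mk (w : D.weylGroup) :
    cosetWeight (w : D.Cosets lam) = w • lam := rfl

theorem cosetWeight_smul (w : D.weylGroup) (κ : D.Cosets lam) :
    cosetWeight (w • κ) = w • cosetWeight κ :=
  MulAction.ofQuotientStabilizer_smul _ _ _ _

theorem cosetWeight_injective : Function.Injective (cosetWeight : D.Cosets lam → E) :=
  MulAction.injective_ofQuotientStabilizer _ _

theorem mem_lifts {κ : D.Cosets lam} {w : D.weylGroup} : w ∈ lifts κ ↔ (w : D.Cosets lam) = κ :=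
  Iff.rfl

theorem smul_eq_cosetWeight {κ : D.Cosets lam} {w : D.weylGroup} (h : w ∈ lifts κ) :
    w • lam = cosetWeight κ := by
  rw [← mem_lifts.1 h, cosetWeight_mk]

theorem mul_mem_lifts {κ : D.Cosets lam} {w : D.weylGroup} (x : D.weylGroup) (h : w ∈ lifts κ) :
    x * w ∈ lifts (x • κ) := by
  rw [mem_lifts] at h ⊢
  rw [← h]
  rfl

theorem lifts_nonempty (κ : D.Cosets lam) : (lifts κ).Nonempty := by
  obtain ⟨w, rfl⟩ := QuotientGroup.mk_surjective κ
  exact ⟨w, rfl⟩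

theorem inv_mul_mem_stab {κ : D.Cosets lam} {w w' : D.weylGroup} (h : w ∈ lifts κ)
    (h' : w' ∈ lifts κ) : w⁻¹ * w' ∈ D.stab lam :=
  QuotientGroup.eq.1 ((mem_lifts.1 h).trans (mem_lifts.1 h').symm)

theorem exists_minRep (κ : D.Cosets lam) : ∃ u ∈ lifts κ, D.length u = cosetLength κ :=
  Nat.sInf_mem ((lifts_nonempty κ).image D.length)

/-- A representative of minimal length. -/
def minRep (κ : D.Cosets lam) : D.weylGroup := (exists_minRep κ).choose

theorem minRep_mem (κ : D.Cosets lam) : minRep κ ∈ lifts κ := (exists_minRep κ).choose_spec.1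

theorem length_minRep (κ : D.Cosets lam) : D.length (minRep κ) = cosetLength κ :=
  (exists_minRep κ).choose_spec.2

theorem cosetLength_le {κ : D.Cosets lam} {w : D.weylGroup} (h : w ∈ lifts κ) :
    cosetLength κ ≤ D.length w :=
  Nat.sInf_le ⟨w, h, rfl⟩

theorem length_minRep_lt_mul_s (κ : D.Cosets lam) {i : ι} (hi : D.coroot i lam = 0) :
    D.length (minRep κ) < D.length (minRep κ * D.s i) := by
  refine (D.length_mul_s_lt_or_lt i _).resolve_left fun h => ?_
  have : minRep κ * D.s i ∈ lifts κ := by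
    rw [mem_lifts, QuotientGroup.mk_mul_of_mem _ (s_mem_stab hi)]
    exact minRep_mem κ
  have := cosetLength_le this
  rw [length_minRep] at h
  omega

/-- A minimal representative that lies below one element of a coset lies below all of them. -/
theorem minRep_le_of_le (hlam : D.IsDominantIntegral lam) {κ κ' : D.Cosets lam}
    {w w' : D.weylGroup} (hw : w ∈ lifts κ) (hw' : w' ∈ lifts κ)
    (h : D.bruhatLE (minRep κ') w) : D.bruhatLE (minRep κ') w' := by
  have := h.le_mul_of_mem_stab hlam (fun i => length_minRep_lt_mul_s κ')
    (inv_mul_mem_stab hw hw')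
  simpa using this

theorem isBruhatMin_minRep (hlam : D.IsDominantIntegral lam) (κ : D.Cosets lam) :
    D.IsBruhatMin (lifts κ) (minRep κ) :=
  ⟨minRep_mem κ, fun _ hx => minRep_le_of_le hlam (minRep_mem κ) hx (bruhatLE_refl _)⟩

variable (D) in
/-- The pairing of a weight `κ λ` with `α_i^∨`. -/
def slope (i : ι) (κ : D.Cosets lam) : ℝ := D.coroot i (cosetWeight κ)

theorem coroot_s_smul (i : ι) (x : E) : D.coroot i (D.s i • x) = -D.coroot i x := by
  rw [s_smul]
  simp only [map_sub, map_smul, coroot_root_self, smul_eq_mul]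
  ring

@[simp]
theorem slope_s_smul (i : ι) (κ : D.Cosets lam) : D.slope i (D.s i • κ) = -D.slope i κ := by
  rw [slope, cosetWeight_smul, coroot_s_smul, slope]

@[simp]
theorem s_smul_s_smul (i : ι) (κ : D.Cosets lam) : D.s i • D.s i • κ = κ := by
  rw [smul_smul, s_mul_self, one_smul]

theorem s_smul_eq_of_slope_eq_zero {i : ι} {κ : D.Cosets lam} (h : D.slope i κ = 0) :
    D.s i • κ = κ :=
  cosetWeight_injective (by rw [cosetWeight_smul, s_smul_eq_self h])

/-- If `κ λ` is orthogonal to `α_i^∨`, then `s_i` times the minimal representative is in the same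
coset, hence also longer. -/
theorem length_minRep_lt_s_mul (hlam : D.IsDominantIntegral lam) {i : ι} {κ : D.Cosets lam}
    (h : 0 ≤ D.slope i κ) : D.length (minRep κ) < D.length (D.s i * minRep κ) := by
  refine (D.length_s_mul_lt_or_lt i _).resolve_left fun h' => ?_
  have h1 := coroot_smul_nonpos hlam h'
  rw [smul_eq_cosetWeight (minRep_mem κ)] at h1
  have h2 := s_smul_eq_of_slope_eq_zero (le_antisymm h1 h)
  have := cosetLength_le (h2 ▸ mul_mem_lifts (D.s i) (minRep_mem κ))
  rw [length_minRep] at h'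
  omega

theorem length_s_mul_lt_of_slope_neg (hlam : D.IsDominantIntegral lam) {i : ι} {κ : D.Cosets lam}
    (h : D.slope i κ < 0) {w : D.weylGroup} (hw : w ∈ lifts κ) :
    D.length (D.s i * w) < D.length w :=
  length_s_mul_lt_of_neg hlam (by rwa [smul_eq_cosetWeight hw])

theorem cosetLength_s_smul (hlam : D.IsDominantIntegral lam) {i : ι} {κ : D.Cosets lam}
    (h : 0 < D.slope i κ) : cosetLength (D.s i • κ) = cosetLength κ + 1 := by
  apply le_antisymm
  · have h1 := cosetLength_le (mul_mem_lifts (D.s i) (minRep_mem κ))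
    have h2 := D.length_s_mul_le i (minRep κ)
    rw [length_minRep] at h2
    omega
  · have h1 := mul_mem_lifts (D.s i) (minRep_mem (D.s i • κ))
    rw [s_smul_s_smul] at h1
    have h2 := length_s_mul_lt_of_slope_neg hlam (i := i) (by simpa using h)
      (minRep_mem (D.s i • κ))
    have h3 := cosetLength_le h1
    rw [length_minRep] at h2
    omega

theorem minRep_s_smul (hlam : D.IsDominantIntegral lam) {i : ι} {κ : D.Cosets lam}
    (h : 0 < D.slope i κ) : minRep (D.s i • κ) = D.s i * minRep κ := by
  refine ((isBruhatMin_minRep hlam _).2 _ (mul_mem_lifts _ (minRep_mem κ))).eq_of_length_le ?_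
  rw [length_minRep, cosetLength_s_smul hlam h, ← length_minRep]
  exact D.length_s_mul_le _ _

theorem ChainStep.minRep_le (hlam : D.IsDominantIntegral lam) {a : ℚ} {κ κ' : D.Cosets lam}
    (h : ChainStep a κ κ') : D.bruhatLE (minRep κ') (minRep κ) := by
  obtain ⟨w, i, rfl, hlen, -⟩ := h
  have h1 := mul_mem_lifts (w * D.s i * w⁻¹) (minRep_mem ((w * D.s i * w⁻¹) • κ))
  have h2 : w * D.s i * w⁻¹ * (w * D.s i * w⁻¹) = 1 := by
    calc _ = w * (D.s i * D.s i) * w⁻¹ := by group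
      _ = 1 := by rw [s_mul_self]; group
  rw [smul_smul, h2, one_smul] at h1
  have h3 := cosetLength_le h1
  refine minRep_le_of_le hlam h1 (minRep_mem κ) (BruhatStep.le ⟨⟨w, i, rfl⟩, ?_⟩)
  rw [length_minRep]
  omega

/-- A step of a chain from a negative to a nonnegative pairing with `α_i^∨` is the simple
reflection `s_i`. -/
theorem ChainStep.eq_s_smul_of_neg (hlam : D.IsDominantIntegral lam) {a : ℚ} {κ κ' : D.Cosets lam}
    (h : ChainStep a κ κ') {i : ι} (hκ : D.slope i κ < 0) (hκ' : 0 ≤ D.slope i κ') :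
    κ' = D.s i • κ := by
  have h1 := length_s_mul_lt_of_slope_neg hlam hκ (minRep_mem κ)
  have h2 := (h.minRep_le hlam).le_s_mul_of_lt (length_minRep_lt_s_mul hlam hκ')
  have h3 := h2.eq_of_length_le (by
    obtain ⟨-, -, -, hlen, -⟩ := h
    rw [length_minRep] at h1 ⊢
    omega)
  have h4 := mul_mem_lifts (D.s i) (minRep_mem κ)
  rw [← h3] at h4
  exact (minRep_mem κ').symm.trans h4

/-- A step of a chain from a nonpositive to a positive pairing with `α_i^∨` is the simple
reflection `s_i`. -/
theorem ChainStep.eq_s_smul_of_pos (hlam : D.IsDominantIntegral lam) {a : ℚ} {κ κ' : D.Cosets lam}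
    (h : ChainStep a κ κ') {i : ι} (hκ : D.slope i κ ≤ 0) (hκ' : 0 < D.slope i κ') :
    κ = D.s i • κ' := by
  have hle := h.minRep_le hlam
  have h1 : D.bruhatLE (minRep (D.s i • κ')) (minRep κ) := by
    rcases hκ.lt_or_eq with hneg | h0
    · rw [minRep_s_smul hlam hκ']
      exact hle.s_mul_le_of_lt (length_s_mul_lt_of_slope_neg hlam hneg (minRep_mem κ))
    · have h2 := mul_mem_lifts (D.s i) (minRep_mem κ)
      rw [s_smul_eq_of_slope_eq_zero h0] at h2
      refine minRep_le_of_le hlam h2 (minRep_mem κ) ?_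
      have h3 := length_minRep_lt_s_mul hlam h0.ge
      rw [minRep_s_smul hlam hκ']
      exact (hle.trans (le_s_mul h3)).s_mul_le_of_lt (by simpa using h3)
  have h2 := h1.eq_of_length_le (by
    obtain ⟨-, -, -, hlen, -⟩ := h
    rw [length_minRep, length_minRep, cosetLength_s_smul hlam hκ', hlen])
  have h3 := minRep_mem (D.s i • κ')
  rw [h2] at h3
  exact (minRep_mem κ).symm.trans h3

end Cosets

/-! ### Minimal elements of double cosets -/

section DoubleCosets

variable {ι E : Type*} [AddCommGroup E] [Module ℝ E] {D : KacMoodyDatum ι E} {lam mu : E}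

theorem IsBruhatMin.unique {K : Set D.weylGroup} {w w' : D.weylGroup} (h : D.IsBruhatMin K w)
    (h' : D.IsBruhatMin K w') : w = w' :=
  (h.2 _ h'.1).antisymm (h'.2 _ h.1)

theorem mul_mul_mem_intervalSet {τ φ x u v : D.weylGroup} (hx : x ∈ D.intervalSet lam mu τ φ)
    (hu : u ∈ D.stab lam) (hv : v ∈ D.stab mu) : u * x * v ∈ D.intervalSet lam mu τ φ := by
  obtain ⟨u', hu', σ, hσ, v', hv', rfl⟩ := hx
  exact ⟨u * u', mul_mem hu hu', σ, hσ, v' * v, mul_mem hv' hv, by group⟩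

/-- The minimal element of a set that is invariant under the two stabilizers lies below all elements
of a double coset as soon as it lies below one of them. -/
theorem IsBruhatMin.le_mul_mul (hlam : D.IsDominantIntegral lam) (hmu : D.IsDominantIntegral mu)
    {K : Set D.weylGroup}
    (hK : ∀ x ∈ K, ∀ u ∈ D.stab lam, ∀ v ∈ D.stab mu, u * x * v ∈ K) {w y u v : D.weylGroup}
    (hw : D.IsBruhatMin K w) (hy : D.bruhatLE w y) (hu : u ∈ D.stab lam) (hv : v ∈ D.stab mu) :
    D.bruhatLE w (u * y * v) := by
  refine (hy.le_stab_mul hlam (fun i hi => ?_) hu).le_mul_of_mem_stab hmu (fun i hi => ?_) hv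
  · have h := hK w hw.1 _ (s_mem_stab hi) 1 (one_mem _)
    rw [mul_one] at h
    have := (hw.2 _ h).length_le
    have := D.length_s_mul_lt_or_lt i w
    omega
  · have h := hK w hw.1 1 (one_mem _) _ (s_mem_stab hi)
    rw [one_mul] at h
    have := (hw.2 _ h).length_le
    have := D.length_mul_s_lt_or_lt i w
    omega

/-- A double coset of two parabolic subgroups has a least element. -/
theorem exists_isBruhatMin_doubleCoset (hlam : D.IsDominantIntegral lam)
    (hmu : D.IsDominantIntegral mu) (z : D.weylGroup) :
    ∃ w, D.IsBruhatMin {x | ∃ u ∈ D.stab lam, ∃ v ∈ D.stab mu, x = u * z * v} w := by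
  set K := {x | ∃ u ∈ D.stab lam, ∃ v ∈ D.stab mu, x = u * z * v} with hK
  have hne : (D.length '' K).Nonempty :=
    ⟨_, z, ⟨1, one_mem _, 1, one_mem _, by simp⟩, rfl⟩
  obtain ⟨w, ⟨u, hu, v, hv, hw⟩, hlen⟩ := Nat.sInf_mem hne
  have hmin : ∀ x ∈ K, D.length w ≤ D.length x := fun x hx => by
    rw [hlen]
    exact Nat.sInf_le ⟨x, hx, rfl⟩
  refine ⟨w, ⟨u, hu, v, hv, hw⟩, ?_⟩
  rintro x ⟨u', hu', v', hv', rfl⟩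
  have h1 := ((bruhatLE_refl w).le_stab_mul hlam (v := u' * u⁻¹) (fun i hi => ?_)
    (mul_mem hu' (inv_mem hu))).le_mul_of_mem_stab hmu (v := v⁻¹ * v') (fun i hi => ?_)
    (mul_mem (inv_mem hv) hv')
  · convert h1 using 1
    rw [hw]
    group
  · have := hmin (D.s i * w) ⟨D.s i * u, mul_mem (s_mem_stab hi) hu, v, hv, by rw [hw]; group⟩
    have := D.length_s_mul_lt_or_lt i w
    omega
  · have := hmin (w * D.s i) ⟨u, hu, v * D.s i, mul_mem hv (s_mem_stab hi), by rw [hw]; group⟩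
    have := D.length_mul_s_lt_or_lt i w
    omega

/-- The least element of `[e, τ⁻¹] φ` lies in the double coset whose least element is the least
element of `W_λ [e, τ⁻¹] φ W_μ`. -/
theorem exists_isBruhatMin_intervalSet (hlam : D.IsDominantIntegral lam)
    (hmu : D.IsDominantIntegral mu) (τ φ : D.weylGroup) :
    ∃ w, D.IsBruhatMin (D.intervalSet lam mu τ φ) w := by
  obtain ⟨σ, hσ, hmin⟩ := exists_least_interval_mul τ⁻¹ φ
  obtain ⟨w, hw⟩ := exists_isBruhatMin_doubleCoset hlam hmu (σ * φ)
  refine ⟨w, ?_, ?_⟩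
  · obtain ⟨⟨u, hu, v, hv, rfl⟩, -⟩ := hw
    exact ⟨u, hu, σ, hσ, v, hv, by group⟩
  · rintro x ⟨u, hu, σ', hσ', v, hv, rfl⟩
    rw [mul_assoc u]
    refine hw.le_mul_mul hlam hmu ?_ ?_ hu hv
    · rintro x ⟨u, hu, v, hv, rfl⟩ u' hu' v' hv'
      exact ⟨u' * u, mul_mem hu' hu, v * v', mul_mem hv hv', by group⟩
    · exact (hw.2 _ ⟨1, one_mem _, 1, one_mem _, by simp⟩).trans (hmin σ' hσ')

theorem bruhatLE_iff_of_s_mul_lt {i : ι} {x y : D.weylGroup}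
    (hx : D.length (D.s i * x) < D.length x) :
    D.bruhatLE y x ↔ D.bruhatLE y (D.s i * x) ∨ D.bruhatLE (D.s i * y) (D.s i * x) := by
  have hinv : ∀ a b : D.weylGroup, D.bruhatLE a⁻¹ b⁻¹ ↔ D.bruhatLE a b := fun a b =>
    ⟨fun h => by simpa using h.inv, fun h => h.inv⟩
  rw [← length_inv, ← length_inv D x, mul_inv_rev, s_inv] at hx
  rw [← hinv y, bruhatLE_iff_of_mul_s_lt hx, ← hinv y, ← hinv (D.s i * y)]
  simp

theorem intervalSet_mul_stab (hlam : D.IsDominantIntegral lam) (τ φ : D.weylGroup)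
    {v : D.weylGroup} (hv : v ∈ D.stab lam) :
    D.intervalSet lam mu (τ * v) φ = D.intervalSet lam mu τ φ := by
  have key : ∀ i, D.coroot i lam = 0 → ∀ τ : D.weylGroup,
      D.intervalSet lam mu (τ * D.s i) φ ⊆ D.intervalSet lam mu τ φ := by
    rintro i hi τ x ⟨u, hu, σ, hσ, v, hv, rfl⟩
    rw [mul_inv_rev, s_inv] at hσ
    rcases D.length_s_mul_lt_or_lt i τ⁻¹ with h | h
    · exact ⟨u, hu, σ, hσ.trans (s_mul_le h), v, hv, rfl⟩
    · rw [bruhatLE_iff_of_s_mul_lt (i := i) (x := D.s i * τ⁻¹) (by simpa using h),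
        s_mul_s_mul] at hσ
      rcases hσ with hσ | hσ
      · exact ⟨u, hu, σ, hσ, v, hv, rfl⟩
      · exact ⟨u * D.s i, mul_mem hu (s_mem_stab hi), _, hσ, v, hv, by simp [← mul_assoc]⟩
  refine stab_induction hlam
    (P := fun v => D.intervalSet lam mu (τ * v) φ = D.intervalSet lam mu τ φ) (by simp) ?_ hv
  intro i w hi ih
  rw [← ih, ← mul_assoc]
  refine (key i hi _).antisymm ?_
  simpa using key i hi (τ * w * D.s i)

theorem intervalSet_mul_stab_right (τ φ : D.weylGroup) {v : D.weylGroup} (hv : v ∈ D.stab mu) :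
    D.intervalSet lam mu τ (φ * v) = D.intervalSet lam mu τ φ := by
  ext x
  constructor
  · rintro ⟨u, hu, σ, hσ, v', hv', rfl⟩
    exact ⟨u, hu, σ, hσ, v * v', mul_mem hv hv', by group⟩
  · rintro ⟨u, hu, σ, hσ, v', hv', rfl⟩
    exact ⟨u, hu, σ, hσ, v⁻¹ * v', mul_mem (inv_mem hv) hv', by group⟩

theorem intervalSet_eq_of_lifts (hlam : D.IsDominantIntegral lam) {κ : D.Cosets lam}
    {κ' : D.Cosets mu} {τ τ' φ φ' : D.weylGroup} (hτ : τ ∈ lifts κ) (hτ' : τ' ∈ lifts κ)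
    (hφ : φ ∈ lifts κ') (hφ' : φ' ∈ lifts κ') :
    D.intervalSet lam mu τ φ = D.intervalSet lam mu τ' φ' := by
  have h1 := intervalSet_mul_stab (mu := mu) hlam τ φ (inv_mul_mem_stab hτ hτ')
  have h2 := intervalSet_mul_stab_right (lam := lam) τ' φ (inv_mul_mem_stab hφ hφ')
  rw [mul_inv_cancel_left] at h1 h2
  rw [← h1, h2]

/-- If `s_i τ < τ` and `φ μ` pairs nonnegatively with `α_i^∨`, replacing `τ` by `s_i τ` does not
change the minimal element, since the part `[e, τ⁻¹ s_i] s_i φ W_μ` that is lost lies above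
`[e, τ⁻¹ s_i] φ W_μ`. -/
theorem isBruhatMin_intervalSet_of_s_mul (hlam : D.IsDominantIntegral lam)
    (hmu : D.IsDominantIntegral mu) {τ φ w : D.weylGroup} {i : ι}
    (hτ : D.length (D.s i * τ) < D.length τ) (hφ : 0 ≤ D.coroot i (φ • mu))
    (hw : D.IsBruhatMin (D.intervalSet lam mu (D.s i * τ) φ) w) :
    D.IsBruhatMin (D.intervalSet lam mu τ φ) w := by
  have hτ' : D.length (τ⁻¹ * D.s i) < D.length τ⁻¹ := by
    rw [← length_inv]
    simpa using hτ
  have hinv : (D.s i * τ)⁻¹ = τ⁻¹ * D.s i := by simp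
  constructor
  · obtain ⟨⟨u, hu, σ, hσ, v, hv, rfl⟩, -⟩ := hw
    rw [hinv] at hσ
    exact ⟨u, hu, σ, hσ.trans (mul_s_le hτ'), v, hv, rfl⟩
  · rintro x ⟨u, hu, σ, hσ, v, hv, rfl⟩
    rcases (bruhatLE_iff_of_mul_s_lt hτ').1 hσ with hσ | hσ
    · exact hw.2 _ ⟨u, hu, σ, by rwa [hinv], v, hv, rfl⟩
    rcases hφ.lt_or_eq with hpos | h0
    · obtain ⟨σ', h1, h2⟩ := exists_le_mul_le_mul (σ * D.s i)
        (le_s_mul (length_lt_s_mul_of_pos hmu hpos))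
      have h3 : D.bruhatLE w (σ' * φ) :=
        hw.2 _ ⟨1, one_mem _, σ', by rw [hinv]; exact h1.trans hσ, 1, one_mem _, by group⟩
      have h4 : σ * D.s i * (D.s i * φ) = σ * φ := by simp [← mul_assoc]
      rw [h4] at h2
      rw [mul_assoc u]
      exact hw.le_mul_mul hlam hmu (fun x hx u hu v hv => mul_mul_mem_intervalSet hx hu hv)
        (h3.trans h2) hu hv
    · refine hw.2 _ ⟨u, hu, σ * D.s i, by rwa [hinv], φ⁻¹ * D.s i * φ * v, mul_mem ?_ hv, ?_⟩
      · rw [MulAction.mem_stabilizer_iff, mul_smul, mul_smul, s_smul_eq_self h0.symm,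
          inv_smul_smul]
      · simp [mul_assoc]

/-- If `τ λ` pairs nonpositively with `α_i^∨`, the interval may be taken stable under right
multiplication with `s_i`. -/
theorem intervalSet_s_mul_right (hlam : D.IsDominantIntegral lam) {τ : D.weylGroup} {i : ι}
    (hτ : D.coroot i (τ • lam) ≤ 0) (φ : D.weylGroup) :
    D.intervalSet lam mu τ (D.s i * φ) = D.intervalSet lam mu τ φ := by
  have key : ∀ τ φ : D.weylGroup, D.length (D.s i * τ) < D.length τ →
      D.intervalSet lam mu τ φ ⊆ D.intervalSet lam mu τ (D.s i * φ) := by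
    rintro τ φ hτ x ⟨u, hu, σ, hσ, v, hv, rfl⟩
    refine ⟨u, hu, σ * D.s i, hσ.mul_s_le_of_lt ?_, v, hv, by simp [mul_assoc]⟩
    rw [← length_inv]
    simpa using hτ
  have key2 : ∀ τ φ : D.weylGroup, D.length (D.s i * τ) < D.length τ →
      D.intervalSet lam mu τ (D.s i * φ) = D.intervalSet lam mu τ φ := fun τ φ h =>
    Set.Subset.antisymm (by simpa using key τ (D.s i * φ) h) (key τ φ h)
  rcases D.length_s_mul_lt_or_lt i τ with h | h
  · exact key2 τ φ h
  · -- Here `s_i τ` is another lift of the same coset, and it has the descent.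
    have h0 : D.coroot i (τ • lam) = 0 := hτ.antisymm (coroot_smul_nonneg hlam h)
    have h1 : τ⁻¹ * D.s i * τ ∈ D.stab lam := by
      rw [MulAction.mem_stabilizer_iff, mul_smul, mul_smul, s_smul_eq_self h0, inv_smul_smul]
    have h2 : D.s i * τ = τ * (τ⁻¹ * D.s i * τ) := by group
    have := key2 (D.s i * τ) φ (by simpa using h)
    rwa [h2, intervalSet_mul_stab hlam _ _ h1, intervalSet_mul_stab hlam _ _ h1] at this

end DoubleCosets

/-! ### Chains in the coset space -/

section Chains

variable {ι E : Type*} [AddCommGroup E] [Module ℝ E] {D : KacMoodyDatum ι E} {lam : E}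

/-- The integers, as a subring of the real numbers. -/
abbrev ints : Subring ℝ := (Int.castRingHom ℝ).range

theorem mem_ints {x : ℝ} : x ∈ ints ↔ ∃ m : ℤ, x = (m : ℝ) := by
  simp [ints, eq_comm]

theorem intCast_mem_ints (m : ℤ) : (m : ℝ) ∈ ints := mem_ints.2 ⟨m, rfl⟩

theorem coroot_smul_mem_ints (hlam : D.IsDominantIntegral lam) (w : D.weylGroup) :
    ∀ i, D.coroot i (w • lam) ∈ ints := by
  induction w using D.weyl_induction with
  | one =>
    intro i
    obtain ⟨k, hk⟩ := hlam i
    rw [one_smul, hk]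
    exact_mod_cast intCast_mem_ints k
  | mul j w ih =>
    intro i
    rw [mul_smul, s_smul, map_sub, LinearMap.map_smul, coroot_root, smul_eq_mul]
    exact sub_mem (ih i) (mul_mem (ih j) (intCast_mem_ints _))

theorem slope_mem_ints (hlam : D.IsDominantIntegral lam) (i : ι) (κ : D.Cosets lam) :
    D.slope i κ ∈ ints := by
  obtain ⟨w, rfl⟩ := QuotientGroup.mk_surjective κ
  exact coroot_smul_mem_ints hlam w i

/-- A chain for the rational number `a`: a sequence of steps in `W / W_λ`. -/
abbrev IsChain (a : ℚ) : D.Cosets lam → D.Cosets lam → Prop :=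
  Relation.ReflTransGen (ChainStep a)

/-- The integrality condition in a chain says that `a` times the difference of the weights lies in
the root lattice. -/
theorem ChainStep.smul_sub_eq_rootPt {a : ℚ} {κ κ' : D.Cosets lam} (h : ChainStep a κ κ') :
    ∃ n, (a : ℝ) • (cosetWeight κ - cosetWeight κ') = D.rootPt n := by
  obtain ⟨w, i, rfl, -, m, hm⟩ := h
  refine ⟨m • D.act w (simple i), ?_⟩
  rw [map_zsmul, rootPt_act, cosetWeight_smul, mul_smul, mul_smul, s_smul, smul_sub',
    smul_inv_smul, sub_sub_cancel, smul_smul', smul_smul, hm, Int.cast_smul_eq_zsmul]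
  simp [simple]

theorem IsChain.smul_sub_eq_rootPt {a : ℚ} {κ κ' : D.Cosets lam} (h : IsChain a κ κ') :
    ∃ n, (a : ℝ) • (cosetWeight κ - cosetWeight κ') = D.rootPt n := by
  induction h with
  | refl => exact ⟨0, by simp⟩
  | tail _ h ih =>
    obtain ⟨n, hn⟩ := ih
    obtain ⟨m, hm⟩ := h.smul_sub_eq_rootPt
    exact ⟨n + m, by rw [map_add, ← hn, ← hm, ← smul_add, sub_add_sub_cancel]⟩

theorem IsChain.slope_sub_mem_ints {a : ℚ} {κ κ' : D.Cosets lam} (h : IsChain a κ κ') (i : ι) :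
    a * D.slope i κ - a * D.slope i κ' ∈ ints := by
  obtain ⟨n, hn⟩ := h.smul_sub_eq_rootPt
  have := congrArg (D.coroot i) hn
  rw [coroot_rootPt, map_smul, map_sub, smul_eq_mul, mul_sub] at this
  exact mem_ints.2 ⟨_, this⟩

theorem mem_ints_of_smul_root_eq {c : ℝ} {i : ι} {n : ι →₀ ℤ} (h : c • D.root i = D.rootPt n) :
    c ∈ ints := by
  have h1 : D.rootPt n =
      Finsupp.linearCombination ℝ D.root (n.mapRange (Int.cast : ℤ → ℝ) Int.cast_zero) := by
    rw [rootPt, Finsupp.linearCombination_apply, Finsupp.linearCombination_apply,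
      Finsupp.sum_mapRange_index (by simp)]
    simp [Int.cast_smul_eq_zsmul]
  have h2 : Finsupp.single i c = n.mapRange (Int.cast : ℤ → ℝ) Int.cast_zero := by
    apply D.root_linearIndependent
    rw [← h1, ← h]
    simp
  exact mem_ints.2 ⟨n i, by simpa using DFunLike.congr_fun h2 i⟩

/-- A chain step that is a simple reflection makes the corresponding pairing integral. -/
theorem ChainStep.slope_mem_ints {a : ℚ} {κ : D.Cosets lam} {i : ι}
    (h : ChainStep a κ (D.s i • κ)) : a * D.slope i κ ∈ ints := by
  obtain ⟨n, hn⟩ := h.smul_sub_eq_rootPt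
  rw [cosetWeight_smul, s_smul, sub_sub_cancel, smul_smul] at hn
  exact mem_ints_of_smul_root_eq hn

theorem chainStep_s_smul (hlam : D.IsDominantIntegral lam) {a : ℚ} {κ : D.Cosets lam} {i : ι}
    (h : D.slope i κ < 0) (ha : a * D.slope i κ ∈ ints) : ChainStep a κ (D.s i • κ) := by
  refine ⟨1, i, by simp, ?_, ?_⟩
  · simpa using cosetLength_s_smul hlam (i := i) (κ := D.s i • κ) (by simpa using h)
  · simpa [slope] using mem_ints.1 ha

theorem cosetLength_of_slope_neg (hlam : D.IsDominantIntegral lam) {κ : D.Cosets lam} {i : ι}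
    (h : D.slope i κ < 0) : cosetLength κ = cosetLength (D.s i • κ) + 1 := by
  simpa using cosetLength_s_smul hlam (i := i) (κ := D.s i • κ) (by simpa using h)

theorem ChainStep.s_smul (hlam : D.IsDominantIntegral lam) {a : ℚ} {κ κ' : D.Cosets lam} {i : ι}
    (h : ChainStep a κ κ') (hs : 0 < D.slope i κ * D.slope i κ') :
    ChainStep a (D.s i • κ) (D.s i • κ') := by
  obtain ⟨w, j, rfl, hlen, m, hm⟩ := h
  refine ⟨D.s i * w, j, ?_, ?_, m, ?_⟩
  · rw [smul_smul, smul_smul]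
    simp [mul_assoc, s_mul_self]
  · rcases pos_and_pos_or_neg_and_neg_of_mul_pos hs with ⟨h1, h2⟩ | ⟨h1, h2⟩
    · rw [cosetLength_s_smul hlam h1, cosetLength_s_smul hlam h2, hlen]
    · rw [cosetLength_of_slope_neg hlam h1, cosetLength_of_slope_neg hlam h2] at hlen
      omega
  · rw [cosetWeight_smul, mul_inv_rev, s_inv, mul_smul, smul_smul (D.s i), s_mul_self, one_smul,
      hm]

/-- A chain from a negative to a nonnegative pairing with `α_i^∨` uses the reflection `s_i`, which
can be moved to its beginning. -/
theorem IsChain.s_smul_left (hlam : D.IsDominantIntegral lam) {a : ℚ} {κ κ' : D.Cosets lam} {i : ι}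
    (h : IsChain a κ κ') (hκ : D.slope i κ < 0) (hκ' : 0 ≤ D.slope i κ') :
    IsChain a (D.s i • κ) κ' ∧ a * D.slope i κ ∈ ints := by
  induction h using Relation.ReflTransGen.head_induction_on with
  | refl => exact absurd hκ hκ'.not_gt
  | head h h' ih =>
    rename_i κ κ₁
    rcases lt_or_ge (D.slope i κ₁) 0 with h1 | h1
    · obtain ⟨h2, h3⟩ := ih h1
      refine ⟨h2.head (h.s_smul hlam (mul_pos_of_neg_of_neg hκ h1)), ?_⟩
      simpa using add_mem (IsChain.slope_sub_mem_ints (.single h) i) h3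
    · obtain rfl := h.eq_s_smul_of_neg hlam hκ h1
      exact ⟨h', h.slope_mem_ints⟩

/-- A chain from a nonpositive to a positive pairing with `α_i^∨` uses the reflection `s_i`, which
can be moved to its end. -/
theorem IsChain.s_smul_right (hlam : D.IsDominantIntegral lam) {a : ℚ} {κ κ' : D.Cosets lam} {i : ι}
    (h : IsChain a κ κ') (hκ : D.slope i κ ≤ 0) (hκ' : 0 < D.slope i κ') :
    IsChain a κ (D.s i • κ') ∧ a * D.slope i κ' ∈ ints := by
  induction h with
  | refl => exact absurd hκ' hκ.not_gt
  | tail h' h ih =>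
    rename_i κ₁ κ'
    rcases lt_or_ge 0 (D.slope i κ₁) with h1 | h1
    · obtain ⟨h2, h3⟩ := ih h1
      refine ⟨h2.tail (h.s_smul hlam (mul_pos h1 hκ')), ?_⟩
      simpa using sub_mem h3 (IsChain.slope_sub_mem_ints (.single h) i)
    · obtain rfl := h.eq_s_smul_of_pos hlam h1 hκ'
      refine ⟨h', ?_⟩
      have h2 : ChainStep a (D.s i • κ') (D.s i • D.s i • κ') := by simpa using h
      simpa using h2.slope_mem_ints

/-- Along a chain for `a` the pairing with `α_i^∨` does not change sign if `a` times it is not an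
integer, and then the chain can be reflected. -/
theorem IsChain.s_smul (hlam : D.IsDominantIntegral lam) {a : ℚ} {κ κ' : D.Cosets lam} {i : ι}
    (h : IsChain a κ κ') (hs : 0 < D.slope i κ * D.slope i κ') (ha : a * D.slope i κ ∉ ints) :
    IsChain a (D.s i • κ) (D.s i • κ') := by
  induction h using Relation.ReflTransGen.head_induction_on with
  | refl => exact .refl
  | head h h' ih =>
    rename_i κ κ₁
    have h1 : a * D.slope i κ₁ ∉ ints := fun h1 => ha (by
      simpa using add_mem (IsChain.slope_sub_mem_ints (.single h) i) h1)
    have h2 : 0 < D.slope i κ₁ * D.slope i κ' := by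
      by_contra hneg
      rcases pos_and_pos_or_neg_and_neg_of_mul_pos hs with ⟨h3, h4⟩ | ⟨h3, h4⟩
      · have h5 : D.slope i κ₁ ≤ 0 := by
          by_contra h5
          exact hneg (mul_pos (not_le.1 h5) h4)
        have h6 := (IsChain.s_smul_right hlam h' h5 h4).2
        exact h1 (by simpa using add_mem (IsChain.slope_sub_mem_ints h' i) h6)
      · have h5 : 0 ≤ D.slope i κ₁ := by
          by_contra h5
          exact hneg (mul_pos_of_neg_of_neg (not_le.1 h5) h4)
        exact ha (IsChain.s_smul_left hlam (.single h) h3 h5).2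
    have h3 : 0 < D.slope i κ * D.slope i κ₁ := by
      have := mul_pos hs h2
      have e : D.slope i κ * D.slope i κ' * (D.slope i κ₁ * D.slope i κ') =
        D.slope i κ * D.slope i κ₁ * D.slope i κ' ^ 2 := by ring
      rw [e] at this
      exact pos_of_mul_pos_left this (sq_nonneg _)
    exact (ih h2 h1).head (h.s_smul hlam h3)

/-- Chains decrease weakly in the Bruhat order of the coset space. -/
theorem IsChain.cosetLE (hlam : D.IsDominantIntegral lam) {a : ℚ} {κ κ' : D.Cosets lam}
    (h : IsChain a κ κ') : cosetLE κ' κ := by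
  refine ⟨minRep κ', minRep κ, isBruhatMin_minRep hlam _, isBruhatMin_minRep hlam _, ?_⟩
  induction h with
  | refl => exact bruhatLE_refl _
  | tail _ h ih => exact (h.minRep_le hlam).trans ih

end Chains

/-! ### Paths on an equidistant subdivision -/

section Grid

variable {M : Type*} [AddCommGroup M] [Module ℝ M]

/-- The piecewise linear path with velocity `v k` on `[k / N, (k + 1) / N]`, for `k < N`. -/
def gridPath (N : ℕ) (v : ℕ → M) (t : ℝ) : M :=
  ∑ k ∈ Finset.range N, (min t (((k + 1 : ℕ) : ℝ) / N) - min t ((k : ℝ) / N)) • v k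

/-- Summation over blocks `[T j, T (j + 1))` on which `w` is constant. -/
theorem sum_group (g : ℕ → ℝ) (w w' : ℕ → M) (T : ℕ → ℕ) (n : ℕ) (h0 : T 0 = 0)
    (hT : ∀ j < n, T j ≤ T (j + 1))
    (hw : ∀ j < n, ∀ k, T j ≤ k → k < T (j + 1) → w k = w' j) :
    ∑ k ∈ Finset.range (T n), (g (k + 1) - g k) • w k =
      ∑ j ∈ Finset.range n, (g (T (j + 1)) - g (T j)) • w' j := by
  induction n with
  | zero => simp [h0]
  | succ n ih =>
    rw [Finset.sum_range_succ, ← ih (fun j hj => hT j (by omega)) (fun j hj => hw j (by omega))]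
    obtain ⟨d, hd⟩ := Nat.exists_eq_add_of_le (hT n (by omega))
    rw [hd, Finset.sum_range_add]
    congr 1
    rw [Finset.sum_congr rfl (g := fun x => (g (T n + (x + 1)) - g (T n + x)) • w' n),
      ← Finset.sum_smul, Finset.sum_range_sub (fun x => g (T n + x))]
    · simp
    · intro x hx
      rw [Finset.mem_range] at hx
      rw [hw n (by omega) (T n + x) (by omega) (by omega), add_assoc]

theorem gridPath_map {M' : Type*} [AddCommGroup M'] [Module ℝ M'] (L : M →ₗ[ℝ] M') (N : ℕ)
    (v : ℕ → M) (t : ℝ) : L (gridPath N v t) = gridPath N (fun k => L (v k)) t := by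
  simp [gridPath, map_sum]

/-- Refining a subdivision does not change the path. -/
theorem gridPath_mul (N : ℕ) {K : ℕ} (hK : 0 < K) (v : ℕ → M) (t : ℝ) :
    gridPath (N * K) (fun k => v (k / K)) t = gridPath N v t := by
  have hK' : (K : ℝ) ≠ 0 := by positivity
  have h := sum_group (fun k => min t ((k : ℝ) / ((N * K : ℕ) : ℝ))) (fun k => v (k / K)) v
    (fun j => j * K) N (by simp) (fun j _ => Nat.mul_le_mul_right _ (by omega))
    (fun j _ k h1 h2 => by
      rw [Nat.div_eq_of_lt_le h1 h2])
  rw [gridPath, h, gridPath]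
  refine Finset.sum_congr rfl fun j _ => ?_
  have e : ∀ x : ℕ, ((x * K : ℕ) : ℝ) / ((N * K : ℕ) : ℝ) = x / N := fun x => by
    push_cast
    rw [mul_div_mul_right _ _ hK']
  rw [e, e]

theorem gridPath_zero (N : ℕ) (v : ℕ → M) : gridPath N v 0 = 0 := by
  refine Finset.sum_eq_zero fun k _ => ?_
  rw [min_eq_left (by positivity), min_eq_left (by positivity), sub_self, zero_smul]

theorem gridPath_add (N : ℕ) (v w : ℕ → M) (t : ℝ) :
    gridPath N (fun k => v k + w k) t = gridPath N v t + gridPath N w t := by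
  simp [gridPath, smul_add, Finset.sum_add_distrib]

theorem gridPath_of_mem {N k : ℕ} (hk : k < N) (v : ℕ → M) {t : ℝ} (h1 : (k : ℝ) / N ≤ t)
    (h2 : t ≤ ((k + 1 : ℕ) : ℝ) / N) :
    gridPath N v t = gridPath N v ((k : ℝ) / N) + (t - (k : ℝ) / N) • v k := by
  have hN : (0 : ℝ) < N := by exact_mod_cast (Nat.zero_le k).trans_lt hk
  have hmono : ∀ a b : ℕ, a ≤ b → (a : ℝ) / N ≤ (b : ℝ) / N := fun a b h => by gcongr
  rw [gridPath, gridPath, ← Finset.sum_erase_add _ _ (Finset.mem_range.2 hk),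
    ← Finset.sum_erase_add (Finset.range N) _ (Finset.mem_range.2 hk), add_assoc]
  congr 1
  · refine Finset.sum_congr rfl fun j hj => ?_
    congr 1
    rcases lt_or_gt_of_ne (Finset.ne_of_mem_erase hj) with hjk | hjk
    · have := hmono (j + 1) k hjk
      have := hmono j k hjk.le
      rw [min_eq_right (by linarith), min_eq_right (by linarith), min_eq_right (by linarith),
        min_eq_right (by linarith)]
    · have := hmono (k + 1) j hjk
      have := hmono j (j + 1) (by omega)
      rw [min_eq_left (by linarith), min_eq_left (by linarith), min_eq_left (by linarith),
        min_eq_left (by linarith)]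
      simp
  · have := hmono k (k + 1) (by omega)
    rw [min_eq_left h2, min_eq_right h1, min_eq_left this, min_self, sub_self, zero_smul, zero_add]

theorem gridPath_succ {N k : ℕ} (hk : k < N) (v : ℕ → M) :
    gridPath N v (((k + 1 : ℕ) : ℝ) / N) = gridPath N v ((k : ℝ) / N) + (1 / N : ℝ) • v k := by
  rw [gridPath_of_mem hk v (by gcongr; omega) le_rfl]
  congr 2
  push_cast
  ring

end Grid

/-! ### LS paths on an equidistant subdivision -/

section LSGrid

variable {ι E : Type*} [AddCommGroup E] [Module ℝ E] {D : KacMoodyDatum ι E} {lam : E}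

/-- An LS path, described by its directions on the intervals of an equidistant subdivision of
`[0, 1]` into `N` parts. Consecutive directions may coincide. -/
structure IsLSGrid (N : ℕ) (κ : ℕ → D.Cosets lam) : Prop where
  pos : 0 < N
  chain : ∀ k, k + 1 < N → IsChain (((k + 1 : ℕ) : ℚ) / N) (κ k) (κ (k + 1))

/-- The path with directions `κ` on an equidistant subdivision into `N` parts. -/
def lsGridPath (N : ℕ) (κ : ℕ → D.Cosets lam) : unitInterval → E :=
  fun t => gridPath N (fun k => cosetWeight (κ k)) t

theorem IsLSGrid.refine {N : ℕ} {κ : ℕ → D.Cosets lam} (h : IsLSGrid N κ) {K : ℕ} (hK : 0 < K) :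
    IsLSGrid (N * K) fun k => κ (k / K) where
  pos := Nat.mul_pos h.pos hK
  chain k hk := by
    by_cases hdvd : K ∣ k + 1
    · obtain ⟨c, hc⟩ := hdvd
      obtain ⟨c, rfl⟩ : ∃ c', c = c' + 1 := ⟨c - 1, by
        rcases c with _ | c
        · simp at hc
        · rfl⟩
      have h1 : (k + 1) / K = c + 1 := by rw [hc, Nat.mul_div_cancel_left _ hK]
      have h2 : k / K = c := by
        refine Nat.div_eq_of_lt_le ?_ ?_
        · rw [mul_add, mul_one] at hc
          rw [mul_comm]
          omega
        · rw [mul_comm]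
          omega
      have h3 := h.chain c (by
        rw [hc, mul_comm] at hk
        exact Nat.lt_of_mul_lt_mul_right hk)
      simp only [h1, h2]
      convert h3 using 1
      have : (K : ℚ) ≠ 0 := by positivity
      rw [hc, mul_comm N, Nat.cast_mul, Nat.cast_mul, mul_div_mul_left _ _ this]
    · have : (k + 1) / K = k / K := by
        rw [Nat.succ_div, if_neg hdvd, add_zero]
      simp only [this]
      exact .refl

theorem lsGridPath_mul (N : ℕ) (κ : ℕ → D.Cosets lam) {K : ℕ} (hK : 0 < K) :
    lsGridPath (N * K) (fun k => κ (k / K)) = lsGridPath N κ := by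
  ext t
  exact gridPath_mul N hK (fun k => cosetWeight (κ k)) t

/-- Every LS path has an equidistant description, obtained from a common denominator of the rational
numbers `a_j`. -/
theorem LSPath.exists_grid (π : D.LSPath lam) : ∃ (N : ℕ) (κ : ℕ → D.Cosets lam), IsLSGrid N κ ∧
    π.toPath = lsGridPath N κ ∧ κ 0 = π.initialDirection ∧ κ (N - 1) = π.finalDirection := by
  classical
  obtain ⟨N, hN, T, hT⟩ : ∃ N : ℕ, 0 < N ∧ ∃ T : Fin (π.n + 2) → ℕ,
      ∀ j, π.a j = (T j : ℚ) / N := by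
    refine ⟨∏ j, (π.a j).den, Finset.prod_pos fun j _ => (π.a j).den_pos, ?_⟩
    have : ∀ j, ∃ x : ℕ, π.a j = (x : ℚ) / ((∏ j, (π.a j).den : ℕ) : ℚ) := by
      intro j
      have h0 : 0 ≤ π.a j := by
        rw [← π.a_zero]
        exact π.a_strictMono.monotone (Fin.zero_le _)
      obtain ⟨c, hc⟩ := Finset.dvd_prod_of_mem (fun j => (π.a j).den) (Finset.mem_univ j)
      have hpos : 0 < ∏ j, (π.a j).den := Finset.prod_pos fun j _ => (π.a j).den_pos
      rw [hc] at hpos ⊢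
      have hc0 : (c : ℚ) ≠ 0 := by
        have := Nat.pos_of_mul_pos_left hpos
        positivity
      refine ⟨(π.a j).num.toNat * c, ?_⟩
      have h2 : (((π.a j).num.toNat : ℕ) : ℚ) = ((π.a j).num : ℚ) := by
        exact_mod_cast congrArg (Int.cast : ℤ → ℚ) (Int.toNat_of_nonneg (Rat.num_nonneg.2 h0))
      rw [Nat.cast_mul, Nat.cast_mul, mul_div_mul_right _ _ hc0, h2, Rat.num_div_den]
    choose T hT using this
    exact ⟨T, hT⟩
  have hNq : (0 : ℚ) < N := by exact_mod_cast hN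
  have hTmono : StrictMono T := by
    intro i j hij
    have := π.a_strictMono hij
    rw [hT, hT, div_lt_div_iff_of_pos_right hNq] at this
    exact_mod_cast this
  have hT0 : T 0 = 0 := by
    have := hT 0
    rw [π.a_zero, eq_comm, div_eq_zero_iff] at this
    rcases this with h | h
    · exact_mod_cast h
    · exact absurd h hNq.ne'
  have hTl : T (Fin.last _) = N := by
    have := hT (Fin.last _)
    rw [π.a_last, eq_comm, div_eq_one_iff_eq hNq.ne'] at this
    exact_mod_cast this
  let T' : ℕ → ℕ := fun j => if h : j < π.n + 2 then T ⟨j, h⟩ else N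
  have hT' : ∀ j (h : j < π.n + 2), T' j = T ⟨j, h⟩ := fun j h => dif_pos h
  have hT'mono : ∀ i j, i < j → j < π.n + 2 → T' i < T' j := by
    intro i j hij hj
    rw [hT' i (by omega), hT' j hj]
    exact hTmono (Fin.mk_lt_mk.2 hij)
  have hT'0 : T' 0 = 0 := by rw [hT' 0 (by omega)]; exact hT0
  have hT'l : T' (π.n + 1) = N := by rw [hT' _ (by omega)]; exact hTl
  -- `J k` is the index of the linear piece of `π` that contains the `k`-th interval.
  let J : ℕ → ℕ := fun k => Nat.findGreatest (fun j => T' j ≤ k) π.n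
  have hJn : ∀ k, J k ≤ π.n := fun k => Nat.findGreatest_le _
  have hJ : ∀ k j, j ≤ π.n → T' j ≤ k → k < T' (j + 1) → J k = j := by
    intro k j hj h1 h2
    refine Nat.findGreatest_eq_iff.2 ⟨hj, fun _ => h1, fun {m} hm hm' => ?_⟩
    rcases (Nat.succ_le_of_lt hm).eq_or_lt with rfl | hlt
    · exact not_le.2 h2
    · have := hT'mono (j + 1) m hlt (by omega)
      omega
  have hJspec : ∀ k, k < N → T' (J k) ≤ k ∧ k < T' (J k + 1) := by
    intro k hk
    refine ⟨Nat.findGreatest_spec (P := fun j => T' j ≤ k) (Nat.zero_le _) (by simp [hT'0]), ?_⟩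
    rcases (hJn k).eq_or_lt with h | h
    · rw [h, hT'l]
      exact hk
    · by_contra hcon
      push Not at hcon
      exact absurd (Nat.le_findGreatest (P := fun j => T' j ≤ k) h hcon) (by simp [J])
  let κ : ℕ → D.Cosets lam := fun k => π.τ ⟨J k, Nat.lt_succ_of_le (hJn k)⟩
  have hκ : ∀ k j (h : j < π.n + 1), J k = j → κ k = π.τ ⟨j, h⟩ := by
    rintro k j h rfl
    rfl
  refine ⟨N, κ, ⟨hN, fun k hk => ?_⟩, ?_, ?_, ?_⟩
  · obtain ⟨h1, h2⟩ := hJspec k (by omega)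
    have hjn := hJn k
    generalize hj : J k = j at h1 h2 hjn
    rcases (Nat.succ_le_of_lt h2).lt_or_eq with h3 | h3
    · rw [hκ k j (by omega) hj, hκ (k + 1) j (by omega) (hJ _ _ hjn (by omega) h3)]
    · have hjlt : j < π.n := by
        rcases hjn.eq_or_lt with h | h
        · rw [h, hT'l] at h3
          omega
        · exact h
      have h4 : J (k + 1) = j + 1 := hJ _ _ hjlt h3.ge (by
        rw [← Nat.succ_eq_add_one k, h3]
        exact hT'mono _ _ (by omega) (by omega))
      have h5 := π.chain ⟨j, hjlt⟩
      rw [hκ k j (by omega) hj, hκ (k + 1) (j + 1) (by omega) h4]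
      have h6 : (((k + 1 : ℕ) : ℚ) / N) = π.a (Fin.succ ⟨j, hjlt⟩).castSucc := by
        rw [hT, ← Nat.succ_eq_add_one k, h3, hT' _ (by omega)]
        rfl
      rw [h6]
      exact h5
  · ext t
    have h := sum_group (fun k => min (t : ℝ) ((k : ℝ) / N)) (fun k => cosetWeight (κ k))
      (fun j => if h : j < π.n + 1 then cosetWeight (π.τ ⟨j, h⟩) else 0) T' (π.n + 1) hT'0
      (fun j hj => (hT'mono j (j + 1) (by omega) (by omega)).le)
      (fun j hj k h1 h2 => by
        simp only [dif_pos hj]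
        rw [hκ k j hj (hJ k j (by omega) h1 h2)])
    rw [hT'l] at h
    rw [lsGridPath, gridPath, h, Finset.sum_range, LSPath.toPath]
    refine Finset.sum_congr rfl fun j _ => ?_
    have h1 : ∀ x : Fin (π.n + 2), (π.a x : ℝ) = (T' x : ℝ) / N := fun x => by
      rw [hT, hT' _ x.2]
      push_cast
      rfl
    rw [h1, h1, dif_pos j.2]
    rfl
  · rw [hκ 0 0 (by omega) (hJ 0 0 (by omega) hT'0.le (by
      have := hT'mono 0 1 (by omega) (by omega)
      rwa [hT'0] at this))]
    rfl
  · rw [hκ (N - 1) π.n (by omega) (hJ _ _ le_rfl (by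
      have := hT'mono π.n (π.n + 1) (by omega) (by omega)
      omega) (by omega))]
    rfl

/-- An equidistant description comes from an LS path, whose numbers `a_j` are the points where the
direction changes. -/
theorem IsLSGrid.exists_lsPath (hlam : D.IsDominantIntegral lam) {N : ℕ} {κ : ℕ → D.Cosets lam}
    (h : IsLSGrid N κ) : ∃ π : D.LSPath lam,
    π.toPath = lsGridPath N κ ∧ π.initialDirection = κ 0 ∧ π.finalDirection = κ (N - 1) := by
  classical
  have hN := h.pos
  have hNq : (0 : ℚ) < N := by exact_mod_cast hN
  -- The points where the direction changes, together with the two end points.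
  let S : Finset ℕ := {0, N} ∪ (Finset.range N).filter fun k => 0 < k ∧ κ (k - 1) ≠ κ k
  have hS : ∀ k, k ∈ S ↔ k = 0 ∨ k = N ∨ (k < N ∧ 0 < k ∧ κ (k - 1) ≠ κ k) := by
    intro k
    simp [S]
  obtain ⟨n, hn⟩ : ∃ n, S.card = n + 2 := by
    have : 1 < S.card := Finset.one_lt_card.2
      ⟨0, (hS 0).2 (by simp), N, (hS N).2 (by simp), hN.ne⟩
    exact ⟨S.card - 2, by omega⟩
  let T := S.orderEmbOfFin hn
  have hT0 : T 0 = 0 := by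
    have h0 := Finset.range_orderEmbOfFin S hn
    have h1 : (0 : ℕ) ∈ Set.range T := by
      rw [h0]
      exact (hS 0).2 (by simp)
    obtain ⟨i, hi⟩ := h1
    have := T.monotone (Fin.zero_le i)
    omega
  have hTS : ∀ j, T j ∈ S := fun j => Finset.orderEmbOfFin_mem S hn j
  have hTN : ∀ j, T j ≤ N := fun j => by
    have := (hS _).1 (hTS j)
    omega
  have hTl : T (Fin.last _) = N := by
    have h0 := Finset.range_orderEmbOfFin S hn
    have h1 : N ∈ Set.range T := by
      rw [h0]
      exact (hS N).2 (by simp)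
    obtain ⟨i, hi⟩ := h1
    have := T.monotone (Fin.le_last i)
    have := hTN (Fin.last _)
    omega
  have hTmono : StrictMono T := T.strictMono
  have hconst : ∀ (j : Fin (n + 1)) k, T j.castSucc ≤ k → k < T j.succ →
      κ k = κ (T j.castSucc) := by
    intro j k h1
    induction k, h1 using Nat.le_induction with
    | base => exact fun _ => rfl
    | succ k hk ih =>
      intro h2
      rw [← ih (by omega)]
      by_contra hne
      have h3 : k + 1 ∈ S := (hS _).2 (Or.inr (Or.inr
        ⟨h2.trans_le (hTN _), by omega, by simpa using Ne.symm hne⟩))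
      have h4 : (k + 1) ∈ Set.range T := by
        rw [Finset.range_orderEmbOfFin S hn]
        exact h3
      obtain ⟨i, hi⟩ := h4
      have h5 : T j.castSucc < T i := by omega
      have h6 : T i < T j.succ := by omega
      rw [hTmono.lt_iff_lt] at h5 h6
      rw [Fin.lt_def] at h5 h6
      simp at h5 h6
      omega
  have hstep : ∀ j : Fin n,
      IsChain ((T j.succ.castSucc : ℚ) / N) (κ (T j.castSucc.castSucc)) (κ (T j.succ.castSucc)) ∧
      κ (T j.succ.castSucc) ≠ κ (T j.castSucc.castSucc) := by
    intro j
    have h1 : T j.castSucc.castSucc < T j.succ.castSucc := hTmono (by simp [Fin.lt_def])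
    have h2 : T j.succ.castSucc < N := by
      rw [← hTl]
      exact hTmono (Fin.castSucc_lt_last _)
    have h3 := hconst j.castSucc (T j.succ.castSucc - 1) (by omega) (by
      have : T j.castSucc.succ = T j.succ.castSucc := by rw [Fin.succ_castSucc]
      omega)
    have h4 := h.chain (T j.succ.castSucc - 1) (by omega)
    rw [Nat.sub_add_cancel (by omega), h3] at h4
    refine ⟨h4, ?_⟩
    rw [← h3]
    have := (hS _).1 (hTS j.succ.castSucc)
    rcases this with h5 | h5 | h5
    · omega
    · omega
    · exact h5.2.2.symm
  refine ⟨{ n := n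
            τ := fun j => κ (T j.castSucc)
            a := fun j => (T j : ℚ) / N
            a_zero := by rw [hT0]; simp
            a_last := by rw [hTl]; exact div_self hNq.ne'
            a_strictMono := fun i j hij => by
              simp only
              rw [div_lt_div_iff_of_pos_right hNq]
              exact_mod_cast hTmono hij
            decreasing := fun j => ⟨(hstep j).1.cosetLE hlam, (hstep j).2⟩
            chain := fun j => (hstep j).1 }, ?_, ?_, ?_⟩
  · ext t
    let T' : ℕ → ℕ := fun j => if h : j < n + 2 then T ⟨j, h⟩ else N
    have hT' : ∀ j (h : j < n + 2), T' j = T ⟨j, h⟩ := fun j h => dif_pos h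
    have hsum := sum_group (fun k => min (t : ℝ) ((k : ℝ) / N)) (fun k => cosetWeight (κ k))
      (fun j => cosetWeight (κ (T' j))) T' (n + 1)
      (by rw [hT' 0 (by omega)]; exact hT0)
      (fun j hj => by
        rw [hT' j (by omega), hT' (j + 1) (by omega)]
        exact hTmono.monotone (by simp [Fin.le_def]))
      (fun j hj k h1 h2 => by
        rw [hT' j (by omega)] at h1 ⊢
        rw [hT' (j + 1) (by omega)] at h2
        rw [hconst ⟨j, hj⟩ k h1 h2]
        rfl)
    have hT'l : T' (n + 1) = N := by rw [hT' _ (by omega)]; exact hTl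
    rw [hT'l] at hsum
    rw [lsGridPath, gridPath, hsum, Finset.sum_range, LSPath.toPath]
    refine Finset.sum_congr rfl fun j _ => ?_
    simp only
    rw [hT' _ (by omega), hT' _ (by omega)]
    push_cast
    rfl
  · change κ (T (Fin.castSucc 0)) = κ 0
    rw [Fin.castSucc_zero, hT0]
  · change κ (T (Fin.last n).castSucc) = κ (N - 1)
    have h1 : T (Fin.last n).castSucc < T (Fin.last n).succ := hTmono (by simp [Fin.lt_def])
    rw [Fin.succ_last, hTl] at h1
    refine (hconst (Fin.last n) (N - 1) (by omega) ?_).symm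
    rw [Fin.succ_last, hTl]
    omega

end LSGrid

/-! ### Piecewise linear functions on a subdivision -/

section RealGrid

variable {N : ℕ} {m : ℕ → ℝ}

variable (N m) in
/-- The value of a real piecewise linear function at the `k`-th point of the subdivision. -/
def node (k : ℕ) : ℝ := gridPath N m ((k : ℝ) / N)

@[simp]
theorem node_zero : node N m 0 = 0 := by
  simp [node, gridPath_zero]

theorem node_last (hN : 0 < N) : node N m N = gridPath N m 1 := by
  have : (N : ℝ) ≠ 0 := by positivity
  rw [node, div_self this]

theorem node_succ {k : ℕ} (hk : k < N) : node N m (k + 1) = node N m k + m k / N := by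
  rw [node, gridPath_succ hk, node, smul_eq_mul]
  ring

theorem node_lt_succ_iff {k : ℕ} (hk : k < N) : node N m k < node N m (k + 1) ↔ 0 < m k := by
  have hN : (0 : ℝ) < N := by exact_mod_cast (Nat.zero_le k).trans_lt hk
  rw [node_succ hk, lt_add_iff_pos_right, div_pos_iff_of_pos_right hN]

theorem node_succ_lt_iff {k : ℕ} (hk : k < N) : node N m (k + 1) < node N m k ↔ m k < 0 := by
  have hN : (0 : ℝ) < N := by exact_mod_cast (Nat.zero_le k).trans_lt hk
  rw [node_succ hk, add_lt_iff_neg_left, div_lt_iff₀ hN, zero_mul]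

theorem exists_grid_interval {a b : ℕ} (hab : a < b) {t : ℝ} (h1 : (a : ℝ) / N ≤ t)
    (h2 : t ≤ (b : ℝ) / N) :
    ∃ k, a ≤ k ∧ k < b ∧ (k : ℝ) / N ≤ t ∧ t ≤ ((k + 1 : ℕ) : ℝ) / N := by
  induction b, hab using Nat.le_induction with
  | base => exact ⟨a, le_rfl, by simp, h1, h2⟩
  | succ b hb ih =>
    rcases le_total t ((b : ℝ) / N) with h | h
    · obtain ⟨k, h3, h4, h5⟩ := ih h
      exact ⟨k, h3, by omega, h5⟩
    · exact ⟨b, by omega, by omega, h, h2⟩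

/-- A lower bound at the points of the subdivision is a lower bound in between. -/
theorem le_gridPath {a b : ℕ} (hab : a ≤ b) (hb : b ≤ N) {c : ℝ}
    (hc : ∀ k, a ≤ k → k ≤ b → c ≤ node N m k) {t : ℝ} (h1 : (a : ℝ) / N ≤ t)
    (h2 : t ≤ (b : ℝ) / N) : c ≤ gridPath N m t := by
  rcases hab.eq_or_lt with rfl | hab
  · rw [← le_antisymm h1 h2]
    exact hc a le_rfl le_rfl
  obtain ⟨k, h3, h4, h5, h6⟩ := exists_grid_interval hab h1 h2
  rw [gridPath_of_mem (by omega) m h5 h6, smul_eq_mul]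
  have e1 := hc k h3 h4.le
  have e2 := hc (k + 1) (by omega) (by omega)
  rw [node_succ (by omega)] at e2
  rw [node] at e1 e2
  have h7 : (t - (k : ℝ) / N) ≤ 1 / N := by
    rw [sub_le_iff_le_add, ← add_div]
    convert h6 using 2
    push_cast
    ring
  rcases le_total 0 (m k) with h | h
  · have := mul_nonneg (sub_nonneg.2 h5) h
    linarith
  · have := mul_le_mul_of_nonpos_right h7 h
    have e3 : 1 / (N : ℝ) * m k = m k / N := by ring
    linarith

/-- Restricting the velocities to the intervals between `a / N` and `b / N` gives the function
whose values are clamped to this part of `[0, 1]`. -/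
theorem gridPath_indicator (hN : 0 < N) {a b : ℕ} (hab : a ≤ b) {t : ℝ} :
    gridPath N (fun k => if a ≤ k ∧ k < b then m k else 0) t =
      gridPath N m (max ((a : ℝ) / N) (min t ((b : ℝ) / N))) - node N m a := by
  have hN' : (0 : ℝ) < N := by exact_mod_cast hN
  have hmono : ∀ a b : ℕ, a ≤ b → (a : ℝ) / N ≤ (b : ℝ) / N := fun a b h => by gcongr
  rw [node, gridPath, gridPath, gridPath, ← Finset.sum_sub_distrib]
  refine Finset.sum_congr rfl fun k _ => ?_
  rw [← sub_smul]
  have h0 := hmono a b hab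
  have h1 := hmono k (k + 1) (by omega)
  by_cases hk : a ≤ k ∧ k < b
  · rw [if_pos hk]
    have h2 := hmono a k hk.1
    have h3 := hmono (k + 1) b hk.2
    congr 1
    generalize (k : ℝ) / N = x at *
    generalize ((k + 1 : ℕ) : ℝ) / N = x' at *
    generalize (a : ℝ) / N = α at *
    generalize (b : ℝ) / N = β at *
    rw [min_eq_left (h2.trans h1), min_eq_left h2, sub_self, sub_zero]
    rcases le_total t α with h | h
    · rw [min_eq_left (show t ≤ x' by linarith), min_eq_left (show t ≤ x by linarith),
        min_eq_left (show t ≤ β by linarith), max_eq_left h, min_eq_left (h2.trans h1),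
        min_eq_left h2]
      ring
    · rcases le_total t β with h' | h'
      · rw [min_eq_left h', max_eq_right h]
      · rw [min_eq_right (show x' ≤ t by linarith), min_eq_right (show x ≤ t by linarith),
          min_eq_right h', max_eq_right h0, min_eq_right h3, min_eq_right (h1.trans h3)]
  · rw [if_neg hk, smul_zero]
    have h4 : (k : ℝ) / N ≤ (k + 1 : ℕ) / N := h1
    have hc1 : (a : ℝ) / N ≤ max ((a : ℝ) / N) (min t ((b : ℝ) / N)) := le_max_left _ _
    have hc2 : max ((a : ℝ) / N) (min t ((b : ℝ) / N)) ≤ (b : ℝ) / N :=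
      max_le h0 (min_le_right _ _)
    generalize max ((a : ℝ) / N) (min t ((b : ℝ) / N)) = c at *
    rcases lt_or_ge k a with h | h
    · have h2 := hmono (k + 1) a h
      rw [min_eq_right (by linarith), min_eq_right (by linarith), min_eq_right (by linarith),
        min_eq_right (by linarith), sub_self, zero_smul]
    · have h2 := hmono b k (by omega)
      rw [min_eq_left (by linarith), min_eq_left (by linarith), min_eq_left (by linarith),
        min_eq_left (by linarith)]
      simp

theorem gridPath_monotoneOn {a b : ℕ} (hm : ∀ k, a ≤ k → k < b → 0 ≤ m k) :
    MonotoneOn (gridPath N m) (Set.Icc ((a : ℝ) / N) ((b : ℝ) / N)) := by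
  intro s hs t ht hst
  have hmono : ∀ a b : ℕ, a ≤ b → (a : ℝ) / N ≤ (b : ℝ) / N := fun a b h => by gcongr
  rw [← sub_nonneg, gridPath, gridPath, ← Finset.sum_sub_distrib]
  refine Finset.sum_nonneg fun k _ => ?_
  rw [← sub_smul, smul_eq_mul]
  have h1 := hmono k (k + 1) (by omega)
  by_cases hk : a ≤ k ∧ k < b
  · refine mul_nonneg ?_ (hm k hk.1 hk.2)
    generalize (k : ℝ) / N = x at *
    generalize ((k + 1 : ℕ) : ℝ) / N = x' at *
    rcases le_total t x with h | h
    · rw [min_eq_left (h.trans h1), min_eq_left h, min_eq_left (by linarith),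
        min_eq_left (by linarith)]
      linarith
    · rw [min_eq_right h]
      rcases le_total s x' with h' | h'
      · rw [min_eq_left h']
        have := le_min hst h'
        rcases le_total s x with h'' | h''
        · rw [min_eq_left h'']
          have := le_min h h1
          linarith
        · rw [min_eq_right h'']
          linarith
      · rw [min_eq_right h', min_eq_right (h'.trans hst), min_eq_right (h1.trans h')]
        linarith
  · obtain ⟨hs1, hs2⟩ := hs
    obtain ⟨ht1, ht2⟩ := ht
    have : (min t (((k + 1 : ℕ) : ℝ) / N) - min t ((k : ℝ) / N)) -
        (min s (((k + 1 : ℕ) : ℝ) / N) - min s ((k : ℝ) / N)) = 0 := by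
      rcases lt_or_ge k a with h | h
      · have h2 := hmono (k + 1) a h
        rw [min_eq_right (by linarith), min_eq_right (by linarith), min_eq_right (by linarith),
          min_eq_right (by linarith), sub_self]
      · have h2 := hmono b k (by omega)
        rw [min_eq_left (by linarith), min_eq_left (by linarith), min_eq_left (by linarith),
          min_eq_left (by linarith)]
        simp
    rw [this, zero_mul]

theorem gridPath_antitoneOn {a b : ℕ} (hm : ∀ k, a ≤ k → k < b → m k ≤ 0) :
    AntitoneOn (gridPath N m) (Set.Icc ((a : ℝ) / N) ((b : ℝ) / N)) := by
  have h := gridPath_monotoneOn (N := N) (m := fun k => -m k) (a := a) (b := b)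
    (fun k h1 h2 => neg_nonneg.2 (hm k h1 h2))
  intro s hs t ht hst
  have := h hs ht hst
  have e : ∀ t, gridPath N (fun k => -m k) t = -gridPath N m t := fun t => by
    simp [gridPath]
  rw [e, e] at this
  linarith

/-- The integrality that the pairing of an LS path with a simple coroot enjoys: its value is an
integer at the end, where it is constant, and where it turns from decreasing to increasing. -/
structure IntegralGrid (N : ℕ) (m : ℕ → ℝ) : Prop where
  pos : 0 < N
  last : gridPath N m 1 ∈ ints
  flat : ∀ k < N, m k = 0 → node N m k ∈ ints
  turn : ∀ k, k + 1 < N → m k < 0 → 0 < m (k + 1) → node N m (k + 1) ∈ ints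

theorem IntegralGrid.turn' (h : IntegralGrid N m) {k : ℕ} (hk : k + 1 < N) (h1 : m k ≤ 0)
    (h2 : 0 ≤ m (k + 1)) : node N m (k + 1) ∈ ints := by
  rcases h2.lt_or_eq with h2 | h2
  · rcases h1.lt_or_eq with h1 | h1
    · exact h.turn k hk h1 h2
    · rw [node_succ (by omega), h1, zero_div, add_zero]
      exact h.flat k (by omega) h1
  · exact h.flat _ hk h2.symm

/-- `Q` is the minimum of the function `h`. -/
def HasMin (h : unitInterval → ℝ) (Q : ℤ) : Prop := (∀ t, (Q : ℝ) ≤ h t) ∧ ∃ t, h t = Q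

theorem HasMin.unique {h : unitInterval → ℝ} {Q Q' : ℤ} (hQ : HasMin h Q) (hQ' : HasMin h Q') :
    Q = Q' := by
  obtain ⟨h1, t, h2⟩ := hQ
  obtain ⟨h3, t', h4⟩ := hQ'
  have e1 := h1 t'
  have e2 := h3 t
  rw [h4] at e1
  rw [h2] at e2
  exact le_antisymm (by exact_mod_cast e1) (by exact_mod_cast e2)

/-- The point `k / N` of the unit interval. -/
def gridPt (hN : 0 < N) {k : ℕ} (hk : k ≤ N) : unitInterval :=
  ⟨(k : ℝ) / N, by positivity, by
    have : (0 : ℝ) < N := by exact_mod_cast hN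
    rw [div_le_one this]
    exact_mod_cast hk⟩

theorem gridPt_le (hN : 0 < N) {k l : ℕ} (hkl : k ≤ l) (hl : l ≤ N) :
    gridPt hN (hkl.trans hl) ≤ gridPt hN hl := by
  change (k : ℝ) / N ≤ (l : ℝ) / N
  gcongr

/-- The minimum `Q` over the points of the subdivision is an integer; `q` and `p` are the first and
the last point where it is attained. -/
theorem IntegralGrid.exists_min (h : IntegralGrid N m) : ∃ Q : ℤ,
    (∀ k ≤ N, (Q : ℝ) ≤ node N m k) ∧ (∃ q ≤ N, node N m q = Q ∧ ∀ k < q, Q < node N m k) ∧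
    (∃ p ≤ N, node N m p = Q ∧ ∀ k, p < k → k ≤ N → Q < node N m k) := by
  classical
  obtain ⟨q₀, hq₀, hmin⟩ := Finset.exists_min_image (Finset.range (N + 1)) (node N m) ⟨0, by simp⟩
  have hmin' : ∀ k ≤ N, node N m q₀ ≤ node N m k := fun k hk => hmin k (by simpa using by omega)
  have hq₀' : q₀ ≤ N := by simpa [Nat.lt_succ_iff] using hq₀
  have hex : ∃ q, q ≤ N ∧ node N m q = node N m q₀ := ⟨q₀, hq₀', rfl⟩
  obtain ⟨hq, hqe⟩ := Nat.find_spec hex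
  have hfirst : ∀ k < Nat.find hex, node N m q₀ < node N m k := fun k hk =>
    lt_of_le_of_ne (hmin' k (by omega)) fun he => Nat.find_min hex hk ⟨by omega, he.symm⟩
  have hP := Nat.findGreatest_spec (P := fun p => node N m p = node N m q₀) hq₀' rfl
  have hPle := Nat.findGreatest_le (P := fun p => node N m p = node N m q₀) N
  have hPgr := fun k => Nat.findGreatest_is_greatest
    (P := fun p => node N m p = node N m q₀) (n := N) (k := k)
  generalize Nat.find hex = q at hq hqe hfirst
  generalize Nat.findGreatest (fun p => node N m p = node N m q₀) N = p at hP hPle hPgr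
  have hint : node N m q₀ ∈ ints := by
    rw [← hqe]
    rcases q with _ | k
    · rw [node_zero]
      exact zero_mem _
    rcases hq.eq_or_lt with hN | hlt
    · rw [hN, node_last h.pos]
      exact h.last
    · refine h.turn' hlt ?_ ?_
      · refine ((node_succ_lt_iff (show k < N by omega)).1 ?_).le
        rw [hqe]
        exact hfirst k (by omega)
      · by_contra hneg
        have := (node_succ_lt_iff hlt).2 (not_le.1 hneg)
        rw [hqe] at this
        exact (hmin' (k + 1 + 1) hlt).not_gt this
  obtain ⟨Q, hQ⟩ := mem_ints.1 hint
  rw [hQ] at hmin' hqe hfirst hP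
  refine ⟨Q, hmin', ⟨q, hq, hqe, hfirst⟩, ⟨p, hPle, hP, fun k h1 h2 => ?_⟩⟩
  refine lt_of_le_of_ne (hmin' k h2) fun he => hPgr k h1 h2 ?_
  rw [hQ, ← he]

theorem hasMin_of_node (hN : 0 < N) {Q : ℤ} (h1 : ∀ k ≤ N, (Q : ℝ) ≤ node N m k) {q : ℕ}
    (hq : q ≤ N) (h2 : node N m q = Q) : HasMin (fun t => gridPath N m t) Q := by
  have hN' : (N : ℝ) ≠ 0 := by positivity
  refine ⟨fun t => ?_, gridPt hN hq, h2⟩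
  refine le_gridPath (Nat.zero_le N) le_rfl (fun k _ hk => h1 k hk) ?_ ?_
  · simpa using t.2.1
  · rw [div_self hN']
    exact t.2.2

theorem IntegralGrid.mem_ints_of_isLocalMin (h : IntegralGrid N m) {t : unitInterval}
    (ht : IsLocalMin (fun t : unitInterval => gridPath N m t) t) : gridPath N m t ∈ ints := by
  have hN := h.pos
  have hN' : (0 : ℝ) < N := by exact_mod_cast hN
  have hmono : ∀ a b : ℕ, a ≤ b → (a : ℝ) / N ≤ (b : ℝ) / N := fun a b h => by gcongr
  have hmono' : ∀ a b : ℕ, a < b → (a : ℝ) / N < (b : ℝ) / N := fun a b h => by gcongr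
  have hle : ∀ k ≤ N, (k : ℝ) / N ≤ 1 := fun k hk => by
    rw [div_le_one hN']
    exact_mod_cast hk
  obtain ⟨ε, hε, hmin⟩ := Metric.eventually_nhds_iff.1 ht
  have hmin' : ∀ s : ℝ, 0 ≤ s → s ≤ 1 → |s - t| < ε → gridPath N m t ≤ gridPath N m s :=
    fun s h0 h1 h2 => hmin (y := ⟨s, h0, h1⟩) h2
  -- The velocities on the two sides of a local minimum have the expected signs.
  have hright : ∀ k < N, (k : ℝ) / N ≤ t → (t : ℝ) < ((k + 1 : ℕ) : ℝ) / N → 0 ≤ m k := by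
    intro k hk h1 h2
    set s := min ((t : ℝ) + ε / 2) (((k + 1 : ℕ) : ℝ) / N) with hs
    have hts : (t : ℝ) < s := lt_min (by linarith) h2
    have hs1 : s ≤ ((k + 1 : ℕ) : ℝ) / N := min_le_right _ _
    have hs2 : s ≤ t + ε / 2 := min_le_left _ _
    have := hmin' s (t.2.1.trans hts.le) (hs1.trans (hle _ hk)) (by
      rw [abs_of_pos (by linarith)]
      linarith)
    rw [gridPath_of_mem hk m h1 h2.le, gridPath_of_mem hk m (by linarith) hs1] at this
    simp only [smul_eq_mul] at this
    by_contra hneg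
    have := mul_lt_mul_of_neg_right hts (not_le.1 hneg)
    linarith
  have hleft : ∀ k < N, (k : ℝ) / N < t → (t : ℝ) ≤ ((k + 1 : ℕ) : ℝ) / N → m k ≤ 0 := by
    intro k hk h1 h2
    set s := max ((t : ℝ) - ε / 2) ((k : ℝ) / N) with hs
    have hts : s < t := max_lt (by linarith) h1
    have hs1 : (k : ℝ) / N ≤ s := le_max_right _ _
    have hs2 : t - ε / 2 ≤ s := le_max_left _ _
    have := hmin' s (le_trans (by positivity) hs1) (hts.le.trans t.2.2) (by
      rw [abs_of_neg (by linarith)]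
      linarith)
    rw [gridPath_of_mem hk m h1.le h2, gridPath_of_mem hk m hs1 (by linarith)] at this
    simp only [smul_eq_mul] at this
    by_contra hneg
    have := mul_lt_mul_of_pos_right hts (not_le.1 hneg)
    linarith
  rcases t.2.2.eq_or_lt with h1 | h1
  · rw [h1]
    exact h.last
  obtain ⟨k, -, hk, hk1, hk2⟩ := exists_grid_interval hN (t := t) (by simpa using t.2.1) (by
    rw [div_self hN'.ne']
    exact h1.le)
  -- The grid interval is chosen such that `t` is not its right end.
  obtain ⟨k, hk, hk1, hk2⟩ : ∃ k < N, (k : ℝ) / N ≤ t ∧ (t : ℝ) < ((k + 1 : ℕ) : ℝ) / N := by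
    rcases hk2.lt_or_eq with hk2 | hk2
    · exact ⟨k, hk, hk1, hk2⟩
    · refine ⟨k + 1, ?_, hk2.ge, ?_⟩
      · rw [hk2, div_lt_one hN'] at h1
        exact_mod_cast h1
      · rw [hk2]
        exact hmono' _ _ (by omega)
  have hr := hright k hk hk1 hk2
  rcases hk1.lt_or_eq with hk1' | hk1'
  · have hm0 := (hleft k hk hk1' hk2.le).antisymm hr
    rw [gridPath_of_mem hk m hk1 hk2.le, hm0, smul_zero, add_zero]
    exact h.flat k hk hm0
  · rw [← hk1']
    rcases k with _ | k
    · rw [Nat.cast_zero, zero_div, gridPath_zero]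
      exact zero_mem _
    · exact h.turn' hk (hleft k (by omega) (by rw [← hk1']; exact hmono' _ _ (by omega)) hk1'.ge) hr

/-- No integer lies strictly between two consecutive values at the points of the subdivision. -/
def Adapted (N : ℕ) (m : ℕ → ℝ) : Prop :=
  ∀ k < N, ∀ n : ℤ, 0 ≤ ((n : ℝ) - node N m k) * (n - node N m (k + 1))

/-- A subdivision can be refined such that a given piecewise linear function with integral slopes
takes no integral value inside the intervals of the subdivision, unless it is constant there. -/
theorem exists_adapted (hN : 0 < N) (hm : ∀ k, m k ∈ ints) :
    ∃ K, 0 < K ∧ Adapted (N * K) fun k => m (k / K) := by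
  have hN' : (0 : ℝ) < N := by exact_mod_cast hN
  choose c hc using fun k => mem_ints.1 (hm k)
  -- A common multiple of the nonzero slopes.
  let K := ∏ k ∈ Finset.range N, max 1 (c k).natAbs
  have hK : 0 < K := Finset.prod_pos fun k _ => by positivity
  have hK' : (0 : ℝ) < K := by exact_mod_cast hK
  have hdvd : ∀ k < N, c k ≠ 0 → ∃ d : ℤ, (K : ℤ) = c k * d := by
    intro k hk h0
    have h1 : max 1 (c k).natAbs ∣ K := Finset.dvd_prod_of_mem _ (Finset.mem_range.2 hk)
    rw [max_eq_right (Int.natAbs_pos.2 h0)] at h1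
    exact Int.natAbs_dvd.1 (Int.natCast_dvd_natCast.2 h1)
  have hnode : ∀ k ≤ N, ∃ A : ℤ, node N m k * N = A := by
    intro k
    induction k with
    | zero => exact fun _ => ⟨0, by simp⟩
    | succ k ih =>
      intro hk
      obtain ⟨A, hA⟩ := ih (by omega)
      refine ⟨A + c k, ?_⟩
      rw [node_succ (by omega), add_mul, hA, div_mul_cancel₀ _ hN'.ne', hc]
      push_cast
      rfl
  refine ⟨K, hK, fun j hj n => ?_⟩
  have hk : j / K < N := by
    rw [Nat.div_lt_iff_lt_mul hK]
    exact hj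
  have hr : j % K < K := Nat.mod_lt _ hK
  have hj' : j = j / K * K + j % K := (Nat.div_add_mod' j K).symm
  generalize j / K = k at hk hj'
  generalize j % K = r at hr hj'
  subst hj'
  have hval : ∀ r ≤ K, node (N * K) (fun k => m (k / K)) (k * K + r) =
      node N m k + r / (N * K) * c k := by
    intro r hr
    have e : ((k * K + r : ℕ) : ℝ) / ((N * K : ℕ) : ℝ) = k / N + r / (N * K) := by
      push_cast
      rw [add_div, mul_div_mul_right _ _ hK'.ne']
    have h1 : (r : ℝ) / (N * K) ≤ 1 / N := by
      rw [div_le_div_iff₀ (by positivity) hN', one_mul, mul_comm]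
      gcongr
    rw [node, gridPath_mul N hK, e, gridPath_of_mem hk m (by
      have : (0 : ℝ) ≤ r / (N * K) := by positivity
      linarith) (by
      push_cast
      rw [add_div]
      linarith), node, hc, smul_eq_mul]
    ring
  rw [hval r hr.le, add_assoc, hval (r + 1) hr]
  obtain ⟨A, hA⟩ := hnode k hk.le
  have hA' : node N m k = A / N := by rw [← hA, mul_div_cancel_right₀ _ hN'.ne']
  have hint : 0 ≤ ((n * N - A) * K - r * c k) * ((n * N - A) * K - (r + 1) * c k) := by
    by_cases h0 : c k = 0
    · rw [h0, mul_zero, mul_zero, sub_zero]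
      exact mul_self_nonneg _
    · obtain ⟨d, hd⟩ := hdvd k hk h0
      rw [hd]
      have e : ((n * N - A) * (c k * d) - r * c k) * ((n * N - A) * (c k * d) - (r + 1) * c k) =
          c k ^ 2 * (((n * N - A) * d - r) * ((n * N - A) * d - r - 1)) := by ring
      rw [e]
      refine mul_nonneg (sq_nonneg _) ?_
      generalize (n * N - A) * d - r = z
      rcases le_or_gt z 0 with h | h
      · exact mul_nonneg_of_nonpos_of_nonpos h (by omega)
      · exact mul_nonneg h.le (by omega)
  have hreal : (0 : ℝ) ≤ ((n * N - A) * K - r * c k) * ((n * N - A) * K - (r + 1) * c k) := by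
    exact_mod_cast hint
  have e : ((n : ℝ) - (node N m k + r / (N * K) * c k)) *
      (n - (node N m k + ((r + 1 : ℕ) : ℝ) / (N * K) * c k)) =
      (((n * N - A) * K - r * c k) * ((n * N - A) * K - (r + 1) * c k)) / (N * K) ^ 2 := by
    rw [hA']
    push_cast
    field_simp
    ring
  rw [e]
  positivity

end RealGrid

/-! ### Root operators on general paths -/

section Profiles

variable {ι E : Type*} [AddCommGroup E] [Module ℝ E] {D : KacMoodyDatum ι E}

/-- The shape of a function `h` with minimum `Q` on which the operator `e` acts by reflecting the
part between `y` and `q`: it is at least `Q + 1` up to `y`, and decreases from `Q + 1` to `Q`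
between `y` and `q`. -/
structure DownProfile (h : unitInterval → ℝ) (Q : ℤ) (y q : unitInterval) : Prop where
  le : y ≤ q
  before : ∀ t ≤ y, (Q : ℝ) + 1 ≤ h t
  anti : AntitoneOn h (Set.Icc y q)
  left : h y = Q + 1
  right : h q = Q
  ge : ∀ t, (Q : ℝ) ≤ h t

/-- The shape of a function `h` with minimum `Q` on which the operator `f` acts by reflecting the
part between `p` and `x`: it increases from `Q` to `Q + 1` between `p` and `x`, and is at least
`Q + 1` from `x` on. -/
structure UpProfile (h : unitInterval → ℝ) (Q : ℤ) (p x : unitInterval) : Prop where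
  le : p ≤ x
  after : ∀ t, x ≤ t → (Q : ℝ) + 1 ≤ h t
  mono : MonotoneOn h (Set.Icc p x)
  left : h p = Q
  right : h x = Q + 1
  ge : ∀ t, (Q : ℝ) ≤ h t

theorem bddBelow_of_le {h : unitInterval → ℝ} {Q : ℤ} (hQ : ∀ t, (Q : ℝ) ≤ h t)
    (s : Set unitInterval) : BddBelow (Set.range fun u : s => h u) :=
  ⟨Q, by
    rintro _ ⟨u, rfl⟩
    exact hQ u⟩

theorem DownProfile.hasMin {h : unitInterval → ℝ} {Q : ℤ} {y q : unitInterval}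
    (hp : DownProfile h Q y q) : HasMin h Q := ⟨hp.ge, q, hp.right⟩

theorem UpProfile.hasMin {h : unitInterval → ℝ} {Q : ℤ} {p x : unitInterval}
    (hp : UpProfile h Q p x) : HasMin h Q := ⟨hp.ge, p, hp.left⟩

/-- The coefficient of `α_i` in the definition of `e` is the amount by which `h` has dropped since
`y`. -/
theorem DownProfile.shift {h : unitInterval → ℝ} {Q : ℤ} {y q : unitInterval}
    (hp : DownProfile h Q y q) (t : unitInterval) :
    max 0 (min 1 ((Q : ℝ) + 1 - ⨅ u : Set.Iic t, h u)) = Q + 1 - h (max y (min t q)) := by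
  have hb := bddBelow_of_le hp.ge (Set.Iic t)
  have : Nonempty (Set.Iic t) := ⟨t, le_refl t⟩
  rcases le_total t y with h1 | h1
  · have h2 : (Q : ℝ) + 1 ≤ ⨅ u : Set.Iic t, h u :=
      le_ciInf fun u => hp.before u (le_trans u.2 h1)
    rw [min_eq_left (h1.trans hp.le), max_eq_left h1, hp.left, sub_self,
      max_eq_left ((min_le_right _ _).trans (by linarith))]
  rcases le_total t q with h2 | h2
  · have h3 : ⨅ u : Set.Iic t, h u = h t := by
      refine le_antisymm (ciInf_le hb ⟨t, le_refl t⟩) (le_ciInf fun u => ?_)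
      rcases le_total (u : unitInterval) y with h4 | h4
      · have e1 := hp.before u h4
        have e2 := hp.anti ⟨le_rfl, hp.le⟩ ⟨h1, h2⟩ h1
        rw [hp.left] at e2
        linarith
      · exact hp.anti ⟨h4, le_trans u.2 h2⟩ ⟨h1, h2⟩ u.2
    have e2 := hp.anti ⟨le_rfl, hp.le⟩ ⟨h1, h2⟩ h1
    rw [hp.left] at e2
    have e3 := hp.ge t
    rw [min_eq_left h2, max_eq_right h1, h3, min_eq_right (by linarith),
      max_eq_right (by linarith)]
  · have h3 : ⨅ u : Set.Iic t, h u = Q := by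
      refine le_antisymm ?_ (le_ciInf fun u => hp.ge u)
      rw [← hp.right]
      exact ciInf_le hb ⟨q, h2⟩
    rw [min_eq_right h2, max_eq_right hp.le, h3, hp.right]
    norm_num

/-- The coefficient of `α_i` in the definition of `f` is the amount by which `h` has grown since
`p`. -/
theorem UpProfile.shift {h : unitInterval → ℝ} {Q : ℤ} {p x : unitInterval}
    (hp : UpProfile h Q p x) (t : unitInterval) :
    max 0 (min 1 ((⨅ u : Set.Ici t, h u) - (Q : ℝ))) = h (max p (min t x)) - Q := by
  have hb := bddBelow_of_le hp.ge (Set.Ici t)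
  have : Nonempty (Set.Ici t) := ⟨t, le_refl t⟩
  rcases le_total x t with h1 | h1
  · have h2 : (Q : ℝ) + 1 ≤ ⨅ u : Set.Ici t, h u :=
      le_ciInf fun u => hp.after u (le_trans h1 u.2)
    rw [min_eq_right h1, max_eq_right hp.le, hp.right, min_eq_left (by linarith)]
    norm_num
  rcases le_total p t with h2 | h2
  · have e2 := hp.mono ⟨h2, h1⟩ ⟨hp.le, le_rfl⟩ h1
    rw [hp.right] at e2
    have h3 : ⨅ u : Set.Ici t, h u = h t := by
      refine le_antisymm (ciInf_le hb ⟨t, le_refl t⟩) (le_ciInf fun u => ?_)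
      rcases le_total x (u : unitInterval) with h4 | h4
      · have e1 := hp.after u h4
        linarith
      · exact hp.mono ⟨h2, h1⟩ ⟨le_trans h2 u.2, h4⟩ u.2
    have e3 := hp.ge t
    rw [min_eq_left h1, max_eq_right h2, h3, min_eq_right (by linarith),
      max_eq_right (by linarith)]
  · have h3 : ⨅ u : Set.Ici t, h u = Q := by
      refine le_antisymm ?_ (le_ciInf fun u => hp.ge u)
      rw [← hp.left]
      exact ciInf_le hb ⟨p, h2⟩
    rw [min_eq_left h1, max_eq_left h2, h3, hp.left]
    norm_num

theorem minHeight_eq {i : ι} {θ : unitInterval → E} {Q : ℤ} (h : HasMin (D.height i θ) Q) :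
    D.minHeight i θ = Q := by
  obtain ⟨h1, t, h2⟩ := h
  refine IsLeast.csInf_eq ⟨⟨t, h2⟩, ?_⟩
  rintro n ⟨u, hu⟩
  have := h1 u
  rw [hu] at this
  exact_mod_cast this

variable (D) in
/-- The path obtained from `θ` by reflecting its part between `y` and `q` by `s_i`, where `Q + 1` is
the value of `h_i` at `y`. -/
def downPath (i : ι) (θ : unitInterval → E) (Q : ℤ) (y q : unitInterval) : unitInterval → E :=
  fun t => θ t + ((Q : ℝ) + 1 - D.height i θ (max y (min t q))) • D.root i

variable (D) in
/-- The path obtained from `θ` by reflecting its part between `p` and `x` by `s_i`, where `Q` is the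
value of `h_i` at `p`. -/
def upPath (i : ι) (θ : unitInterval → E) (Q : ℤ) (p x : unitInterval) : unitInterval → E :=
  fun t => θ t - (D.height i θ (max p (min t x)) - (Q : ℝ)) • D.root i

theorem e_eq_downPath {i : ι} {θ : unitInterval → E} {Q : ℤ} {y q : unitInterval}
    (hp : DownProfile (D.height i θ) Q y q) (hQ : Q ≠ 0) :
    D.e i θ = some (D.downPath i θ Q y q) := by
  have hm := minHeight_eq hp.hasMin
  rw [e, hm, if_neg hQ]
  congr 1
  ext t
  rw [hp.shift, downPath]

theorem f_eq_upPath {i : ι} {θ : unitInterval → E} {Q : ℤ} {p x : unitInterval}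
    (hp : UpProfile (D.height i θ) Q p x) : D.f i θ = some (D.upPath i θ Q p x) := by
  have hm := minHeight_eq hp.hasMin
  have h1 := hp.after 1 (unitInterval.le_one')
  rw [f, hm, if_neg (by linarith)]
  congr 1
  ext t
  rw [hp.shift, upPath]

theorem height_downPath (i : ι) (θ : unitInterval → E) (Q : ℤ) (y q t : unitInterval) :
    D.height i (D.downPath i θ Q y q) t =
      D.height i θ t + 2 * (Q + 1 - D.height i θ (max y (min t q))) := by
  simp only [height, downPath, map_add, map_smul, coroot_root_self, smul_eq_mul]
  ring

theorem height_upPath (i : ι) (θ : unitInterval → E) (Q : ℤ) (p x t : unitInterval) :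
    D.height i (D.upPath i θ Q p x) t =
      D.height i θ t - 2 * (D.height i θ (max p (min t x)) - Q) := by
  simp only [height, upPath, map_sub, map_smul, coroot_root_self, smul_eq_mul]
  ring

theorem clamp_of_mem {y q t : unitInterval} (h : t ∈ Set.Icc y q) : max y (min t q) = t := by
  rw [min_eq_left h.2, max_eq_right h.1]

theorem clamp_mem {y q : unitInterval} (h : y ≤ q) (t : unitInterval) :
    max y (min t q) ∈ Set.Icc y q :=
  ⟨le_max_left _ _, max_le h (min_le_right _ _)⟩

theorem DownProfile.upProfile {i : ι} {θ : unitInterval → E} {Q : ℤ} {y q : unitInterval}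
    (hp : DownProfile (D.height i θ) Q y q) :
    UpProfile (D.height i (D.downPath i θ Q y q)) (Q + 1) y q := by
  have hmid : ∀ t ∈ Set.Icc y q, D.height i (D.downPath i θ Q y q) t =
      2 * (Q + 1) - D.height i θ t := fun t ht => by
    rw [height_downPath, clamp_of_mem ht]
    ring
  have hafter : ∀ t, q ≤ t → D.height i (D.downPath i θ Q y q) t = D.height i θ t + 2 :=
    fun t ht => by
      rw [height_downPath, min_eq_right ht, max_eq_right hp.le, hp.right]
      ring
  have hy : y ∈ Set.Icc y q := ⟨le_rfl, hp.le⟩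
  have hq : q ∈ Set.Icc y q := ⟨hp.le, le_rfl⟩
  refine ⟨hp.le, fun t ht => ?_, fun s hs t ht hst => ?_, ?_, ?_, fun t => ?_⟩
  · rw [hafter t ht]
    have := hp.ge t
    push_cast
    linarith
  · rw [hmid s hs, hmid t ht]
    have := hp.anti hs ht hst
    linarith
  · rw [hmid y hy, hp.left]
    push_cast
    ring
  · rw [hmid q hq, hp.right]
    push_cast
    ring
  · push_cast
    rcases le_total t y with h1 | h1
    · rw [height_downPath, min_eq_left (h1.trans hp.le), max_eq_left h1, hp.left]
      have := hp.before t h1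
      linarith
    rcases le_total t q with h2 | h2
    · rw [hmid t ⟨h1, h2⟩]
      have := hp.anti hy ⟨h1, h2⟩ h1
      rw [hp.left] at this
      linarith
    · rw [hafter t h2]
      have := hp.ge t
      linarith

theorem UpProfile.downProfile {i : ι} {θ : unitInterval → E} {Q : ℤ} {p x : unitInterval}
    (hp : UpProfile (D.height i θ) Q p x) :
    DownProfile (D.height i (D.upPath i θ Q p x)) (Q - 1) p x := by
  have hmid : ∀ t ∈ Set.Icc p x, D.height i (D.upPath i θ Q p x) t =
      2 * Q - D.height i θ t := fun t ht => by
    rw [height_upPath, clamp_of_mem ht]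
    ring
  have hbefore : ∀ t, t ≤ p → D.height i (D.upPath i θ Q p x) t = D.height i θ t :=
    fun t ht => by
      rw [height_upPath, min_eq_left (ht.trans hp.le), max_eq_left ht, hp.left]
      ring
  have hpm : p ∈ Set.Icc p x := ⟨le_rfl, hp.le⟩
  have hxm : x ∈ Set.Icc p x := ⟨hp.le, le_rfl⟩
  refine ⟨hp.le, fun t ht => ?_, fun s hs t ht hst => ?_, ?_, ?_, fun t => ?_⟩
  · rw [hbefore t ht]
    have := hp.ge t
    push_cast
    linarith
  · rw [hmid s hs, hmid t ht]
    have := hp.mono hs ht hst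
    linarith
  · rw [hmid p hpm, hp.left]
    push_cast
    ring
  · rw [hmid x hxm, hp.right]
    push_cast
    ring
  · push_cast
    rcases le_total x t with h1 | h1
    · rw [height_upPath, min_eq_right h1, max_eq_right hp.le, hp.right]
      have := hp.after t h1
      linarith
    rcases le_total p t with h2 | h2
    · rw [hmid t ⟨h2, h1⟩]
      have := hp.mono ⟨h2, h1⟩ hxm h1
      rw [hp.right] at this
      linarith
    · rw [hbefore t h2]
      have := hp.ge t
      linarith

theorem f_downPath {i : ι} {θ : unitInterval → E} {Q : ℤ} {y q : unitInterval}
    (hp : DownProfile (D.height i θ) Q y q) : D.f i (D.downPath i θ Q y q) = some θ := by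
  rw [f_eq_upPath hp.upProfile]
  congr 1
  ext t
  have := clamp_of_mem (clamp_mem hp.le t)
  rw [upPath, height_downPath, this, downPath]
  push_cast
  module

theorem e_upPath {i : ι} {θ : unitInterval → E} {Q : ℤ} {p x : unitInterval}
    (hp : UpProfile (D.height i θ) Q p x) (hQ : Q - 1 ≠ 0) :
    D.e i (D.upPath i θ Q p x) = some θ := by
  rw [e_eq_downPath hp.downProfile hQ]
  congr 1
  ext t
  have := clamp_of_mem (clamp_mem hp.le t)
  rw [downPath, height_upPath, this, upPath]
  push_cast
  module

end Profiles

/-! ### Reflecting a part of an LS path -/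

section Reflection

variable {ι E : Type*} [AddCommGroup E] [Module ℝ E] {D : KacMoodyDatum ι E} {lam : E}

variable (D) in
/-- The sequence of directions with `s_i` applied to the directions with indices in `[a, b)`. -/
def reflectSeq (i : ι) (a b : ℕ) (κ : ℕ → D.Cosets lam) (k : ℕ) : D.Cosets lam :=
  if a ≤ k ∧ k < b then D.s i • κ k else κ k

/-- Reflecting the directions with indices in `[a, b)` translates the path by the multiple of `α_i`
by which `h_i` has changed since `a / N`. -/
theorem lsGridPath_reflectSeq {N : ℕ} (hN : 0 < N) (i : ι) {a b : ℕ} (hab : a ≤ b) (hb : b ≤ N)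
    (κ : ℕ → D.Cosets lam) (t : unitInterval) :
    lsGridPath N (D.reflectSeq i a b κ) t = lsGridPath N κ t -
      (D.height i (lsGridPath N κ) (max (gridPt hN (hab.trans hb)) (min t (gridPt hN hb))) -
        node N (fun k => D.slope i (κ k)) a) • D.root i := by
  have h1 : ∀ k, cosetWeight (D.reflectSeq i a b κ k) = cosetWeight (κ k) +
      (if a ≤ k ∧ k < b then D.slope i (κ k) else 0) • (-D.root i) := by
    intro k
    rw [reflectSeq]
    split_ifs with h
    · rw [cosetWeight_smul, s_smul, slope]
      module
    · simp
  have h2 : ∀ (c : ℕ → ℝ) (t : ℝ) (r : E),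
      gridPath N (fun k => c k • r) t = gridPath N c t • r := by
    intro c t r
    simp [gridPath, Finset.sum_smul, mul_smul]
  have h3 : D.height i (lsGridPath N κ) (max (gridPt hN (hab.trans hb)) (min t (gridPt hN hb))) =
      gridPath N (fun k => D.slope i (κ k)) (max ((a : ℝ) / N) (min (t : ℝ) ((b : ℝ) / N))) := by
    rw [height, lsGridPath, gridPath_map]
    congr 1
  rw [h3, ← gridPath_indicator hN hab, lsGridPath]
  simp only [h1]
  rw [gridPath_add, h2, smul_neg, ← sub_eq_add_neg]
  rfl

theorem height_lsGridPath (i : ι) (N : ℕ) (κ : ℕ → D.Cosets lam) :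
    D.height i (lsGridPath N κ) =
      fun t : unitInterval => gridPath N (fun k => D.slope i (κ k)) t := by
  ext t
  rw [height, lsGridPath, gridPath_map]
  rfl

/-- Summation by parts together with the chain conditions shows that the value of `h_i` at `k / N`
is `k / N` times the next slope, up to an integer. -/
theorem IsLSGrid.node_sub_mem_ints {N : ℕ} {κ : ℕ → D.Cosets lam} (h : IsLSGrid N κ)
    (i : ι) {k : ℕ} (hk : k < N) :
    node N (fun k => D.slope i (κ k)) k - (k : ℝ) / N * D.slope i (κ k) ∈ ints := by
  induction k with
  | zero => simp
  | succ k ih =>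
    have h1 := (h.chain k hk).slope_sub_mem_ints i
    have h2 := add_mem (ih (by omega)) h1
    convert h2 using 1
    rw [node_succ (by omega)]
    push_cast
    ring

theorem IsLSGrid.node_succ_sub_mem_ints {N : ℕ} {κ : ℕ → D.Cosets lam}
    (h : IsLSGrid N κ) (i : ι) {k : ℕ} (hk : k < N) :
    node N (fun k => D.slope i (κ k)) (k + 1) - ((k + 1 : ℕ) : ℝ) / N * D.slope i (κ k) ∈ ints := by
  convert h.node_sub_mem_ints i hk using 1
  rw [node_succ hk]
  push_cast
  ring

theorem IsLSGrid.node_mem_ints_iff {N : ℕ} {κ : ℕ → D.Cosets lam} (h : IsLSGrid N κ)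
    (i : ι) {k : ℕ} (hk : k < N) : node N (fun k => D.slope i (κ k)) (k + 1) ∈ ints ↔
      ((k + 1 : ℕ) : ℝ) / N * D.slope i (κ k) ∈ ints := by
  have := h.node_succ_sub_mem_ints i hk
  exact ⟨fun h1 => by simpa using sub_mem h1 this, fun h1 => by simpa using add_mem this h1⟩

theorem IsLSGrid.integralGrid (hlam : D.IsDominantIntegral lam) {N : ℕ} {κ : ℕ → D.Cosets lam}
    (h : IsLSGrid N κ) (i : ι) : IntegralGrid N fun k => D.slope i (κ k) where
  pos := h.pos
  last := by
    have hN := h.pos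
    have hN' : (N : ℝ) ≠ 0 := by positivity
    rw [← node_last hN]
    obtain ⟨k, rfl⟩ : ∃ k, N = k + 1 := ⟨N - 1, by omega⟩
    rw [h.node_mem_ints_iff i (by omega), div_self hN', one_mul]
    exact slope_mem_ints hlam i _
  flat k hk h0 := by
    have := h.node_sub_mem_ints i hk
    rwa [h0, mul_zero, sub_zero] at this
  turn k hk h1 h2 := by
    rw [h.node_mem_ints_iff i (by omega)]
    have := (IsChain.s_smul_left hlam (h.chain k hk) h1 h2.le).2
    push_cast at this ⊢
    exact this

end Reflection

/-! ### The intervals reflected by the root operators -/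

section Intervals

variable {N : ℕ} {m : ℕ → ℝ}

/-- Let `q` be the first point where the minimum `Q < 0` is attained, and `y` the last point such
that the function is at least `Q + 1` up to `y`. Then the function decreases from `Q + 1` to `Q`
between `y` and `q`, since it cannot turn at a value strictly between `Q` and `Q + 1`. -/
theorem IntegralGrid.exists_down (h : IntegralGrid N m) (ha : Adapted N m) {Q : ℤ} {q : ℕ}
    (hq : q ≤ N) (hqe : node N m q = Q) (hfirst : ∀ k < q, (Q : ℝ) < node N m k) (hQ : Q < 0) :
    ∃ y < q, node N m y = Q + 1 ∧ (∀ k ≤ y, (Q : ℝ) + 1 ≤ node N m k) ∧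
      (∀ k, y ≤ k → k < q → m k < 0) ∧ ∀ k, y < k → k < q → node N m k ∉ ints := by
  classical
  let P : ℕ → Prop := fun k => ∀ j ≤ k, (Q : ℝ) + 1 ≤ node N m j
  have hP0 : P 0 := by
    intro j hj
    rw [Nat.le_zero.1 hj, node_zero]
    exact_mod_cast hQ
  have hPy : P (Nat.findGreatest P N) := Nat.findGreatest_spec (Nat.zero_le N) hP0
  have hyN : Nat.findGreatest P N ≤ N := Nat.findGreatest_le N
  have hgr : ∀ k, Nat.findGreatest P N < k → k ≤ N → ¬ P k := fun k =>
    Nat.findGreatest_is_greatest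
  generalize Nat.findGreatest P N = y at hPy hyN hgr
  have hyq : y < q := by
    by_contra hcon
    have := hPy q (not_lt.1 hcon)
    rw [hqe] at this
    linarith
  have hy1 : node N m (y + 1) < Q + 1 := by
    by_contra hcon
    refine hgr (y + 1) (by omega) (by omega) fun j hj => ?_
    rcases hj.eq_or_lt with rfl | hj
    · exact not_lt.1 hcon
    · exact hPy j (by omega)
  -- The value `Q + 1` is not skipped, since the subdivision is adapted.
  have hyv : node N m y = Q + 1 := by
    have h1 := ha y (by omega) (Q + 1)
    have h2 := hPy y le_rfl
    push_cast at h1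
    have h3 : (0 : ℝ) < Q + 1 - node N m (y + 1) := by linarith
    have := nonneg_of_mul_nonneg_left h1 h3
    linarith
  have key : ∀ k, y ≤ k → k < q → m k < 0 ∧ node N m (k + 1) < Q + 1 := by
    intro k hk
    induction k, hk using Nat.le_induction with
    | base =>
      exact fun _ => ⟨(node_succ_lt_iff (show y < N by omega)).1 (by rwa [hyv]), hy1⟩
    | succ k hk ih =>
      intro hkq
      obtain ⟨h1, h2⟩ := ih (by omega)
      have h3 := hfirst (k + 1) hkq
      have h4 : m (k + 1) < 0 := by
        by_contra hcon
        obtain ⟨n, hn⟩ := mem_ints.1 (h.turn' (by omega) h1.le (not_lt.1 hcon))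
        rw [hn] at h2 h3
        have e1 : n < Q + 1 := by exact_mod_cast h2
        have e2 : Q < n := by exact_mod_cast h3
        omega
      exact ⟨h4, ((node_succ_lt_iff (by omega)).2 h4).trans h2⟩
  refine ⟨y, hyq, hyv, hPy, fun k h1 h2 => (key k h1 h2).1, fun k h1 h2 hint => ?_⟩
  obtain ⟨k, rfl⟩ : ∃ k', k = k' + 1 := ⟨k - 1, by omega⟩
  obtain ⟨n, hn⟩ := mem_ints.1 hint
  have h3 := (key k (by omega) (by omega)).2
  have h4 := hfirst (k + 1) h2
  rw [hn] at h3 h4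
  have e1 : n < Q + 1 := by exact_mod_cast h3
  have e2 : Q < n := by exact_mod_cast h4
  omega

/-- Let `p` be the last point where the minimum `Q` is attained, and `x` the first point such that
the function is at least `Q + 1` from `x` on. Then the function increases from `Q` to `Q + 1`
between `p` and `x`. -/
theorem IntegralGrid.exists_up (h : IntegralGrid N m) (ha : Adapted N m) {Q : ℤ} {p : ℕ}
    (hpN : p ≤ N) (hpe : node N m p = Q) (hlast : ∀ k, p < k → k ≤ N → (Q : ℝ) < node N m k)
    (hQ : (Q : ℝ) + 1 ≤ node N m N) :
    ∃ x, p < x ∧ x ≤ N ∧ node N m x = Q + 1 ∧ (∀ k, x ≤ k → k ≤ N → (Q : ℝ) + 1 ≤ node N m k) ∧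
      (∀ k, p ≤ k → k < x → 0 < m k) ∧ ∀ k, p < k → k < x → node N m k ∉ ints := by
  classical
  have hex : ∃ x, ∀ k, x ≤ k → k ≤ N → (Q : ℝ) + 1 ≤ node N m k :=
    ⟨N, fun k h1 h2 => by rwa [le_antisymm h2 h1]⟩
  have hxs := Nat.find_spec hex
  have hxN : Nat.find hex ≤ N := Nat.find_min' hex fun k h1 h2 => by rwa [le_antisymm h2 h1]
  have hxm := fun k => Nat.find_min hex (m := k)
  generalize Nat.find hex = x at hxs hxN hxm
  have hpx : p < x := by
    by_contra hcon
    have := hxs p (not_lt.1 hcon) hpN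
    rw [hpe] at this
    linarith
  obtain ⟨x, rfl⟩ : ∃ x', x = x' + 1 := ⟨x - 1, by omega⟩
  have hx1 : node N m x < Q + 1 := by
    by_contra hcon
    refine hxm x (by omega) fun k h1 h2 => ?_
    rcases h1.eq_or_lt with rfl | h1
    · exact not_lt.1 hcon
    · exact hxs k h1 h2
  have hxv : node N m (x + 1) = Q + 1 := by
    have h1 := ha x (by omega) (Q + 1)
    have h2 := hxs (x + 1) le_rfl hxN
    push_cast at h1
    have h3 : (0 : ℝ) < Q + 1 - node N m x := by linarith
    have := nonneg_of_mul_nonneg_right h1 h3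
    linarith
  have key : ∀ d k, k + d = x → p ≤ k → 0 < m k ∧ node N m k < Q + 1 := by
    intro d
    induction d with
    | zero =>
      intro k hk _
      obtain rfl : k = x := by omega
      exact ⟨(node_lt_succ_iff (show k < N by omega)).1 (by rwa [hxv]), hx1⟩
    | succ d ih =>
      intro k hkd hpk
      obtain ⟨h1, h2⟩ := ih (k + 1) (by omega) (by omega)
      have h3 := hlast (k + 1) (by omega) (by omega)
      have h4 : 0 < m k := by
        by_contra hcon
        obtain ⟨n, hn⟩ := mem_ints.1 (h.turn' (by omega) (not_lt.1 hcon) h1.le)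
        rw [hn] at h2 h3
        have e1 : n < Q + 1 := by exact_mod_cast h2
        have e2 : Q < n := by exact_mod_cast h3
        omega
      exact ⟨h4, ((node_lt_succ_iff (by omega)).2 h4).trans h2⟩
  refine ⟨x + 1, hpx, hxN, hxv, hxs, fun k h1 h2 => (key (x - k) k (by omega) h1).1,
    fun k h1 h2 hint => ?_⟩
  obtain ⟨n, hn⟩ := mem_ints.1 hint
  have h3 := (key (x - k) k (by omega) h1.le).2
  have h4 := hlast k h1 (by omega)
  rw [hn] at h3 h4
  have e1 : n < Q + 1 := by exact_mod_cast h3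
  have e2 : Q < n := by exact_mod_cast h4
  omega

end Intervals

/-! ### Root operators on LS paths -/

section RootOperators

variable {ι E : Type*} [AddCommGroup E] [Module ℝ E] {D : KacMoodyDatum ι E} {lam : E}

/-- `θ` is an LS path with initial direction `ini` and final direction `fin`. -/
def IsLS (θ : unitInterval → E) (ini fin : D.Cosets lam) : Prop :=
  ∃ (N : ℕ) (κ : ℕ → D.Cosets lam), IsLSGrid N κ ∧ θ = lsGridPath N κ ∧ κ 0 = ini ∧ κ (N - 1) = fin

theorem LSPath.isLS (π : D.LSPath lam) : IsLS π.toPath π.initialDirection π.finalDirection :=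
  π.exists_grid

theorem IsLS.exists_lsPath (hlam : D.IsDominantIntegral lam) {θ : unitInterval → E}
    {ini fin : D.Cosets lam} (h : IsLS θ ini fin) :
    ∃ π : D.LSPath lam, π.toPath = θ ∧ π.initialDirection = ini ∧ π.finalDirection = fin := by
  obtain ⟨N, κ, h1, rfl, rfl, rfl⟩ := h
  exact h1.exists_lsPath hlam

theorem IsLS.exists_adapted (hlam : D.IsDominantIntegral lam) {θ : unitInterval → E}
    {ini fin : D.Cosets lam} (h : IsLS θ ini fin) (i : ι) :
    ∃ (N : ℕ) (κ : ℕ → D.Cosets lam), IsLSGrid N κ ∧ θ = lsGridPath N κ ∧ κ 0 = ini ∧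
      κ (N - 1) = fin ∧ Adapted N fun k => D.slope i (κ k) := by
  obtain ⟨N, κ, h1, rfl, rfl, rfl⟩ := h
  obtain ⟨K, hK, hK'⟩ := KacMoodyDatum.exists_adapted (N := N) (m := fun k => D.slope i (κ k)) h1.pos
    fun k => slope_mem_ints hlam i _
  refine ⟨N * K, fun k => κ (k / K), h1.refine hK, (lsGridPath_mul N κ hK).symm, by simp, ?_, hK'⟩
  change κ _ = κ _
  congr 1
  have := h1.pos
  obtain ⟨n, rfl⟩ : ∃ n, N = n + 1 := ⟨N - 1, by omega⟩
  refine Nat.div_eq_of_lt_le ?_ ?_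
  · rw [add_mul, one_mul, Nat.add_sub_cancel]
    omega
  · rw [Nat.add_sub_cancel]
    have : 0 < (n + 1) * K := Nat.mul_pos this hK
    omega

theorem IsLS.apply_zero {θ : unitInterval → E} {ini fin : D.Cosets lam} (h : IsLS θ ini fin) :
    θ 0 = 0 := by
  obtain ⟨N, κ, h1, rfl, rfl, rfl⟩ := h
  exact gridPath_zero _ _

theorem IsLS.mem_ints_of_isLocalMin (hlam : D.IsDominantIntegral lam) {θ : unitInterval → E}
    {ini fin : D.Cosets lam} (h : IsLS θ ini fin) {i : ι} {t : unitInterval}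
    (ht : IsLocalMin (D.height i θ) t) : D.height i θ t ∈ ints := by
  obtain ⟨N, κ, h1, rfl, rfl, rfl⟩ := h
  rw [height_lsGridPath] at ht ⊢
  exact (h1.integralGrid hlam i).mem_ints_of_isLocalMin ht

theorem IsLS.height_one_mem_ints (hlam : D.IsDominantIntegral lam) {θ : unitInterval → E}
    {ini fin : D.Cosets lam} (h : IsLS θ ini fin) (i : ι) : D.height i θ 1 ∈ ints := by
  obtain ⟨N, κ, h1, rfl, rfl, rfl⟩ := h
  rw [height_lsGridPath]
  exact (h1.integralGrid hlam i).last

theorem IsLS.exists_hasMin (hlam : D.IsDominantIntegral lam) {θ : unitInterval → E}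
    {ini fin : D.Cosets lam} (h : IsLS θ ini fin) (i : ι) : ∃ Q, HasMin (D.height i θ) Q := by
  obtain ⟨N, κ, h1, rfl, rfl, rfl⟩ := h
  rw [height_lsGridPath]
  obtain ⟨Q, h2, ⟨q, hq, hqe, -⟩, -⟩ := (h1.integralGrid hlam i).exists_min
  exact ⟨Q, hasMin_of_node h1.pos h2 hq hqe⟩

theorem IsLS.slope_fin_nonpos {θ : unitInterval → E} {ini fin : D.Cosets lam} (h : IsLS θ ini fin)
    {i : ι} {Q : ℤ} (hQ : HasMin (D.height i θ) Q) (h1 : D.height i θ 1 = Q) :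
    D.slope i fin ≤ 0 := by
  obtain ⟨N, κ, hg, rfl, rfl, rfl⟩ := h
  have hN := hg.pos
  by_contra hcon
  have h2 := (node_lt_succ_iff (N := N) (m := fun k => D.slope i (κ k)) (k := N - 1)
    (by omega)).2 (not_le.1 hcon)
  rw [height_lsGridPath] at hQ h1
  rw [Nat.sub_add_cancel hN, node_last hN] at h2
  have h3 := hQ.1 (gridPt hN (k := N - 1) (by omega))
  have h1' : gridPath N (fun k => D.slope i (κ k)) 1 = Q := h1
  rw [h1'] at h2
  exact h3.not_gt h2

theorem IsLS.slope_ini_nonneg {θ : unitInterval → E} {ini fin : D.Cosets lam} (h : IsLS θ ini fin)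
    {i : ι} (hQ : HasMin (D.height i θ) 0) : 0 ≤ D.slope i ini := by
  obtain ⟨N, κ, hg, rfl, rfl, rfl⟩ := h
  have hN := hg.pos
  by_contra hcon
  have h2 := (node_succ_lt_iff (N := N) (m := fun k => D.slope i (κ k)) (k := 0) hN).2
    (not_le.1 hcon)
  rw [height_lsGridPath] at hQ
  rw [node_zero] at h2
  have h3 := hQ.1 (gridPt hN (k := 0 + 1) (by omega))
  rw [Int.cast_zero] at h3
  exact h3.not_gt h2

/-- The operator `e_i` on an LS path: it reflects the directions in an interval on which the pairing
with `α_i^∨` decreases from `Q + 1` to its minimum `Q`. -/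
theorem IsLS.exists_e (hlam : D.IsDominantIntegral lam) {θ : unitInterval → E}
    {ini fin : D.Cosets lam} (h : IsLS θ ini fin) {i : ι} {Q : ℤ} (hQ : HasMin (D.height i θ) Q)
    (hQ0 : Q ≠ 0) : ∃ (y q : unitInterval) (ini' fin' : D.Cosets lam),
      DownProfile (D.height i θ) Q y q ∧ IsLS (D.downPath i θ Q y q) ini' fin' ∧
      (ini' = ini ∨ ini' = D.s i • ini ∧ D.slope i ini < 0 ∧ Q = -1) ∧
      (fin' = fin ∨ fin' = D.s i • fin ∧ D.slope i fin < 0 ∧ D.height i θ 1 = Q) := by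
  obtain ⟨N, κ, hg, rfl, rfl, rfl, hA⟩ := h.exists_adapted hlam i
  have hN := hg.pos
  have hI := hg.integralGrid hlam i
  obtain ⟨Q', hQle, ⟨q, hq, hqe, hfirst⟩, -⟩ := hI.exists_min
  obtain rfl : Q = Q' := by
    refine hQ.unique ?_
    rw [height_lsGridPath]
    exact hasMin_of_node hN hQle hq hqe
  have hQneg : Q < 0 := by
    have := hQle 0 (by omega)
    rw [node_zero] at this
    have : Q ≤ 0 := by exact_mod_cast this
    omega
  obtain ⟨y, hyq, hyv, hbefore, hneg, hnonint⟩ := hI.exists_down hA hq hqe hfirst hQneg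
  have hyN : y ≤ N := by omega
  have hheight := height_lsGridPath (D := D) i N κ
  have hp : DownProfile (D.height i (lsGridPath N κ)) Q (gridPt hN hyN) (gridPt hN hq) := by
    refine ⟨gridPt_le hN hyq.le hq, fun t ht => ?_, fun s hs t ht hst => ?_, ?_, ?_, hQ.1⟩
    · rw [hheight]
      exact le_gridPath (Nat.zero_le y) hyN (fun k _ hk => hbefore k hk) (by simpa using t.2.1) ht
    · rw [hheight]
      exact gridPath_antitoneOn (a := y) (b := q) (fun k h1 h2 => (hneg k h1 h2).le) hs ht hst
    · rw [hheight]
      exact hyv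
    · rw [hheight]
      exact hqe
  have hpath : lsGridPath N (D.reflectSeq i y q κ) =
      D.downPath i (lsGridPath N κ) Q (gridPt hN hyN) (gridPt hN hq) := by
    ext t
    rw [lsGridPath_reflectSeq hN i hyq.le hq, downPath, hyv]
    module
  have hgrid : IsLSGrid N (D.reflectSeq i y q κ) := by
    refine ⟨hN, fun k hk => ?_⟩
    have hc := hg.chain k hk
    rw [reflectSeq, reflectSeq]
    by_cases h1 : y ≤ k ∧ k < q <;> by_cases h2 : y ≤ k + 1 ∧ k + 1 < q
    · rw [if_pos h1, if_pos h2]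
      refine IsChain.s_smul hlam hc (mul_pos_of_neg_of_neg (hneg k h1.1 h1.2)
        (hneg _ h2.1 h2.2)) fun hint => hnonint (k + 1) (by omega) h2.2 ?_
      rw [hg.node_mem_ints_iff i (by omega)]
      push_cast at hint ⊢
      exact hint
    · -- At `q` the pairing changes its sign, so that the chain can be started at `s_i κ k`.
      rw [if_pos h1, if_neg h2]
      obtain rfl : k + 1 = q := by omega
      refine (IsChain.s_smul_left hlam hc (hneg k h1.1 h1.2) ?_).1
      by_contra hcon
      have h3 := (node_succ_lt_iff (N := N) (m := fun k => D.slope i (κ k)) hk).2 (not_le.1 hcon)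
      rw [hqe] at h3
      exact (hQle _ hk).not_gt h3
    · -- At `y` the chain is continued by the step from `κ y` to `s_i κ y`.
      rw [if_neg h1, if_pos h2]
      obtain rfl : k + 1 = y := by omega
      refine hc.tail (chainStep_s_smul hlam (hneg _ le_rfl hyq) ?_)
      have h3 := hg.node_sub_mem_ints i hk
      rw [hyv] at h3
      have h4 : (Q : ℝ) + 1 ∈ ints := by exact_mod_cast intCast_mem_ints (Q + 1)
      have := sub_mem h4 h3
      rw [sub_sub_cancel] at this
      push_cast at this ⊢
      exact this
    · rw [if_neg h1, if_neg h2]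
      exact hc
  have hlast : D.height i (lsGridPath N κ) 1 = node N (fun k => D.slope i (κ k)) N := by
    rw [hheight, node_last hN]
    rfl
  refine ⟨_, _, _, _, hp, ⟨N, _, hgrid, hpath.symm, rfl, rfl⟩, ?_, ?_⟩
  · rw [reflectSeq]
    split_ifs with h1
    · obtain rfl : y = 0 := by omega
      rw [node_zero] at hyv
      refine Or.inr ⟨rfl, hneg 0 le_rfl hyq, ?_⟩
      have : (0 : ℤ) = Q + 1 := by exact_mod_cast hyv
      omega
    · exact Or.inl rfl
  · rw [reflectSeq]
    split_ifs with h1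
    · obtain rfl : q = N := by omega
      exact Or.inr ⟨rfl, hneg _ h1.1 h1.2, by rw [hlast, hqe]⟩
    · exact Or.inl rfl

/-- The operator `f_i` on an LS path: it reflects the directions in an interval on which the pairing
with `α_i^∨` increases from its minimum `Q` to `Q + 1`. -/
theorem IsLS.exists_f (hlam : D.IsDominantIntegral lam) {θ : unitInterval → E}
    {ini fin : D.Cosets lam} (h : IsLS θ ini fin) {i : ι} {Q : ℤ} (hQ : HasMin (D.height i θ) Q)
    (hQ1 : (Q : ℝ) + 1 ≤ D.height i θ 1) :
    ∃ (p x : unitInterval) (ini' fin' : D.Cosets lam),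
      UpProfile (D.height i θ) Q p x ∧ IsLS (D.upPath i θ Q p x) ini' fin' ∧
      (ini' = ini ∨ ini' = D.s i • ini ∧ 0 < D.slope i ini ∧ Q = 0) ∧
      (fin' = fin ∨ fin' = D.s i • fin ∧ 0 < D.slope i fin ∧ D.height i θ 1 = Q + 1) := by
  obtain ⟨N, κ, hg, rfl, rfl, rfl, hA⟩ := h.exists_adapted hlam i
  have hN := hg.pos
  have hI := hg.integralGrid hlam i
  obtain ⟨Q', hQle, -, ⟨p, hpN, hpe, hlast⟩⟩ := hI.exists_min
  obtain rfl : Q = Q' := by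
    refine hQ.unique ?_
    rw [height_lsGridPath]
    exact hasMin_of_node hN hQle hpN hpe
  have hheight := height_lsGridPath (D := D) i N κ
  have hend : D.height i (lsGridPath N κ) 1 = node N (fun k => D.slope i (κ k)) N := by
    rw [hheight, node_last hN]
    rfl
  obtain ⟨x, hpx, hx, hxv, hafter, hpos, hnonint⟩ := hI.exists_up hA hpN hpe hlast (hend ▸ hQ1)
  have hp : UpProfile (D.height i (lsGridPath N κ)) Q (gridPt hN hpN) (gridPt hN hx) := by
    refine ⟨gridPt_le hN hpx.le hx, fun t ht => ?_, fun s hs t ht hst => ?_, ?_, ?_, hQ.1⟩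
    · rw [hheight]
      have hN' : (N : ℝ) ≠ 0 := by positivity
      refine le_gridPath hx le_rfl hafter ht ?_
      rw [div_self hN']
      exact t.2.2
    · rw [hheight]
      exact gridPath_monotoneOn (a := p) (b := x) (fun k h1 h2 => (hpos k h1 h2).le) hs ht hst
    · rw [hheight]
      exact hpe
    · rw [hheight]
      exact hxv
  have hpath : lsGridPath N (D.reflectSeq i p x κ) =
      D.upPath i (lsGridPath N κ) Q (gridPt hN hpN) (gridPt hN hx) := by
    ext t
    rw [lsGridPath_reflectSeq hN i hpx.le hx, upPath, hpe]
  have hgrid : IsLSGrid N (D.reflectSeq i p x κ) := by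
    refine ⟨hN, fun k hk => ?_⟩
    have hc := hg.chain k hk
    rw [reflectSeq, reflectSeq]
    by_cases h1 : p ≤ k ∧ k < x <;> by_cases h2 : p ≤ k + 1 ∧ k + 1 < x
    · rw [if_pos h1, if_pos h2]
      refine IsChain.s_smul hlam hc (mul_pos (hpos k h1.1 h1.2) (hpos _ h2.1 h2.2))
        fun hint => hnonint (k + 1) (by omega) h2.2 ?_
      rw [hg.node_mem_ints_iff i (by omega)]
      push_cast at hint ⊢
      exact hint
    · -- At `x` the chain is preceded by the step from `s_i κ k` to `κ k`.
      rw [if_pos h1, if_neg h2]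
      obtain rfl : k + 1 = x := by omega
      have h3 := hpos k h1.1 h1.2
      have h4 : ChainStep (((k + 1 : ℕ) : ℚ) / N) (D.s i • κ k) (D.s i • D.s i • κ k) := by
        refine chainStep_s_smul hlam (by simpa using h3) ?_
        rw [slope_s_smul, mul_neg]
        refine neg_mem ?_
        have h5 := (hg.node_mem_ints_iff i (show k < N by omega)).1 (by
          rw [hxv]
          exact_mod_cast intCast_mem_ints (Q + 1))
        push_cast at h5 ⊢
        exact h5
      rw [s_smul_s_smul] at h4
      exact hc.head h4
    · rw [if_neg h1, if_pos h2]
      obtain rfl : k + 1 = p := by omega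
      refine (IsChain.s_smul_right hlam hc ?_ (hpos _ h2.1 h2.2)).1
      by_contra hcon
      have h3 := (node_lt_succ_iff (N := N) (m := fun k => D.slope i (κ k))
        (show k < N by omega)).2 (not_le.1 hcon)
      rw [hpe] at h3
      exact (hQle k (by omega)).not_gt h3
    · rw [if_neg h1, if_neg h2]
      exact hc
  refine ⟨_, _, _, _, hp, ⟨N, _, hgrid, hpath.symm, rfl, rfl⟩, ?_, ?_⟩
  · rw [reflectSeq]
    split_ifs with h1
    · obtain rfl : p = 0 := by omega
      rw [node_zero] at hpe
      exact Or.inr ⟨rfl, hpos 0 le_rfl hpx, by exact_mod_cast hpe.symm⟩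
    · exact Or.inl rfl
  · rw [reflectSeq]
    split_ifs with h1
    · obtain rfl : x = N := by omega
      exact Or.inr ⟨rfl, hpos _ h1.1 h1.2, by rw [hend, hxv]⟩
    · exact Or.inl rfl

end RootOperators

/-! ### Concatenation of paths -/

section Halves

/-- The map from the unit interval onto its first half. -/
def firstHalf (t : unitInterval) : unitInterval :=
  ⟨(t : ℝ) / 2, by linarith [t.2.1], by linarith [t.2.2]⟩

/-- The map from the unit interval onto its second half. -/
def secondHalf (t : unitInterval) : unitInterval :=
  ⟨((t : ℝ) + 1) / 2, by linarith [t.2.1], by linarith [t.2.2]⟩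

theorem continuous_firstHalf : Continuous firstHalf := by
  unfold firstHalf
  fun_prop

theorem continuous_secondHalf : Continuous secondHalf := by
  unfold secondHalf
  fun_prop

theorem firstHalf_le {s t : unitInterval} : firstHalf s ≤ firstHalf t ↔ s ≤ t := by
  change (s : ℝ) / 2 ≤ (t : ℝ) / 2 ↔ (s : ℝ) ≤ t
  constructor <;> intro h <;> linarith

theorem secondHalf_le {s t : unitInterval} : secondHalf s ≤ secondHalf t ↔ s ≤ t := by
  change ((s : ℝ) + 1) / 2 ≤ ((t : ℝ) + 1) / 2 ↔ (s : ℝ) ≤ t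
  constructor <;> intro h <;> linarith

theorem firstHalf_le_secondHalf (s t : unitInterval) : firstHalf s ≤ secondHalf t := by
  change (s : ℝ) / 2 ≤ ((t : ℝ) + 1) / 2
  linarith [s.2.2, t.2.1]

theorem firstHalf_mono : Monotone firstHalf := fun _ _ h => firstHalf_le.2 h

theorem secondHalf_mono : Monotone secondHalf := fun _ _ h => secondHalf_le.2 h

theorem eq_half (t : unitInterval) : (∃ s, t = firstHalf s) ∨ ∃ s, t = secondHalf s := by
  rcases le_total (t : ℝ) (1 / 2) with h | h
  · exact Or.inl ⟨⟨2 * t, by linarith [t.2.1], by linarith⟩, Subtype.ext (by simp [firstHalf])⟩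
  · exact Or.inr ⟨⟨2 * t - 1, by linarith, by linarith [t.2.2]⟩,
      Subtype.ext (by simp [secondHalf])⟩

theorem eq_firstHalf_of_le {s t : unitInterval} (h : t ≤ firstHalf s) :
    ∃ u ≤ s, t = firstHalf u := by
  have h' : (t : ℝ) ≤ (s : ℝ) / 2 := h
  refine ⟨⟨2 * t, by linarith [t.2.1], by linarith [s.2.2]⟩, ?_,
    Subtype.ext (by simp [firstHalf])⟩
  change 2 * (t : ℝ) ≤ s
  linarith

theorem eq_secondHalf_of_ge {s t : unitInterval} (h : secondHalf s ≤ t) :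
    ∃ u, s ≤ u ∧ t = secondHalf u := by
  have h' : ((s : ℝ) + 1) / 2 ≤ t := h
  refine ⟨⟨2 * t - 1, by linarith [s.2.1], by linarith [t.2.2]⟩, ?_,
    Subtype.ext (by simp [secondHalf])⟩
  change (s : ℝ) ≤ 2 * (t : ℝ) - 1
  linarith

theorem path_ext {X : Type*} {θ η : unitInterval → X} (h1 : ∀ t, θ (firstHalf t) = η (firstHalf t))
    (h2 : ∀ t, θ (secondHalf t) = η (secondHalf t)) : θ = η := by
  ext t
  rcases eq_half t with ⟨s, rfl⟩ | ⟨s, rfl⟩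
  · exact h1 s
  · exact h2 s

variable {E : Type*} [AddCommGroup E]

@[simp]
theorem concat_firstHalf (π π' : unitInterval → E) (t : unitInterval) :
    concat π π' (firstHalf t) = π t := by
  have h : ((firstHalf t : unitInterval) : ℝ) = t / 2 := rfl
  rw [concat, if_pos (by rw [h]; linarith [t.2.2]), h, mul_div_cancel₀ _ two_ne_zero]
  simp

theorem concat_secondHalf (π : unitInterval → E) {π' : unitInterval → E} (h0 : π' 0 = 0)
    (t : unitInterval) : concat π π' (secondHalf t) = π 1 + π' t := by
  have h : ((secondHalf t : unitInterval) : ℝ) = (t + 1) / 2 := rfl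
  rcases t.2.1.eq_or_lt with h1 | h1
  · have ht : t = 0 := Subtype.ext h1.symm
    have h2 : secondHalf t = firstHalf 1 := by
      rw [ht]
      exact Subtype.ext (by simp [secondHalf, firstHalf])
    rw [h2, concat_firstHalf, ht, h0, add_zero]
  · rw [concat, if_neg (by rw [h]; linarith), h, mul_div_cancel₀ _ two_ne_zero,
      add_sub_cancel_right]
    simp

theorem concat_injective {π σ π' σ' : unitInterval → E} (h0 : π' 0 = 0) (h0' : σ' 0 = 0)
    (h : concat π π' = concat σ σ') : π = σ ∧ π' = σ' := by
  have h1 : π = σ := by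
    ext t
    simpa using congrFun h (firstHalf t)
  refine ⟨h1, ?_⟩
  ext t
  have := congrFun h (secondHalf t)
  rw [concat_secondHalf _ h0, concat_secondHalf _ h0', h1] at this
  exact add_left_cancel this

end Halves

/-! ### Root operators and concatenation -/

section Concat

variable {ι E : Type*} [AddCommGroup E] [Module ℝ E] {D : KacMoodyDatum ι E}

theorem height_firstHalf (i : ι) (π π' : unitInterval → E) (t : unitInterval) :
    D.height i (concat π π') (firstHalf t) = D.height i π t := by
  rw [height, concat_firstHalf, height]

theorem height_secondHalf (i : ι) (π : unitInterval → E) {π' : unitInterval → E} (h0 : π' 0 = 0)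
    (t : unitInterval) :
    D.height i (concat π π') (secondHalf t) = D.height i π 1 + D.height i π' t := by
  rw [height, concat_secondHalf _ h0, map_add, height, height]

theorem le_height_concat {i : ι} {π π' : unitInterval → E} (h0 : π' 0 = 0) {Q Q' : ℤ}
    (hQ : ∀ t, (Q : ℝ) ≤ D.height i π t) (hQ' : ∀ t, (Q' : ℝ) ≤ D.height i π' t) {c : ℝ}
    (h1 : c ≤ Q) (h2 : c ≤ D.height i π 1 + Q') (t : unitInterval) :
    c ≤ D.height i (concat π π') t := by
  rcases eq_half t with ⟨s, rfl⟩ | ⟨s, rfl⟩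
  · rw [height_firstHalf]
    exact h1.trans (hQ s)
  · rw [height_secondHalf _ _ h0]
    linarith [hQ' s]

/-- The operator `e_i` acts on the first factor if the minimum over the second factor is not
smaller. -/
theorem DownProfile.concat_left {i : ι} {π π' : unitInterval → E} (h0 : π' 0 = 0) {Q Q' : ℤ}
    {y q : unitInterval} (hp : DownProfile (D.height i π) Q y q)
    (hQ' : ∀ t, (Q' : ℝ) ≤ D.height i π' t) (hle : (Q : ℝ) ≤ D.height i π 1 + Q') :
    DownProfile (D.height i (concat π π')) Q (firstHalf y) (firstHalf q) ∧
      D.downPath i (concat π π') Q (firstHalf y) (firstHalf q) =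
        concat (D.downPath i π Q y q) π' := by
  constructor
  · refine ⟨firstHalf_le.2 hp.le, fun t ht => ?_, fun s hs t ht hst => ?_, ?_, ?_,
      le_height_concat h0 hp.ge hQ' le_rfl hle⟩
    · obtain ⟨u, hu, rfl⟩ := eq_firstHalf_of_le ht
      rw [height_firstHalf]
      exact hp.before u hu
    · obtain ⟨u, hu, rfl⟩ := eq_firstHalf_of_le hs.2
      obtain ⟨v, hv, rfl⟩ := eq_firstHalf_of_le ht.2
      rw [height_firstHalf, height_firstHalf]
      exact hp.anti ⟨firstHalf_le.1 hs.1, hu⟩ ⟨firstHalf_le.1 ht.1, hv⟩ (firstHalf_le.1 hst)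
    · rw [height_firstHalf, hp.left]
    · rw [height_firstHalf, hp.right]
  · refine path_ext (fun t => ?_) fun t => ?_
    · rw [concat_firstHalf, downPath, ← firstHalf_mono.map_min, ← firstHalf_mono.map_max,
        height_firstHalf, concat_firstHalf, downPath]
    · rw [concat_secondHalf _ h0, downPath, min_eq_right (firstHalf_le_secondHalf _ _),
        max_eq_right (firstHalf_le.2 hp.le), height_firstHalf, concat_secondHalf _ h0, downPath,
        min_eq_right unitInterval.le_one', max_eq_right hp.le]
      abel

/-- The operator `e_i` acts on the second factor if the minimum over this factor is smaller. -/
theorem DownProfile.concat_right {i : ι} {π π' : unitInterval → E} (h0 : π' 0 = 0) {Q Q' n : ℤ}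
    {y q : unitInterval} (hp : DownProfile (D.height i π') Q' y q)
    (hQ : ∀ t, (Q : ℝ) ≤ D.height i π t) (hn : D.height i π 1 = n) (hlt : n + Q' < Q) :
    DownProfile (D.height i (concat π π')) (n + Q') (secondHalf y) (secondHalf q) ∧
      D.downPath i (concat π π') (n + Q') (secondHalf y) (secondHalf q) =
        concat π (D.downPath i π' Q' y q) := by
  have hlt' : (n : ℝ) + Q' + 1 ≤ Q := by exact_mod_cast hlt
  have hval : ∀ t, D.height i (concat π π') (secondHalf t) = n + D.height i π' t := fun t => by
    rw [height_secondHalf _ _ h0, hn]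
  have h0' : D.downPath i π' Q' y q 0 = 0 := by
    have hy : (0 : unitInterval) ≤ y := unitInterval.nonneg'
    rw [downPath, h0, min_eq_left (hy.trans hp.le), max_eq_left hy, hp.left]
    simp
  constructor
  · refine ⟨secondHalf_le.2 hp.le, fun t ht => ?_, fun s hs t ht hst => ?_, ?_, ?_,
      le_height_concat h0 hQ hp.ge (by push_cast; linarith) (by push_cast; linarith)⟩
    · push_cast
      rcases eq_half t with ⟨s, rfl⟩ | ⟨s, rfl⟩
      · rw [height_firstHalf]
        linarith [hQ s]
      · rw [hval]
        linarith [hp.before s (secondHalf_le.1 ht)]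
    · obtain ⟨u, hu, rfl⟩ := eq_secondHalf_of_ge hs.1
      obtain ⟨v, hv, rfl⟩ := eq_secondHalf_of_ge ht.1
      rw [hval, hval]
      have := hp.anti ⟨hu, secondHalf_le.1 hs.2⟩ ⟨hv, secondHalf_le.1 ht.2⟩ (secondHalf_le.1 hst)
      linarith
    · rw [hval, hp.left]
      push_cast
      ring
    · rw [hval, hp.right]
      push_cast
      ring
  · refine path_ext (fun t => ?_) fun t => ?_
    · rw [concat_firstHalf, downPath, min_eq_left (firstHalf_le_secondHalf _ _),
        max_eq_left (firstHalf_le_secondHalf _ _), hval, hp.left, concat_firstHalf]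
      push_cast
      module
    · rw [concat_secondHalf _ h0', downPath, ← secondHalf_mono.map_min, ← secondHalf_mono.map_max,
        hval, concat_secondHalf _ h0, downPath]
      push_cast
      module

/-- The operator `f_i` acts on the first factor if the minimum over the second factor is larger. -/
theorem UpProfile.concat_left {i : ι} {π π' : unitInterval → E} (h0 : π' 0 = 0) {Q Q' : ℤ}
    {p x : unitInterval} (hp : UpProfile (D.height i π) Q p x)
    (hQ' : ∀ t, (Q' : ℝ) ≤ D.height i π' t) (hlt : (Q : ℝ) + 1 ≤ D.height i π 1 + Q') :
    UpProfile (D.height i (concat π π')) Q (firstHalf p) (firstHalf x) ∧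
      D.upPath i (concat π π') Q (firstHalf p) (firstHalf x) =
        concat (D.upPath i π Q p x) π' := by
  constructor
  · refine ⟨firstHalf_le.2 hp.le, fun t ht => ?_, fun s hs t ht hst => ?_, ?_, ?_,
      le_height_concat h0 hp.ge hQ' le_rfl (by linarith)⟩
    · rcases eq_half t with ⟨s, rfl⟩ | ⟨s, rfl⟩
      · rw [height_firstHalf]
        exact hp.after s (firstHalf_le.1 ht)
      · rw [height_secondHalf _ _ h0]
        linarith [hQ' s]
    · obtain ⟨u, hu, rfl⟩ := eq_firstHalf_of_le hs.2
      obtain ⟨v, hv, rfl⟩ := eq_firstHalf_of_le ht.2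
      rw [height_firstHalf, height_firstHalf]
      exact hp.mono ⟨firstHalf_le.1 hs.1, hu⟩ ⟨firstHalf_le.1 ht.1, hv⟩ (firstHalf_le.1 hst)
    · rw [height_firstHalf, hp.left]
    · rw [height_firstHalf, hp.right]
  · refine path_ext (fun t => ?_) fun t => ?_
    · rw [concat_firstHalf, upPath, ← firstHalf_mono.map_min, ← firstHalf_mono.map_max,
        height_firstHalf, concat_firstHalf, upPath]
    · rw [concat_secondHalf _ h0, upPath, min_eq_right (firstHalf_le_secondHalf _ _),
        max_eq_right (firstHalf_le.2 hp.le), height_firstHalf, concat_secondHalf _ h0, upPath,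
        min_eq_right unitInterval.le_one', max_eq_right hp.le]
      abel

/-- The operator `f_i` acts on the second factor if the minimum over this factor is not larger. -/
theorem UpProfile.concat_right {i : ι} {π π' : unitInterval → E} (h0 : π' 0 = 0) {Q Q' n : ℤ}
    {p x : unitInterval} (hp : UpProfile (D.height i π') Q' p x)
    (hQ : ∀ t, (Q : ℝ) ≤ D.height i π t) (hn : D.height i π 1 = n) (hle : n + Q' ≤ Q) :
    UpProfile (D.height i (concat π π')) (n + Q') (secondHalf p) (secondHalf x) ∧
      D.upPath i (concat π π') (n + Q') (secondHalf p) (secondHalf x) =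
        concat π (D.upPath i π' Q' p x) := by
  have hle' : (n : ℝ) + Q' ≤ Q := by exact_mod_cast hle
  have hval : ∀ t, D.height i (concat π π') (secondHalf t) = n + D.height i π' t := fun t => by
    rw [height_secondHalf _ _ h0, hn]
  have h0' : D.upPath i π' Q' p x 0 = 0 := by
    have hy : (0 : unitInterval) ≤ p := unitInterval.nonneg'
    rw [upPath, h0, min_eq_left (hy.trans hp.le), max_eq_left hy, hp.left]
    simp
  constructor
  · refine ⟨secondHalf_le.2 hp.le, fun t ht => ?_, fun s hs t ht hst => ?_, ?_, ?_,
      le_height_concat h0 hQ hp.ge (by push_cast; linarith) (by push_cast; linarith)⟩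
    · obtain ⟨u, hu, rfl⟩ := eq_secondHalf_of_ge ht
      rw [hval]
      push_cast
      linarith [hp.after u hu]
    · obtain ⟨u, hu, rfl⟩ := eq_secondHalf_of_ge hs.1
      obtain ⟨v, hv, rfl⟩ := eq_secondHalf_of_ge ht.1
      rw [hval, hval]
      have := hp.mono ⟨hu, secondHalf_le.1 hs.2⟩ ⟨hv, secondHalf_le.1 ht.2⟩ (secondHalf_le.1 hst)
      linarith
    · rw [hval, hp.left]
      push_cast
      ring
    · rw [hval, hp.right]
      push_cast
      ring
  · refine path_ext (fun t => ?_) fun t => ?_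
    · rw [concat_firstHalf, upPath, min_eq_left (firstHalf_le_secondHalf _ _),
        max_eq_left (firstHalf_le_secondHalf _ _), hval, hp.left, concat_firstHalf]
      push_cast
      module
    · rw [concat_secondHalf _ h0', upPath, ← secondHalf_mono.map_min, ← secondHalf_mono.map_max,
        hval, concat_secondHalf _ h0, upPath]
      push_cast
      module

end Concat

/-! ### Concatenations of LS paths -/

section LSConcat

variable {ι E : Type*} [AddCommGroup E] [Module ℝ E] {D : KacMoodyDatum ι E} {lam mu : E}

/-- The initial and the final direction can be read off from the path near its ends. -/
theorem IsLS.exists_directions {θ : unitInterval → E} {ini fin : D.Cosets lam}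
    (h : IsLS θ ini fin) : ∃ ε : ℝ, 0 < ε ∧
      (∀ t : unitInterval, (t : ℝ) ≤ ε → θ t = (t : ℝ) • cosetWeight ini) ∧
      ∀ t : unitInterval, 1 - ε ≤ t → θ 1 - θ t = (1 - t : ℝ) • cosetWeight fin := by
  obtain ⟨N, κ, hg, rfl, rfl, rfl⟩ := h
  have hN := hg.pos
  have hN' : (0 : ℝ) < N := by exact_mod_cast hN
  refine ⟨1 / N, by positivity, fun t ht => ?_, fun t ht => ?_⟩
  · rw [lsGridPath, gridPath_of_mem hN _ (by simpa using t.2.1) (by simpa using ht)]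
    simp [gridPath_zero]
  · obtain ⟨n, rfl⟩ : ∃ n, N = n + 1 := ⟨N - 1, by omega⟩
    have e : (n : ℝ) / (n + 1 : ℕ) = 1 - 1 / (n + 1 : ℕ) := by
      rw [eq_sub_iff_add_eq, ← add_div]
      push_cast
      rw [div_self (by positivity)]
    have e' : ((n + 1 : ℕ) : ℝ) / (n + 1 : ℕ) = 1 := div_self hN'.ne'
    have h1 := gridPath_of_mem (N := n + 1) (k := n) (by omega) (fun k => cosetWeight (κ k))
      (t := t) (by rw [e]; exact ht) (by rw [e']; exact t.2.2)
    have h2 := gridPath_of_mem (N := n + 1) (k := n) (by omega) (fun k => cosetWeight (κ k))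
      (t := 1) (by rw [e]; linarith [ht, t.2.2]) (by rw [e'])
    rw [lsGridPath, lsGridPath, h1, Nat.add_sub_cancel]
    have h3 : (((1 : unitInterval)) : ℝ) = 1 := rfl
    rw [h3, h2]
    module

theorem IsLS.unique {θ : unitInterval → E} {ini fin ini' fin' : D.Cosets lam}
    (h : IsLS θ ini fin) (h' : IsLS θ ini' fin') : ini = ini' ∧ fin = fin' := by
  obtain ⟨ε, hε, h1, h2⟩ := h.exists_directions
  obtain ⟨ε', hε', h1', h2'⟩ := h'.exists_directions
  obtain ⟨δ, hδ, hδ1, hδε, hδε'⟩ : ∃ δ : ℝ, 0 < δ ∧ δ ≤ 1 ∧ δ ≤ ε ∧ δ ≤ ε' :=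
    ⟨min 1 (min ε ε'), lt_min one_pos (lt_min hε hε'), min_le_left _ _,
      (min_le_right _ _).trans (min_le_left _ _), (min_le_right _ _).trans (min_le_right _ _)⟩
  constructor
  · have e1 := h1 ⟨δ, hδ.le, hδ1⟩ hδε
    have e2 := h1' ⟨δ, hδ.le, hδ1⟩ hδε'
    rw [e1] at e2
    exact cosetWeight_injective (smul_right_injective E hδ.ne' e2)
  · have e1 := h2 ⟨1 - δ, by linarith, by linarith⟩ (by change 1 - ε ≤ 1 - δ; linarith)
    have e2 := h2' ⟨1 - δ, by linarith, by linarith⟩ (by change 1 - ε' ≤ 1 - δ; linarith)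
    rw [e1] at e2
    simp only [sub_sub_cancel] at e2
    exact cosetWeight_injective (smul_right_injective E hδ.ne' e2)

/-- The element `w(π * π')` is the minimum of the set for every choice of lifts. -/
theorem isBruhatMin_weylElement (hlam : D.IsDominantIntegral lam) (hmu : D.IsDominantIntegral mu)
    {π π' : unitInterval → E} {a b : D.Cosets lam} {a' b' : D.Cosets mu} (h : IsLS π a b)
    (h' : IsLS π' a' b') {τ φ : D.weylGroup} (hτ : τ ∈ lifts b) (hφ : φ ∈ lifts a') :
    D.IsBruhatMin (D.intervalSet lam mu τ φ) (D.weylElement lam mu (concat π π')) := by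
  classical
  have hex : ∃ w, ∃ (ρ : D.LSPath lam) (ρ' : D.LSPath mu), concat π π' = concat ρ.toPath ρ'.toPath ∧
      ∃ τ ∈ lifts ρ.finalDirection, ∃ φ ∈ lifts ρ'.initialDirection,
        D.IsBruhatMin (D.intervalSet lam mu τ φ) w := by
    obtain ⟨w, hw⟩ := exists_isBruhatMin_intervalSet hlam hmu τ φ
    obtain ⟨ρ, h1, -, h3⟩ := h.exists_lsPath hlam
    obtain ⟨ρ', h1', h2', -⟩ := h'.exists_lsPath hmu
    exact ⟨w, ρ, ρ', by rw [h1, h1'], τ, by rwa [h3], φ, by rwa [h2'], hw⟩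
  obtain ⟨ρ, ρ', he, τ', hτ', φ', hφ', hw⟩ := Classical.epsilon_spec hex
  obtain ⟨rfl, rfl⟩ := concat_injective h'.apply_zero ρ'.isLS.apply_zero he
  rw [(h.unique ρ.isLS).2] at hτ
  rw [(h'.unique ρ'.isLS).1] at hφ
  rw [intervalSet_eq_of_lifts hlam hτ hτ' hφ hφ']
  exact hw

theorem weylElement_eq_of_directions (hlam : D.IsDominantIntegral lam)
    (hmu : D.IsDominantIntegral mu) {π π' σ σ' : unitInterval → E} {a b c : D.Cosets lam}
    {a' b' d' : D.Cosets mu} (h : IsLS π a b) (h' : IsLS π' a' b')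
    (hσ : IsLS σ c b) (hσ' : IsLS σ' a' d') :
    D.weylElement lam mu (concat π π') = D.weylElement lam mu (concat σ σ') := by
  obtain ⟨τ, hτ⟩ := lifts_nonempty b
  obtain ⟨φ, hφ⟩ := lifts_nonempty a'
  exact (isBruhatMin_weylElement hlam hmu h h' hτ hφ).unique
    (isBruhatMin_weylElement hlam hmu hσ hσ' hτ hφ)

theorem weylElement_eq_of_reflect_left (hlam : D.IsDominantIntegral lam)
    (hmu : D.IsDominantIntegral mu) {π π' σ : unitInterval → E} {a b c : D.Cosets lam}
    {a' b' : D.Cosets mu} {i : ι} (h : IsLS π a b) (h' : IsLS π' a' b')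
    (hσ : IsLS σ c (D.s i • b)) (hb : D.slope i b < 0) (ha' : 0 ≤ D.slope i a') :
    D.weylElement lam mu (concat σ π') = D.weylElement lam mu (concat π π') := by
  obtain ⟨τ, hτ⟩ := lifts_nonempty b
  obtain ⟨φ, hφ⟩ := lifts_nonempty a'
  have h1 := isBruhatMin_weylElement hlam hmu h h' hτ hφ
  have h2 := isBruhatMin_weylElement hlam hmu hσ h' (mul_mem_lifts _ hτ) hφ
  refine IsBruhatMin.unique (isBruhatMin_intervalSet_of_s_mul hlam hmu
    (length_s_mul_lt_of_slope_neg hlam hb hτ) ?_ h2) h1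
  rwa [smul_eq_cosetWeight hφ]

theorem weylElement_eq_of_reflect_right (hlam : D.IsDominantIntegral lam)
    (hmu : D.IsDominantIntegral mu) {π π' σ' : unitInterval → E} {a b : D.Cosets lam}
    {a' b' d' : D.Cosets mu} {i : ι} (h : IsLS π a b) (h' : IsLS π' a' b')
    (hσ' : IsLS σ' (D.s i • a') d') (hb : D.slope i b ≤ 0) :
    D.weylElement lam mu (concat π σ') = D.weylElement lam mu (concat π π') := by
  obtain ⟨τ, hτ⟩ := lifts_nonempty b
  obtain ⟨φ, hφ⟩ := lifts_nonempty a'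
  have h1 := isBruhatMin_weylElement hlam hmu h h' hτ hφ
  have h2 := isBruhatMin_weylElement hlam hmu h hσ' hτ (mul_mem_lifts (D.s i) hφ)
  rw [intervalSet_s_mul_right hlam (by rwa [smul_eq_cosetWeight hτ])] at h2
  exact h2.unique h1

/-- The operator `e_i` acts on one of the two factors of a concatenation, keeps the Weyl group
element, and is inverted by `f_i`. -/
theorem IsLS.e_concat (hlam : D.IsDominantIntegral lam) (hmu : D.IsDominantIntegral mu)
    {π π' η : unitInterval → E} {a b : D.Cosets lam} {a' b' : D.Cosets mu} {i : ι} (h : IsLS π a b)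
    (h' : IsLS π' a' b') (he : D.e i (concat π π') = some η) :
    ((∃ (σ : unitInterval → E) (c d : D.Cosets lam), IsLS σ c d ∧ D.e i π = some σ ∧
        η = concat σ π') ∨
      ∃ (σ' : unitInterval → E) (c' d' : D.Cosets mu), IsLS σ' c' d' ∧ D.e i π' = some σ' ∧
        η = concat π σ') ∧
    D.weylElement lam mu η = D.weylElement lam mu (concat π π') ∧
    D.f i η = some (concat π π') := by
  obtain ⟨Q, hQ⟩ := h.exists_hasMin hlam i
  obtain ⟨Q', hQ'⟩ := h'.exists_hasMin hmu i
  obtain ⟨n, hn⟩ := mem_ints.1 (h.height_one_mem_ints hlam i)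
  have h0 := h'.apply_zero
  have hQ0 : Q ≤ 0 := by
    have := hQ.1 0
    rw [height, h.apply_zero, map_zero] at this
    exact_mod_cast this
  have hQ0' : Q' ≤ 0 := by
    have := hQ'.1 0
    rw [height, h0, map_zero] at this
    exact_mod_cast this
  have hQn : Q ≤ n := by
    have := hQ.1 1
    rw [hn] at this
    exact_mod_cast this
  rcases le_or_gt Q (n + Q') with hle | hlt
  · have hle' : (Q : ℝ) ≤ D.height i π 1 + Q' := by
      rw [hn]
      exact_mod_cast hle
    have hQne : Q ≠ 0 := by
      rintro rfl
      have hmin : HasMin (D.height i (concat π π')) 0 := by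
        obtain ⟨t, ht⟩ := hQ.2
        exact ⟨le_height_concat h0 hQ.1 hQ'.1 le_rfl hle', firstHalf t, by
          rw [height_firstHalf, ht]⟩
      rw [e, minHeight_eq hmin, if_pos rfl] at he
      exact absurd he (by simp)
    obtain ⟨y, q, c, d, hp, hσ, -, hfin⟩ := h.exists_e hlam hQ hQne
    obtain ⟨hp', hpath⟩ := hp.concat_left h0 hQ'.1 hle'
    rw [e_eq_downPath hp' hQne, Option.some_inj] at he
    rw [hpath] at he
    subst he
    refine ⟨Or.inl ⟨_, c, d, hσ, e_eq_downPath hp hQne, rfl⟩, ?_, by rw [← hpath, f_downPath hp']⟩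
    rcases hfin with rfl | ⟨rfl, hb, h1⟩
    · exact weylElement_eq_of_directions hlam hmu hσ h' h h'
    · refine weylElement_eq_of_reflect_left hlam hmu h h' hσ hb (h'.slope_ini_nonneg ?_)
      rw [hn] at h1
      have : n = Q := by exact_mod_cast h1
      obtain rfl : Q' = 0 := by omega
      exact hQ'
  · have hQne : Q' ≠ 0 := by omega
    obtain ⟨y, q, c, d, hp, hσ, hini, -⟩ := h'.exists_e hmu hQ' hQne
    obtain ⟨hp', hpath⟩ := hp.concat_right h0 hQ.1 hn hlt
    rw [e_eq_downPath hp' (by omega), Option.some_inj] at he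
    rw [hpath] at he
    subst he
    refine ⟨Or.inr ⟨_, c, d, hσ, e_eq_downPath hp hQne, rfl⟩, ?_, by rw [← hpath, f_downPath hp']⟩
    rcases hini with rfl | ⟨rfl, -, h1⟩
    · exact weylElement_eq_of_directions hlam hmu h hσ h h'
    · refine weylElement_eq_of_reflect_right hlam hmu h h' hσ (h.slope_fin_nonpos hQ ?_)
      rw [hn]
      have : n = Q := by omega
      rw [this]

/-- The operator `f_i` acts on one of the two factors of a concatenation, keeps the Weyl group
element, and is inverted by `e_i`. -/
theorem IsLS.f_concat (hlam : D.IsDominantIntegral lam) (hmu : D.IsDominantIntegral mu)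
    {π π' η : unitInterval → E} {a b : D.Cosets lam} {a' b' : D.Cosets mu} {i : ι} (h : IsLS π a b)
    (h' : IsLS π' a' b') (hf : D.f i (concat π π') = some η) :
    ((∃ (σ : unitInterval → E) (c d : D.Cosets lam), IsLS σ c d ∧ η = concat σ π') ∨
      ∃ (σ' : unitInterval → E) (c' d' : D.Cosets mu), IsLS σ' c' d' ∧ η = concat π σ') ∧
    D.weylElement lam mu η = D.weylElement lam mu (concat π π') ∧
    D.e i η = some (concat π π') := by
  obtain ⟨Q, hQ⟩ := h.exists_hasMin hlam i
  obtain ⟨Q', hQ'⟩ := h'.exists_hasMin hmu i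
  obtain ⟨n, hn⟩ := mem_ints.1 (h.height_one_mem_ints hlam i)
  have h0 := h'.apply_zero
  have hQ0 : Q ≤ 0 := by
    have := hQ.1 0
    rw [height, h.apply_zero, map_zero] at this
    exact_mod_cast this
  have hQ0' : Q' ≤ 0 := by
    have := hQ'.1 0
    rw [height, h0, map_zero] at this
    exact_mod_cast this
  have hQn : Q ≤ n := by
    have := hQ.1 1
    rw [hn] at this
    exact_mod_cast this
  rcases le_or_gt (n + Q') Q with hle | hlt
  · have hle' : (n : ℝ) + Q' ≤ Q := by exact_mod_cast hle
    have h1 : (Q' : ℝ) + 1 ≤ D.height i π' 1 := by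
      have hmin : HasMin (D.height i (concat π π')) (n + Q') := by
        obtain ⟨t, ht⟩ := hQ'.2
        refine ⟨le_height_concat h0 hQ.1 hQ'.1 (by exact_mod_cast hle) (by rw [hn]; simp),
          secondHalf t, ?_⟩
        rw [height_secondHalf _ _ h0, ht, hn]
        push_cast
        rfl
      by_contra hcon
      have e1 : (1 : unitInterval) = secondHalf 1 := Subtype.ext (by simp [secondHalf])
      rw [f, minHeight_eq hmin, e1, height_secondHalf _ _ h0, hn, if_pos] at hf
      · exact absurd hf (by simp)
      · push_cast
        linarith
    obtain ⟨p, x, c, d, hp, hσ, hini, -⟩ := h'.exists_f hmu hQ' h1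
    obtain ⟨hp', hpath⟩ := hp.concat_right h0 hQ.1 hn hle
    rw [f_eq_upPath hp', Option.some_inj] at hf
    rw [hpath] at hf
    subst hf
    refine ⟨Or.inr ⟨_, c, d, hσ, rfl⟩, ?_, by rw [← hpath, e_upPath hp' (by omega)]⟩
    rcases hini with rfl | ⟨rfl, -, h2⟩
    · exact weylElement_eq_of_directions hlam hmu h hσ h h'
    · refine weylElement_eq_of_reflect_right hlam hmu h h' hσ (h.slope_fin_nonpos hQ ?_)
      rw [hn]
      have : n = Q := by omega
      rw [this]
  · have hlt' : (Q : ℝ) + 1 ≤ D.height i π 1 + Q' := by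
      rw [hn]
      exact_mod_cast hlt
    have h1 : (Q : ℝ) + 1 ≤ D.height i π 1 := by
      have : (Q' : ℝ) ≤ 0 := by exact_mod_cast hQ0'
      linarith
    obtain ⟨p, x, c, d, hp, hσ, -, hfin⟩ := h.exists_f hlam hQ h1
    obtain ⟨hp', hpath⟩ := hp.concat_left h0 hQ'.1 hlt'
    rw [f_eq_upPath hp', Option.some_inj] at hf
    rw [hpath] at hf
    subst hf
    refine ⟨Or.inl ⟨_, c, d, hσ, rfl⟩, ?_, by rw [← hpath, e_upPath hp' (by omega)]⟩
    rcases hfin with rfl | ⟨rfl, hb, h2⟩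
    · exact weylElement_eq_of_directions hlam hmu hσ h' h h'
    · have h3 : 0 ≤ D.slope i a' := by
        refine h'.slope_ini_nonneg ?_
        rw [hn] at h2
        have : n = Q + 1 := by exact_mod_cast h2
        obtain rfl : Q' = 0 := by omega
        exact hQ'
      exact (weylElement_eq_of_reflect_left (i := i) hlam hmu hσ h' (by simpa using h)
        (by simpa using hb) h3).symm

theorem isLS_of_mem_lsPaths {π : unitInterval → E} (h : π ∈ D.lsPaths lam) :
    ∃ a b : D.Cosets lam, IsLS π a b := by
  obtain ⟨ρ, rfl⟩ := h
  exact ⟨_, _, ρ.isLS⟩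

theorem IsLS.mem_lsPaths (hlam : D.IsDominantIntegral lam) {π : unitInterval → E}
    {a b : D.Cosets lam} (h : IsLS π a b) : π ∈ D.lsPaths lam := by
  obtain ⟨ρ, h1, -⟩ := h.exists_lsPath hlam
  exact ⟨ρ, h1⟩

theorem mem_ints_of_isLocalMin_concat (hlam : D.IsDominantIntegral lam)
    (hmu : D.IsDominantIntegral mu) {π π' : unitInterval → E} {a b : D.Cosets lam}
    {a' b' : D.Cosets mu} (h : IsLS π a b) (h' : IsLS π' a' b') {i : ι} {t : unitInterval}
    (ht : IsLocalMin (D.height i (concat π π')) t) : D.height i (concat π π') t ∈ ints := by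
  have h0 := h'.apply_zero
  rcases eq_half t with ⟨s, rfl⟩ | ⟨s, rfl⟩
  · rw [height_firstHalf]
    refine h.mem_ints_of_isLocalMin hlam ?_
    have := ht.comp_continuous (g := firstHalf) (b := s) continuous_firstHalf.continuousAt
    refine this.congr (Filter.Eventually.of_forall fun u => ?_)
    exact height_firstHalf i π π' u
  · rw [height_secondHalf _ _ h0]
    refine add_mem (h.height_one_mem_ints hlam i) (h'.mem_ints_of_isLocalMin hmu ?_)
    have := ht.comp_continuous (g := secondHalf) (b := s) continuous_secondHalf.continuousAt
    filter_upwards [this] with u hu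
    simp only [Function.comp_apply, height_secondHalf i π h0] at hu
    linarith

/-- The root operators preserve the set of concatenations of LS paths and the Weyl group element,
and a step with a root operator can be undone. -/
theorem related_spec (hlam : D.IsDominantIntegral lam) (hmu : D.IsDominantIntegral mu)
    {θ η : unitInterval → E} (hθ : θ ∈ D.concatPaths lam mu) {i : ι}
    (h : D.e i θ = some η ∨ D.f i θ = some η) :
    η ∈ D.concatPaths lam mu ∧ D.weylElement lam mu η = D.weylElement lam mu θ ∧
      (D.e i η = some θ ∨ D.f i η = some θ) := by
  obtain ⟨π, hπ, π', hπ', rfl⟩ := hθ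
  obtain ⟨a, b, hab⟩ := isLS_of_mem_lsPaths hπ
  obtain ⟨a', b', hab'⟩ := isLS_of_mem_lsPaths hπ'
  rcases h with h | h
  · obtain ⟨h1, h2, h3⟩ := hab.e_concat hlam hmu hab' h
    refine ⟨?_, h2, Or.inr h3⟩
    rcases h1 with ⟨σ, c, d, hσ, -, rfl⟩ | ⟨σ', c, d, hσ, -, rfl⟩
    · exact ⟨σ, hσ.mem_lsPaths hlam, π', hπ', rfl⟩
    · exact ⟨π, hπ, σ', hσ.mem_lsPaths hmu, rfl⟩
  · obtain ⟨h1, h2, h3⟩ := hab.f_concat hlam hmu hab' h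
    refine ⟨?_, h2, Or.inl h3⟩
    rcases h1 with ⟨σ, c, d, hσ, rfl⟩ | ⟨σ', c, d, hσ, rfl⟩
    · exact ⟨σ, hσ.mem_lsPaths hlam, π', hπ', rfl⟩
    · exact ⟨π, hπ, σ', hσ.mem_lsPaths hmu, rfl⟩

theorem sim_equivalence (hlam : D.IsDominantIntegral lam) (hmu : D.IsDominantIntegral mu) :
    Equivalence (D.Sim lam mu) where
  refl _ := .refl
  trans h h' := h.trans h'
  symm h := by
    induction h with
    | refl => exact .refl
    | @tail ζ η _ h ih =>
      obtain ⟨i, h⟩ := h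
      exact ih.head ⟨i, (related_spec hlam hmu η.2 h).2.2⟩

theorem Sim.weylElement_eq (hlam : D.IsDominantIntegral lam) (hmu : D.IsDominantIntegral mu)
    {θ η : D.concatPaths lam mu} (h : D.Sim lam mu θ η) :
    D.weylElement lam mu θ.1 = D.weylElement lam mu η.1 := by
  induction h with
  | refl => rfl
  | @tail ζ η _ h ih =>
    obtain ⟨i, h⟩ := h
    rw [ih, (related_spec hlam hmu η.2 h).2.1]

theorem weylElement_le_of_doubleCoset (hlam : D.IsDominantIntegral lam)
    (hmu : D.IsDominantIntegral mu) {θ : unitInterval → E} (hθ : θ ∈ D.concatPaths lam mu)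
    {w u v : D.weylGroup} (hu : u ∈ D.stab lam) (hv : v ∈ D.stab mu)
    (h : D.bruhatLE (D.weylElement lam mu θ) w) :
    D.bruhatLE (D.weylElement lam mu θ) (u * w * v) := by
  obtain ⟨π, hπ, π', hπ', rfl⟩ := hθ
  obtain ⟨a, b, hab⟩ := isLS_of_mem_lsPaths hπ
  obtain ⟨a', b', hab'⟩ := isLS_of_mem_lsPaths hπ'
  obtain ⟨τ, hτ⟩ := lifts_nonempty b
  obtain ⟨φ, hφ⟩ := lifts_nonempty a'
  exact (isBruhatMin_weylElement hlam hmu hab hab' hτ hφ).le_mul_mul hlam hmu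
    (fun x hx u hu v hv => mul_mul_mem_intervalSet hx hu hv) h hu hv

theorem kkSet_eq_of_doubleCoset_eq (hlam : D.IsDominantIntegral lam)
    (hmu : D.IsDominantIntegral mu) {w w' : D.weylGroup}
    (h : DoubleCoset.mk (D.stab lam) (D.stab mu) w = DoubleCoset.mk (D.stab lam) (D.stab mu) w') :
    D.kkSet lam mu w = D.kkSet lam mu w' := by
  obtain ⟨u, hu, v, hv, rfl⟩ := (DoubleCoset.eq _ _ _ _).1 h
  ext θ
  refine ⟨fun hθ => weylElement_le_of_doubleCoset hlam hmu θ.2 hu hv hθ, fun hθ => ?_⟩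
  have := weylElement_le_of_doubleCoset hlam hmu θ.2 (inv_mem hu) (inv_mem hv) hθ
  have e : u⁻¹ * (u * w * v) * v⁻¹ = w := by group
  rwa [e] at this

end LSConcat

end KacMoodyDatum

end

theorem propositionp {ι E : Type*} [Finite ι] [AddCommGroup E] [Module ℝ E]
    (D : KacMoodyDatum ι E) (lam mu : E)
    (hlam : D.IsDominantIntegral lam) (hmu : D.IsDominantIntegral mu) :
    -- the element `w(π * π')` is well defined: for all lifts, it is the unique minimal element
    (∀ (π : D.LSPath lam) (π' : D.LSPath mu),
      ∀ τ ∈ KacMoodyDatum.lifts π.finalDirection, ∀ φ ∈ KacMoodyDatum.lifts π'.initialDirection,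
        D.IsBruhatMin (D.intervalSet lam mu τ φ)
          (D.weylElement lam mu (KacMoodyDatum.concat π.toPath π'.toPath))) ∧
    -- local minimum values of the functions `h_i` are integers
    (∀ θ ∈ D.concatPaths lam mu, ∀ i t, IsLocalMin (D.height i θ) t →
      ∃ m : ℤ, D.height i θ t = (m : ℝ)) ∧
    -- the action of `e_i` on a concatenation
    (∀ π ∈ D.lsPaths lam, ∀ π' ∈ D.lsPaths mu, ∀ i η,
      D.e i (KacMoodyDatum.concat π π') = some η →
        (∃ σ ∈ D.lsPaths lam, D.e i π = some σ ∧ η = KacMoodyDatum.concat σ π') ∨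
        (∃ σ' ∈ D.lsPaths mu, D.e i π' = some σ' ∧ η = KacMoodyDatum.concat π σ')) ∧
    -- invariance under the root operators
    (∀ θ ∈ D.concatPaths lam mu, ∀ i η, (D.e i θ = some η ∨ D.f i θ = some η) →
      η ∈ D.concatPaths lam mu ∧ D.weylElement lam mu η = D.weylElement lam mu θ) ∧
    -- constancy on the classes of the equivalence relation
    Equivalence (D.Sim lam mu) ∧
    (∀ θ η : D.concatPaths lam mu, D.Sim lam mu θ η →
      D.weylElement lam mu θ.1 = D.weylElement lam mu η.1) ∧
    -- KK sets depend only on the double coset and are unions of equivalence classes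
    (∀ w w' : D.weylGroup,
      DoubleCoset.mk (D.stab lam) (D.stab mu) w = DoubleCoset.mk (D.stab lam) (D.stab mu) w' →
        D.kkSet lam mu w = D.kkSet lam mu w') ∧
    (∀ w : D.weylGroup, ∃ C : Set (Set (D.concatPaths lam mu)),
      (∀ c ∈ C, ∃ θ, c = {η | D.Sim lam mu θ η}) ∧ D.kkSet lam mu w = ⋃₀ C) := by
  refine ⟨fun π π' τ hτ φ hφ => ?_, fun θ hθ i t ht => ?_, fun π hπ π' hπ' i η he => ?_,
    fun θ hθ i η h => ?_, KacMoodyDatum.sim_equivalence hlam hmu,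
    fun θ η h => KacMoodyDatum.Sim.weylElement_eq hlam hmu h,
    fun w w' h => KacMoodyDatum.kkSet_eq_of_doubleCoset_eq hlam hmu h, fun w => ?_⟩
  · exact KacMoodyDatum.isBruhatMin_weylElement hlam hmu π.isLS π'.isLS hτ hφ
  · obtain ⟨π, hπ, π', hπ', rfl⟩ := hθ
    obtain ⟨a, b, hab⟩ := KacMoodyDatum.isLS_of_mem_lsPaths hπ
    obtain ⟨a', b', hab'⟩ := KacMoodyDatum.isLS_of_mem_lsPaths hπ'
    exact KacMoodyDatum.mem_ints.1
      (KacMoodyDatum.mem_ints_of_isLocalMin_concat hlam hmu hab hab' ht)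
  · obtain ⟨a, b, hab⟩ := KacMoodyDatum.isLS_of_mem_lsPaths hπ
    obtain ⟨a', b', hab'⟩ := KacMoodyDatum.isLS_of_mem_lsPaths hπ'
    rcases (hab.e_concat hlam hmu hab' he).1 with ⟨σ, c, d, hσ, h⟩ | ⟨σ', c, d, hσ', h⟩
    · exact Or.inl ⟨σ, hσ.mem_lsPaths hlam, h⟩
    · exact Or.inr ⟨σ', hσ'.mem_lsPaths hmu, h⟩
  · obtain ⟨h1, h2, -⟩ := KacMoodyDatum.related_spec hlam hmu hθ h
    exact ⟨h1, h2⟩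
  · refine ⟨{c | ∃ θ ∈ D.kkSet lam mu w, c = {η | D.Sim lam mu θ η}},
      fun c ⟨θ, _, hc⟩ => ⟨θ, hc⟩, Set.Subset.antisymm (fun θ hθ => ?_) ?_⟩
    · exact ⟨_, ⟨θ, hθ, rfl⟩, .refl⟩
    · rintro η ⟨_, ⟨θ, hθ, rfl⟩, hη⟩
      have : D.bruhatLE (D.weylElement lam mu θ.1) w := hθ
      rw [KacMoodyDatum.Sim.weylElement_eq hlam hmu hη] at this
      exact this
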